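/- Computation model: unit-cost real RAM (here even restricted to constants, addition, subtraction and comparison of integers and of reals, with indirect addressing by integers, all integers used having $O(\log n)$ bits; no bit manipulation, no conversion of reals into integers). A tree decomposition of a graph $G=(V,E)$ is a tree $T$ whose nodes carry bags (subsets of $V$) such that the bags cover $V$, every edge is contained in some bag, and for every vertex $v$ the nodes whose bags contain $v$ induce a (non-empty) subtree of $T$. A rooted tree decomposition is called suitable if (1) every bag has exactly $3$ vertices and any two adjacent bags share exactly $2$ vertices, and (2) any two links (tree edges) $(X_1,Y_1)$, $(X_2,Y_2)$, directed from father to child, with the same label $X_1\cap Y_1=X_2\cap Y_2$ have the same father, $X_1=X_2$. (A graph with such a decomposition is a partial $2$-tree.) A shortest path between $u$ and $v$ is a path of minimum total weight between them; for $u=v$ it is the path without edges. Let $G$ be a connected partial $2$-tree on $n$ vertices $0,\dots,n-1$ with a non-negative edge weight function $w:E\to\mathbb R_{\ge 0}$ and let $T$ be a suitable tree decomposition of $G$. The input lists the edges of $G$ with their weights and, for every bag of $T$, its three vertices and its father, all in arbitrary order. Then there is a data structure that uses $O(n)$ space, can be built in $O(n)$ time, and supports any sequence of the following queries, each given by two vertices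 $u$, $v$ and a bag $X$ of $T$ that contains $u$ and $v$, with absolute constants in all bounds: 1. (distance query) compute in time $O(1)$ the length (weight) of a shortest path between $u$ and $v$; 2. (intermediate vertex query) provided that every shortest path between $u$ and $v$ has at least two edges, compute in time $O(1)$ a vertex $z\notin\{u,v\}$ that lies on some shortest path between $u$ and $v$, together with a bag $Y$ of $T$ such that $Y=\{u,v,z\}$; 3. (shortest path extraction) compute a shortest path $P$ between $u$ and $v$, as the sequence of its vertices, in time $O(|E(P)|+1)$. -/

import Mathlib

/-! ## The machine model: a unit-cost real RAM

A structured presentation of the real RAM. A program is a finite piece of syntax and so mentions only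
finitely many variables and arrays. There are integer variables and arrays (cells hold natural
numbers) and real variables and arrays (cells hold real numbers). Integers can be added, subtracted
and compared and used as addresses; reals can be added, subtracted and compared. There is no way to
convert a real into an integer, no multiplication and no bit manipulation. -/

namespace RealRAM

/-- The memory. `nvar x` is integer variable number `x`, `narr A i` is cell `i` of integer array
number `A`; `rvar` and `rarr` are the same for reals. -/
structure State where
  nvar : ℕ → ℕ
  narr : ℕ → ℕ → ℕ
  rvar : ℕ → ℝ
  rarr : ℕ → ℕ → ℝ

/-- Integer expressions: constants, variables, array cells (indirect addressing), sum and
truncated difference. -/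
inductive NExp where
  | lit (k : ℕ)
  | var (x : ℕ)
  | get (A : ℕ) (i : NExp)
  | add (a b : NExp)
  | sub (a b : NExp)

namespace NExp

/-- The value of an integer expression. -/
def eval (s : State) : NExp → ℕ
  | lit k => k
  | var x => s.nvar x
  | get A i => s.narr A (i.eval s)
  | add a b => a.eval s + b.eval s
  | sub a b => a.eval s - b.eval s

/-- Evaluation time: one unit per constant, memory access and arithmetic operation. -/
def cost : NExp → ℕ
  | lit _ => 1
  | var _ => 1
  | get _ i => i.cost + 1
  | add a b => a.cost + b.cost + 1
  | sub a b => a.cost + b.cost + 1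

/-- Every integer occurring during the evaluation (in particular every address) is at most `B`. -/
def Fits (B : ℕ) (s : State) : NExp → Prop
  | lit k => k ≤ B
  | var x => s.nvar x ≤ B
  | get A i => i.Fits B s ∧ s.narr A (i.eval s) ≤ B
  | add a b => a.Fits B s ∧ b.Fits B s ∧ a.eval s + b.eval s ≤ B
  | sub a b => a.Fits B s ∧ b.Fits B s

end NExp

/-- Real expressions: rational constants, variables, array cells, sum and difference. -/
inductive RExp where
  | lit (q : ℚ)
  | var (x : ℕ)
  | get (A : ℕ) (i : NExp)
  | add (a b : RExp)
  | sub (a b : RExp)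

namespace RExp

/-- The value of a real expression. -/
noncomputable def eval (s : State) : RExp → ℝ
  | lit q => (q : ℝ)
  | var x => s.rvar x
  | get A i => s.rarr A (i.eval s)
  | add a b => a.eval s + b.eval s
  | sub a b => a.eval s - b.eval s

/-- Evaluation time. -/
def cost : RExp → ℕ
  | lit _ => 1
  | var _ => 1
  | get _ i => i.cost + 1
  | add a b => a.cost + b.cost + 1
  | sub a b => a.cost + b.cost + 1

/-- Every integer occurring during the evaluation is at most `B`. -/
def Fits (B : ℕ) (s : State) : RExp → Prop
  | lit _ => True
  | var _ => True
  | get _ i => i.Fits B s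
  | add a b => a.Fits B s ∧ b.Fits B s
  | sub a b => a.Fits B s ∧ b.Fits B s

end RExp

/-- Tests: comparisons of integers, comparison of reals, negation, conjunction. -/
inductive Test where
  | eq (a b : NExp)
  | lt (a b : NExp)
  | rlt (a b : RExp)
  | not (p : Test)
  | and (p q : Test)

namespace Test

/-- The truth value of a test. -/
def Holds (s : State) : Test → Prop
  | eq a b => a.eval s = b.eval s
  | lt a b => a.eval s < b.eval s
  | rlt a b => a.eval s < b.eval s
  | not p => ¬ p.Holds s
  | and p q => p.Holds s ∧ q.Holds s

/-- Evaluation time (both parts of a conjunction are evaluated). -/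
def cost : Test → ℕ
  | eq a b => a.cost + b.cost + 1
  | lt a b => a.cost + b.cost + 1
  | rlt a b => a.cost + b.cost + 1
  | not p => p.cost + 1
  | and p q => p.cost + q.cost + 1

/-- Every integer occurring during the evaluation is at most `B`. -/
def Fits (B : ℕ) (s : State) : Test → Prop
  | eq a b => a.Fits B s ∧ b.Fits B s
  | lt a b => a.Fits B s ∧ b.Fits B s
  | rlt a b => a.Fits B s ∧ b.Fits B s
  | not p => p.Fits B s
  | and p q => p.Fits B s ∧ q.Fits B s

end Test

/-- Programs. -/
inductive Cmd where
  | skip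
  | setN (x : ℕ) (e : NExp)
  | storeN (A : ℕ) (i e : NExp)
  | setR (x : ℕ) (e : RExp)
  | storeR (A : ℕ) (i : NExp) (e : RExp)
  | seq (c d : Cmd)
  | ite (p : Test) (c d : Cmd)
  | loop (p : Test) (c : Cmd)

/-- Write an integer variable. -/
def State.setN (s : State) (x k : ℕ) : State :=
  { s with nvar := Function.update s.nvar x k }

/-- Write a cell of an integer array. -/
def State.storeN (s : State) (A i k : ℕ) : State :=
  { s with narr := Function.update s.narr A (Function.update (s.narr A) i k) }

/-- Write a real variable. -/
def State.setR (s : State) (x : ℕ) (a : ℝ) : State :=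
  { s with rvar := Function.update s.rvar x a }

/-- Write a cell of a real array. -/
def State.storeR (s : State) (A i : ℕ) (a : ℝ) : State :=
  { s with rarr := Function.update s.rarr A (Function.update (s.rarr A) i a) }

/-- `Exec B c s t s'`: program `c`, started in `s`, halts in `s'` after exactly `t` time units, and
every integer occurring on the way is at most `B`. Addresses are integers, so such a run touches
only the cells `0, …, B` of each of the finitely many arrays that `c` mentions: it uses `O(B)`
memory cells, and integers of `O(log B)` bits. The loop is a while loop. The semantics is
deterministic. -/
inductive Exec (B : ℕ) : Cmd → State → ℕ → State → Prop where
  | skip (s : State) : Exec B .skip s 1 s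
  | setN (s : State) (x : ℕ) (e : NExp) (h : e.Fits B s) :
      Exec B (.setN x e) s (e.cost + 1) (s.setN x (e.eval s))
  | storeN (s : State) (A : ℕ) (i e : NExp) (hi : i.Fits B s) (he : e.Fits B s) :
      Exec B (.storeN A i e) s (i.cost + e.cost + 1) (s.storeN A (i.eval s) (e.eval s))
  | setR (s : State) (x : ℕ) (e : RExp) (h : e.Fits B s) :
      Exec B (.setR x e) s (e.cost + 1) (s.setR x (e.eval s))
  | storeR (s : State) (A : ℕ) (i : NExp) (e : RExp) (hi : i.Fits B s) (he : e.Fits B s) :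
      Exec B (.storeR A i e) s (i.cost + e.cost + 1) (s.storeR A (i.eval s) (e.eval s))
  | seq {c d : Cmd} {s s' s'' : State} {t t' : ℕ}
      (hc : Exec B c s t s') (hd : Exec B d s' t' s'') : Exec B (.seq c d) s (t + t') s''
  | iteTrue {p : Test} {c d : Cmd} {s s' : State} {t : ℕ} (hp : p.Fits B s) (h : p.Holds s)
      (hc : Exec B c s t s') : Exec B (.ite p c d) s (p.cost + 1 + t) s'
  | iteFalse {p : Test} {c d : Cmd} {s s' : State} {t : ℕ} (hp : p.Fits B s) (h : ¬ p.Holds s)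
      (hd : Exec B d s t s') : Exec B (.ite p c d) s (p.cost + 1 + t) s'
  | loopTrue {p : Test} {c : Cmd} {s s' s'' : State} {t t' : ℕ} (hp : p.Fits B s)
      (h : p.Holds s) (hc : Exec B c s t s') (hl : Exec B (.loop p c) s' t' s'') :
      Exec B (.loop p c) s (p.cost + 1 + t + t') s''
  | loopFalse {p : Test} {c : Cmd} {s : State} (hp : p.Fits B s) (h : ¬ p.Holds s) :
      Exec B (.loop p c) s (p.cost + 1) s

end RealRAM

/-! ## Shortest paths in weighted graphs -/

/-- The weight of a walk: the sum of the weights of its edges. -/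
def SimpleGraph.Walk.weight {V : Type*} {G : SimpleGraph V} (w : Sym2 V → ℝ) {u v : V}
    (P : G.Walk u v) : ℝ :=
  (P.edges.map w).sum

/-- `P` is a path from `u` to `v`, of minimum weight among all paths from `u` to `v`. -/
def SimpleGraph.Walk.IsShortestPath {V : Type*} {G : SimpleGraph V} (w : Sym2 V → ℝ) {u v : V}
    (P : G.Walk u v) : Prop :=
  P.IsPath ∧ ∀ Q : G.Walk u v, Q.IsPath → P.weight w ≤ Q.weight w

/-! ## Rooted tree decompositions -/

/-- A rooted tree with nodes `0, …, r - 1`, given by its root and the father of every node (by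
convention the root is its own father), where every node carries a bag of vertices of a graph on
`0, …, n - 1`. -/
structure RootedBagTree (n r : ℕ) where
  root : Fin r
  father : Fin r → Fin r
  bag : Fin r → Finset (Fin n)
  father_root : father root = root
  reaches_root : ∀ i, ∃ k : ℕ, father^[k] i = root

namespace RootedBagTree

variable {n r : ℕ}

/-- The underlying undirected tree: its links join every node other than the root to its father. -/
def links (T : RootedBagTree n r) : SimpleGraph (Fin r) :=
  SimpleGraph.fromRel fun i j => T.father i = j

/-- `T` is a tree decomposition of `G`: the bags cover the vertices, every edge lies in a bag, and
for every vertex the nodes whose bags contain it induce a subtree. -/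
structure IsTreeDecomposition (T : RootedBagTree n r) (G : SimpleGraph (Fin n)) : Prop where
  cover : ∀ v, ∃ i, v ∈ T.bag i
  edge : ∀ u v, G.Adj u v → ∃ i, u ∈ T.bag i ∧ v ∈ T.bag i
  subtree : ∀ v, (T.links.induce {i | v ∈ T.bag i}).Connected

/-- The label of the link from a node `i`, other than the root, to its father. -/
def label (T : RootedBagTree n r) (i : Fin r) : Finset (Fin n) :=
  T.bag (T.father i) ∩ T.bag i

/-- Suitability: all bags have size three, adjacent bags share exactly two vertices (smoothness),
and any two links with the same label have the same father. (A graph with such a tree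
decomposition has treewidth at most two, i.e. it is a partial 2-tree.) -/
structure IsSuitable (T : RootedBagTree n r) : Prop where
  card_bag : ∀ i, (T.bag i).card = 3
  card_label : ∀ i, i ≠ T.root → (T.label i).card = 2
  common_father : ∀ i j, i ≠ T.root → j ≠ T.root → T.label i = T.label j →
    T.father i = T.father j

end RootedBagTree

/-! ## Input format -/

/-- A listing of the input: the `m` edges of `G`, each exactly once, in any order and orientation,
and the three vertices of every bag of `T`, in any order. -/
structure InputListing {n r : ℕ} (G : SimpleGraph (Fin n)) (T : RootedBagTree n r) (m : ℕ) where
  src : Fin m → Fin n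
  tgt : Fin m → Fin n
  edge_injective : Function.Injective fun i => s(src i, tgt i)
  edge_range : Set.range (fun i => s(src i, tgt i)) = G.edgeSet
  vert : Fin 3 → Fin r → Fin n
  bag_eq : ∀ i, T.bag i = {vert 0 i, vert 1 i, vert 2 i}

/-- The content of an array holding a finite list of integers (zero beyond its end). -/
def arrayOf {k l : ℕ} (f : Fin k → Fin l) (i : ℕ) : ℕ :=
  if h : i < k then (f ⟨i, h⟩ : ℕ) else 0

/-- The initial memory. Integer variables: `0` holds `n`, `1` the number of edges, `2` the number of
bags, `3` the root. Integer arrays: `0` and `1` hold the two ends of every edge, `2`, `3`, `4` the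
three vertices of every bag, `5` the father of every bag. Real array `0` holds the edge weights.
All other memory is zero. -/
noncomputable def InputListing.initialState {n r m : ℕ} {G : SimpleGraph (Fin n)}
    {T : RootedBagTree n r} (I : InputListing G T m) (w : Sym2 (Fin n) → ℝ) : RealRAM.State where
  nvar
    | 0 => n
    | 1 => m
    | 2 => r
    | 3 => T.root
    | _ => 0
  narr
    | 0 => arrayOf I.src
    | 1 => arrayOf I.tgt
    | 2 => arrayOf (I.vert 0)
    | 3 => arrayOf (I.vert 1)
    | 4 => arrayOf (I.vert 2)
    | 5 => arrayOf T.father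
    | _ => fun _ => 0
  rvar := fun _ => 0
  rarr
    | 0 => fun i => if h : i < m then w s(I.src ⟨i, h⟩, I.tgt ⟨i, h⟩) else 0
    | _ => fun _ => 0

/-- Passing the arguments of a query (two vertices `u`, `v` and a bag `X`): integer variables `4`,
`5`, `6` are set to `u`, `v`, `X`; the rest of the memory stays as it is. -/
def RealRAM.State.withQuery {n r : ℕ} (s : RealRAM.State) (u v : Fin n) (X : Fin r) :
    RealRAM.State :=
  ((s.setN 4 u).setN 5 v).setN 6 X

/-! The data structure is a table with one entry for each pair of vertices that share a bag. An
entry is a lexicographic length (weight, number of edges). At the start an edge has its weight and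
count one; any other pair has `bigWeight`, which exceeds the weight of every path, and count one.
Suitability gives constant-time access: the topmost bag containing a pair is either the given bag or
its father (`rep_congr`), and this bag together with the position of its third vertex names the pair
(`idx_inj`).

Relaxing a bag improves each of its three pairs through the other two. All bags are relaxed once
with children before fathers and once in the reverse order. At most one pair of a bag also lies in
the father's bag (`sideRep_eq`). The upward pass makes the triangle inequality of this pair hold,
and relaxation never changes an entry whose inequality already holds. In the downward pass, relaxing
`c` therefore changes only pairs whose topmost bag is `c`, and these occur only in `c` and its
children. So the bags already treated stay closed (`Relaxed.upOK_of_eq`,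
`Relaxed.sideOK_of_father_ne`), and finally every triangle inequality inside a bag holds.

This closure determines the distances. Lower bound: on any walk, the vertex with the deepest topmost
bag has its neighbours in that bag, so it can be cut out by a triangle inequality (`le_listLength`).
Upper bound: an entry is either the initial length of an edge or the sum of the two other entries in
its witness bag (`Solved.witness`). The edge counts are positive and additive, so unfolding
witnesses ends even when weights are zero, and it yields a walk that is lexicographically minimal,
hence a path (`isShortestPath_of_walkLen_le`).

Path extraction unfolds witnesses with a stack. The unfolding is a binary tree with one leaf per
edge, so the time is linear in the output (`runs_pathLoop`). The programs are verified with a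
weakest-precondition calculus for loop-free code (`Cmd.wp_sound`), a while rule (`Runs.loop`) and
`Frame` conditions that say what a program leaves untouched. -/

namespace RealRAM

/-! ## Verification of programs -/

/-- Program `c`, started in `s`, halts within `T` time units in a state satisfying `Q`, and all
integers stay at most `B`. -/
def Runs (B : ℕ) (c : Cmd) (s : State) (T : ℕ) (Q : State → Prop) : Prop :=
  ∃ t s', t ≤ T ∧ Exec B c s t s' ∧ Q s'

infixr:60 " ;; " => Cmd.seq

/-- Disjunction of tests. -/
def Test.or (p q : Test) : Test := .not (.and (.not p) (.not q))

@[simp] theorem Test.holds_or (p q : Test) (s : State) :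
    (p.or q).Holds s ↔ p.Holds s ∨ q.Holds s := by
  simp only [Test.or, Test.Holds]; tauto

@[simp] theorem Test.fits_or (B : ℕ) (p q : Test) (s : State) :
    (p.or q).Fits B s ↔ p.Fits B s ∧ q.Fits B s := Iff.rfl

/-- Worst-case running time of a loop-free program. -/
def Cmd.time : Cmd → ℕ
  | .skip => 1
  | .setN _ e => e.cost + 1
  | .storeN _ i e => i.cost + e.cost + 1
  | .setR _ e => e.cost + 1
  | .storeR _ i e => i.cost + e.cost + 1
  | .seq c d => c.time + d.time
  | .ite p c d => p.cost + 1 + max c.time d.time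
  | .loop _ _ => 0

/-- Weakest precondition of a loop-free program. -/
def Cmd.wp (B : ℕ) : Cmd → (State → Prop) → State → Prop
  | .skip, Q, s => Q s
  | .setN x e, Q, s => e.Fits B s ∧ Q (s.setN x (e.eval s))
  | .storeN A i e, Q, s => i.Fits B s ∧ e.Fits B s ∧ Q (s.storeN A (i.eval s) (e.eval s))
  | .setR x e, Q, s => e.Fits B s ∧ Q (s.setR x (e.eval s))
  | .storeR A i e, Q, s => i.Fits B s ∧ e.Fits B s ∧ Q (s.storeR A (i.eval s) (e.eval s))
  | .seq c d, Q, s => c.wp B (d.wp B Q) s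
  | .ite p c d, Q, s => p.Fits B s ∧ (p.Holds s → c.wp B Q s) ∧ (¬ p.Holds s → d.wp B Q s)
  | .loop _ _, _, _ => False

theorem Cmd.wp_sound {B : ℕ} (c : Cmd) (Q : State → Prop) (s : State) (h : c.wp B Q s) :
    Runs B c s c.time Q := by
  induction c generalizing Q s with
  | skip => exact ⟨1, s, le_rfl, .skip s, h⟩
  | setN x e => exact ⟨_, _, le_rfl, .setN s x e h.1, h.2⟩
  | storeN A i e => exact ⟨_, _, le_rfl, .storeN s A i e h.1 h.2.1, h.2.2⟩
  | setR x e => exact ⟨_, _, le_rfl, .setR s x e h.1, h.2⟩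
  | storeR A i e => exact ⟨_, _, le_rfl, .storeR s A i e h.1 h.2.1, h.2.2⟩
  | seq c d ihc ihd =>
    obtain ⟨t, s', ht, hc, h'⟩ := ihc _ _ h
    obtain ⟨t', s'', ht', hd, h''⟩ := ihd _ _ h'
    exact ⟨_, _, Nat.add_le_add ht ht', .seq hc hd, h''⟩
  | ite p c d ihc ihd =>
    by_cases hp : p.Holds s
    · obtain ⟨t, s', ht, hc, h'⟩ := ihc _ _ (h.2.1 hp)
      exact ⟨_, _, by simp only [Cmd.time]; omega, .iteTrue h.1 hp hc, h'⟩
    · obtain ⟨t, s', ht, hc, h'⟩ := ihd _ _ (h.2.2 hp)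
      exact ⟨_, _, by simp only [Cmd.time]; omega, .iteFalse h.1 hp hc, h'⟩
  | loop p c => exact h.elim

theorem Cmd.wp_mono {B : ℕ} (c : Cmd) {Q Q' : State → Prop} {s : State} (h : c.wp B Q s)
    (hQ : ∀ s, Q s → Q' s) : c.wp B Q' s := by
  induction c generalizing Q Q' s with
  | skip => exact hQ _ h
  | setN x e => exact ⟨h.1, hQ _ h.2⟩
  | storeN A i e => exact ⟨h.1, h.2.1, hQ _ h.2.2⟩
  | setR x e => exact ⟨h.1, hQ _ h.2⟩
  | storeR A i e => exact ⟨h.1, h.2.1, hQ _ h.2.2⟩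
  | seq c d ihc ihd => exact ihc h fun s hs => ihd hs hQ
  | ite p c d ihc ihd => exact ⟨h.1, fun hp => ihc (h.2.1 hp) hQ, fun hp => ihd (h.2.2 hp) hQ⟩
  | loop p c => exact h.elim

theorem Runs.mono {B : ℕ} {c : Cmd} {s : State} {T T' : ℕ} {Q Q' : State → Prop}
    (h : Runs B c s T Q) (hT : T ≤ T') (hQ : ∀ s, Q s → Q' s) : Runs B c s T' Q' := by
  obtain ⟨t, s', ht, hc, h'⟩ := h
  exact ⟨t, s', ht.trans hT, hc, hQ _ h'⟩

theorem Runs.seq {B : ℕ} {c d : Cmd} {s : State} {T T' : ℕ} {Q R : State → Prop}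
    (hc : Runs B c s T Q) (hd : ∀ s, Q s → Runs B d s T' R) : Runs B (c ;; d) s (T + T') R := by
  obtain ⟨t, s', ht, hc, h'⟩ := hc
  obtain ⟨t', s'', ht', hd, h''⟩ := hd _ h'
  exact ⟨_, _, Nat.add_le_add ht ht', .seq hc hd, h''⟩

/-- One iteration of a loop with a loop-free body. -/
theorem Runs.loop_step {B : ℕ} {p : Test} {c : Cmd} {s : State} {T : ℕ} {Q R : State → Prop}
    (hf : p.Fits B s) (hp : p.Holds s) (hc : c.wp B R s)
    (hl : ∀ s', R s' → Runs B (.loop p c) s' T Q) :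
    Runs B (.loop p c) s (p.cost + 1 + c.time + T) Q := by
  obtain ⟨t, s', ht, hc, h'⟩ := Cmd.wp_sound _ _ _ hc
  obtain ⟨t', s'', ht', hd, h''⟩ := hl _ h'
  exact ⟨_, _, by omega, .loopTrue hf hp hc hd, h''⟩

theorem Runs.loop_done {B : ℕ} {p : Test} {c : Cmd} {s : State} {Q : State → Prop}
    (hf : p.Fits B s) (hp : ¬ p.Holds s) (hQ : Q s) :
    Runs B (.loop p c) s (p.cost + 1) Q :=
  ⟨_, _, le_rfl, .loopFalse hf hp, hQ⟩

/-- While rule: `I` is an invariant and `μ` bounds the number of iterations. -/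
theorem Runs.loop {B : ℕ} {p : Test} {c : Cmd} (I : State → Prop) (μ : State → ℕ)
    (hf : ∀ s, I s → p.Fits B s)
    (hc : ∀ s, I s → p.Holds s → c.wp B (fun s' => I s' ∧ μ s' < μ s) s)
    {s : State} (hs : I s) :
    Runs B (.loop p c) s ((μ s + 1) * (p.cost + 1 + c.time)) (fun s' => I s' ∧ ¬ p.Holds s') := by
  -- The extra unit in `μ s + 1` pays for the last test, which fails.
  induction hk : μ s using Nat.strong_induction_on generalizing s with
  | _ k ih =>
    by_cases hp : p.Holds s
    · have key := Runs.loop_step (T := k * (p.cost + 1 + c.time))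
        (Q := fun s' => I s' ∧ ¬ p.Holds s') (hf s hs) hp (hc s hs hp) fun s' hs' =>
          (ih (μ s') (hk ▸ hs'.2) hs'.1 rfl).mono
            (Nat.mul_le_mul_right _ (by omega)) fun _ h => h
      exact key.mono (by rw [Nat.add_mul, Nat.one_mul]; omega) fun _ h => h
    · exact (Runs.loop_done (hf s hs) hp ⟨hs, hp⟩).mono
        (by rw [Nat.add_mul, Nat.one_mul]; omega) fun _ h => h

/-! ### Reading a modified memory -/

section
variable (s : State) (x y A A' i k : ℕ) (a : ℝ)

@[simp] theorem State.setN_nvar : (s.setN x k).nvar y = if y = x then k else s.nvar y := by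
  simp [State.setN, Function.update_apply]
@[simp] theorem State.setN_narr : (s.setN x k).narr = s.narr := rfl
@[simp] theorem State.setN_rvar : (s.setN x k).rvar = s.rvar := rfl
@[simp] theorem State.setN_rarr : (s.setN x k).rarr = s.rarr := rfl
@[simp] theorem State.storeN_nvar : (s.storeN A i k).nvar = s.nvar := rfl
@[simp] theorem State.storeN_narr : (s.storeN A i k).narr A' =
    if A' = A then Function.update (s.narr A) i k else s.narr A' := by
  simp [State.storeN, Function.update_apply]
@[simp] theorem State.storeN_rvar : (s.storeN A i k).rvar = s.rvar := rfl
@[simp] theorem State.storeN_rarr : (s.storeN A i k).rarr = s.rarr := rfl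
@[simp] theorem State.setR_nvar : (s.setR x a).nvar = s.nvar := rfl
@[simp] theorem State.setR_narr : (s.setR x a).narr = s.narr := rfl
@[simp] theorem State.setR_rvar : (s.setR x a).rvar y = if y = x then a else s.rvar y := by
  simp [State.setR, Function.update_apply]
@[simp] theorem State.setR_rarr : (s.setR x a).rarr = s.rarr := rfl
@[simp] theorem State.storeR_nvar : (s.storeR A i a).nvar = s.nvar := rfl
@[simp] theorem State.storeR_narr : (s.storeR A i a).narr = s.narr := rfl
@[simp] theorem State.storeR_rvar : (s.storeR A i a).rvar = s.rvar := rfl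
@[simp] theorem State.storeR_rarr : (s.storeR A i a).rarr A' =
    if A' = A then Function.update (s.rarr A) i a else s.rarr A' := by
  simp [State.storeR, Function.update_apply]

end

/-- `s` differs from `s₀` at most in the integer variables `ns`, integer arrays `as`, real
variables `xs` and real arrays `rs`. -/
structure Frame (ns as xs rs : List ℕ) (s₀ s : State) : Prop where
  nvar : ∀ x, x ∉ ns → s.nvar x = s₀.nvar x
  narr : ∀ A, A ∉ as → s.narr A = s₀.narr A
  rvar : ∀ x, x ∉ xs → s.rvar x = s₀.rvar x
  rarr : ∀ A, A ∉ rs → s.rarr A = s₀.rarr A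

namespace Frame

variable {ns as xs rs : List ℕ} {s₀ s s' : State}

theorem refl (s : State) : Frame ns as xs rs s s :=
  ⟨fun _ _ => rfl, fun _ _ => rfl, fun _ _ => rfl, fun _ _ => rfl⟩

theorem trans (h : Frame ns as xs rs s₀ s) (h' : Frame ns as xs rs s s') :
    Frame ns as xs rs s₀ s' :=
  ⟨fun x hx => (h'.nvar x hx).trans (h.nvar x hx), fun x hx => (h'.narr x hx).trans (h.narr x hx),
    fun x hx => (h'.rvar x hx).trans (h.rvar x hx), fun x hx => (h'.rarr x hx).trans (h.rarr x hx)⟩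

theorem weaken {ns' as' xs' rs' : List ℕ} (h : Frame ns as xs rs s₀ s) (h1 : ns ⊆ ns')
    (h2 : as ⊆ as') (h3 : xs ⊆ xs') (h4 : rs ⊆ rs') : Frame ns' as' xs' rs' s₀ s :=
  ⟨fun x hx => h.nvar x fun h' => hx (h1 h'), fun x hx => h.narr x fun h' => hx (h2 h'),
    fun x hx => h.rvar x fun h' => hx (h3 h'), fun x hx => h.rarr x fun h' => hx (h4 h')⟩

theorem setN (h : Frame ns as xs rs s₀ s) {x : ℕ} (hx : x ∈ ns) (k : ℕ) :
    Frame ns as xs rs s₀ (s.setN x k) :=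
  ⟨fun y hy => by rw [State.setN_nvar, if_neg (by rintro rfl; exact hy hx), h.nvar y hy],
    h.narr, h.rvar, h.rarr⟩

theorem storeN (h : Frame ns as xs rs s₀ s) {A : ℕ} (hA : A ∈ as) (i k : ℕ) :
    Frame ns as xs rs s₀ (s.storeN A i k) :=
  ⟨h.nvar, fun y hy => by rw [State.storeN_narr, if_neg (by rintro rfl; exact hy hA), h.narr y hy],
    h.rvar, h.rarr⟩

theorem setR (h : Frame ns as xs rs s₀ s) {x : ℕ} (hx : x ∈ xs) (a : ℝ) :
    Frame ns as xs rs s₀ (s.setR x a) :=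
  ⟨h.nvar, h.narr,
    fun y hy => by rw [State.setR_rvar, if_neg (by rintro rfl; exact hy hx), h.rvar y hy], h.rarr⟩

theorem storeR (h : Frame ns as xs rs s₀ s) {A : ℕ} (hA : A ∈ rs) (i : ℕ) (a : ℝ) :
    Frame ns as xs rs s₀ (s.storeR A i a) :=
  ⟨h.nvar, h.narr, h.rvar,
    fun y hy => by rw [State.storeR_rarr, if_neg (by rintro rfl; exact hy hA), h.rarr y hy]⟩

end Frame

end RealRAM

/-! ## Combinatorics of suitable tree decompositions -/

namespace RootedBagTree

variable {n r : ℕ} (T : RootedBagTree n r)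

/-- The distance of a node from the root. -/
noncomputable def depth (i : Fin r) : ℕ :=
  open Classical in Nat.find (T.reaches_root i)

theorem depth_father {i : Fin r} (hi : i ≠ T.root) : T.depth i = T.depth (T.father i) + 1 := by
  classical
  unfold depth
  exact Nat.find_comp_succ (T.reaches_root i) (T.reaches_root (T.father i)) (by simpa using hi)

theorem depth_father_lt {i : Fin r} (hi : i ≠ T.root) : T.depth (T.father i) < T.depth i := by
  rw [T.depth_father hi]; exact Nat.lt_succ_self _

theorem father_ne {i : Fin r} (hi : i ≠ T.root) : T.father i ≠ i := fun h => by
  have := T.depth_father_lt hi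
  rw [h] at this
  exact lt_irrefl _ this

/-- Used to compare ancestors: two nodes that are ancestors of each other must coincide. -/
theorem eq_or_depth_lt {i j : Fin r} {k : ℕ} (h : T.father^[k] i = j) :
    i = j ∨ T.depth j < T.depth i := by
  induction k generalizing i with
  | zero => exact Or.inl h
  | succ k ih =>
    by_cases hi : i = T.root
    · rw [hi, Function.iterate_fixed T.father_root] at h
      exact Or.inl (hi.trans h)
    · have := T.depth_father_lt hi
      rcases ih (i := T.father i) h with h' | h'
      · exact Or.inr (h' ▸ this)
      · exact Or.inr (h'.trans this)

/-- Node `c` is the topmost node whose bag contains `v`. -/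
def IsTop (v : Fin n) (c : Fin r) : Prop :=
  v ∈ T.bag c ∧ (c = T.root ∨ v ∉ T.bag (T.father c))

variable {T} {G : SimpleGraph (Fin n)}

/-! ### Topmost bags of vertices and of pairs -/

namespace IsTreeDecomposition

/-- Follow a walk from `b` to `c` inside the subtree of `v` backwards. Having `c` as an ancestor
could be lost only by stepping from `c` to its father, and that bag does not contain `v`. -/
theorem descends (hT : T.IsTreeDecomposition G) {v : Fin n} {c b : Fin r} (hc : T.IsTop v c)
    (hb : v ∈ T.bag b) : ∃ k, T.father^[k] b = c := by
  have hcon := (hT.subtree v).preconnected ⟨c, hc.1⟩ ⟨b, hb⟩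
  obtain ⟨p⟩ := hcon.symm
  suffices H : ∀ (x y : {i | v ∈ T.bag i}) (p : (T.links.induce {i | v ∈ T.bag i}).Walk x y),
      (∃ k, T.father^[k] y.1 = c) → ∃ k, T.father^[k] x.1 = c from H _ _ p ⟨0, rfl⟩
  intro x y p
  induction p with
  | nil => exact id
  | @cons a b' _ h p ih =>
    intro hy
    obtain ⟨k, hk⟩ := ih hy
    have hadj : T.links.Adj a.1 b'.1 := h
    rw [links, SimpleGraph.fromRel_adj] at hadj
    obtain ⟨hne, h1 | h1⟩ := hadj
    · exact ⟨k + 1, by rw [Function.iterate_succ_apply, h1, hk]⟩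
    · cases k with
      | zero =>
        have hk : b'.1 = c := hk
        rcases hc.2 with h2 | h2
        · rw [hk, h2, T.father_root] at h1
          exact absurd (h1.symm.trans (h2.symm.trans hk.symm)) hne
        · rw [hk] at h1
          exact absurd (h1 ▸ a.2) h2
      | succ k => exact ⟨k, by rw [← h1, ← Function.iterate_succ_apply, hk]⟩

theorem isTop_unique (hT : T.IsTreeDecomposition G) {v : Fin n} {c b : Fin r}
    (hc : T.IsTop v c) (hb : T.IsTop v b) : b = c := by
  obtain ⟨k, hk⟩ := hT.descends hc hb.1
  obtain ⟨l, hl⟩ := hT.descends hb hc.1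
  rcases T.eq_or_depth_lt hk with h | h
  · exact h
  · rcases T.eq_or_depth_lt hl with h' | h'
    · exact h'.symm
    · omega

theorem exists_isTop (hT : T.IsTreeDecomposition G) (v : Fin n) : ∃ c, T.IsTop v c := by
  obtain ⟨b, hb⟩ := hT.cover v
  induction hd : T.depth b using Nat.strong_induction_on generalizing b with
  | _ d ih =>
    by_cases h : T.IsTop v b
    · exact ⟨b, h⟩
    · simp only [IsTop, hb, true_and, not_or, not_not] at h
      exact ih _ (hd ▸ T.depth_father_lt h.1) _ h.2 rfl

/-- The topmost node whose bag contains `v`. -/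
noncomputable def top (hT : T.IsTreeDecomposition G) (v : Fin n) : Fin r :=
  (hT.exists_isTop v).choose

theorem isTop_top (hT : T.IsTreeDecomposition G) (v : Fin n) : T.IsTop v (hT.top v) :=
  (hT.exists_isTop v).choose_spec

theorem depth_top_le (hT : T.IsTreeDecomposition G) {v : Fin n} {b : Fin r} (hb : v ∈ T.bag b) :
    T.depth (hT.top v) ≤ T.depth b := by
  obtain ⟨k, hk⟩ := hT.descends (hT.isTop_top v) hb
  rcases T.eq_or_depth_lt hk with h | h
  · rw [h]
  · exact h.le

theorem mem_father (hT : T.IsTreeDecomposition G) {v : Fin n} {b : Fin r} (hb : v ∈ T.bag b)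
    (hne : b ≠ hT.top v) : b ≠ T.root ∧ v ∈ T.bag (T.father b) := by
  by_contra h
  exact hne (hT.isTop_unique (hT.isTop_top v) ⟨hb, by tauto⟩)

/-- Climb from `b` to the top of `u`. The top of `v` is not deeper, so `v` is not lost on the way.
-/
theorem mem_bag_top (hT : T.IsTreeDecomposition G) {u v : Fin n} {b : Fin r} (hu : u ∈ T.bag b)
    (hv : v ∈ T.bag b) (h : T.depth (hT.top v) ≤ T.depth (hT.top u)) :
    v ∈ T.bag (hT.top u) := by
  induction hd : T.depth b using Nat.strong_induction_on generalizing b with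
  | _ d ih =>
    by_cases hbu : b = hT.top u
    · exact hbu ▸ hv
    · obtain ⟨hr, hu'⟩ := hT.mem_father hu hbu
      have hlt := T.depth_father_lt hr
      have hbv : b ≠ hT.top v := by
        rintro rfl
        have := hT.depth_top_le hu'
        omega
      exact ih _ (hd ▸ hlt) hu' (hT.mem_father hv hbv).2 rfl

/-- The node `t` is the top of whichever of the two vertices has the deeper top; by `mem_bag_top`
its bag contains both. -/
theorem exists_pairTop (hT : T.IsTreeDecomposition G) {u v : Fin n} {b : Fin r} (hu : u ∈ T.bag b)
    (hv : v ∈ T.bag b) : ∃ t, u ∈ T.bag t ∧ v ∈ T.bag t ∧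
      (t = T.root ∨ ¬ (u ∈ T.bag (T.father t) ∧ v ∈ T.bag (T.father t))) ∧
      ∀ c, u ∈ T.bag c → v ∈ T.bag c → c ≠ t →
        c ≠ T.root ∧ u ∈ T.bag (T.father c) ∧ v ∈ T.bag (T.father c) := by
  wlog h : T.depth (hT.top v) ≤ T.depth (hT.top u) generalizing u v
  · obtain ⟨t, h1, h2, h3, h4⟩ := this hv hu (le_of_not_ge h)
    refine ⟨t, h2, h1, by tauto, fun c hc hc' hne => ?_⟩
    have := h4 c hc' hc hne
    tauto
  refine ⟨hT.top u, (hT.isTop_top u).1, hT.mem_bag_top hu hv h,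
    (hT.isTop_top u).2.imp_right (by tauto), fun c hc hc' hne => ?_⟩
  obtain ⟨hr, hu'⟩ := hT.mem_father hc hne
  refine ⟨hr, hu', (hT.mem_father hc' ?_).2⟩
  rintro rfl
  have h1 := hT.depth_top_le hu'
  have h2 := T.depth_father_lt hr
  omega

end IsTreeDecomposition

/-! ### The topmost bag of a pair in constant time, and the number of bags -/

variable (T) in
/-- The topmost node whose bag contains `u` and `v`, computed from any node with this property. -/
def rep (u v : Fin n) (c : Fin r) : Fin r :=
  if u ∈ T.bag (T.father c) ∧ v ∈ T.bag (T.father c) then T.father c else c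

theorem rep_comm (u v : Fin n) (c : Fin r) : T.rep u v c = T.rep v u c := by
  simp only [rep, and_comm]

theorem rep_eq_or (u v : Fin n) (c : Fin r) : T.rep u v c = c ∨ T.rep u v c = T.father c := by
  unfold rep; split_ifs <;> simp

theorem left_mem_rep {u v : Fin n} {c : Fin r} (hu : u ∈ T.bag c) : u ∈ T.bag (T.rep u v c) := by
  unfold rep; split_ifs with h
  · exact h.1
  · exact hu

theorem right_mem_rep {u v : Fin n} {c : Fin r} (hv : v ∈ T.bag c) : v ∈ T.bag (T.rep u v c) := by
  rw [rep_comm]; exact left_mem_rep hv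

theorem IsSuitable.label_eq (hs : T.IsSuitable) {u v : Fin n} (huv : u ≠ v) {c : Fin r}
    (hc : c ≠ T.root) (hu : u ∈ T.bag c) (hv : v ∈ T.bag c) (hu' : u ∈ T.bag (T.father c))
    (hv' : v ∈ T.bag (T.father c)) : T.label c = {u, v} := by
  symm
  apply Finset.eq_of_subset_of_card_le
  · intro x hx
    simp only [Finset.mem_insert, Finset.mem_singleton] at hx
    rcases hx with rfl | rfl <;> simp [label, *]
  · rw [hs.card_label c hc, Finset.card_pair huv]

/-- One step upwards always suffices. Suppose the father `f` of `c` contains the pair but is not the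
topmost such bag. Then the links above `c` and above `f` both have the label `{u, v}`, so
`common_father` makes `f` its own father, although it is not the root. -/
theorem rep_congr (hT : T.IsTreeDecomposition G) (hs : T.IsSuitable) {u v : Fin n} (huv : u ≠ v)
    {b c : Fin r} (hub : u ∈ T.bag b) (hvb : v ∈ T.bag b) (huc : u ∈ T.bag c)
    (hvc : v ∈ T.bag c) : T.rep u v b = T.rep u v c := by
  obtain ⟨t, hu, hv, ht, H⟩ := hT.exists_pairTop hub hvb
  suffices key : ∀ c, u ∈ T.bag c → v ∈ T.bag c → T.rep u v c = t by
    rw [key b hub hvb, key c huc hvc]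
  intro c huc hvc
  by_cases hct : c = t
  · subst hct
    unfold rep
    split_ifs with h
    · rcases ht with rfl | ht
      · exact T.father_root
      · exact absurd h ht
    · rfl
  · obtain ⟨hr, hu', hv'⟩ := H c huc hvc hct
    rw [rep, if_pos ⟨hu', hv'⟩]
    by_contra hft
    obtain ⟨hr', hu'', hv''⟩ := H _ hu' hv' hft
    have := hs.common_father c (T.father c) hr hr'
      ((hs.label_eq huv hr huc hvc hu' hv').trans (hs.label_eq huv hr' hu' hv' hu'' hv'').symm)
    exact T.father_ne hr' this.symm

/-- Every node is the top of some vertex, because a bag has three vertices and its label only two. A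
vertex has only one top, so choosing such a vertex for each node is injective. -/
theorem IsSuitable.card_nodes_le (hT : T.IsTreeDecomposition G) (hs : T.IsSuitable) : r ≤ n := by
  have H : ∀ c, ∃ v, T.IsTop v c := by
    intro c
    by_cases hc : c = T.root
    · obtain ⟨v, hv⟩ : (T.bag c).Nonempty := Finset.card_pos.1 (by rw [hs.card_bag]; norm_num)
      exact ⟨v, hv, Or.inl hc⟩
    · by_contra! h
      have hsub : T.bag c ⊆ T.label c := fun v hv => by
        have := h v
        simp only [IsTop, hv, true_and, hc, false_or, not_not] at this
        simp [label, hv, this]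
      have := Finset.card_le_card hsub
      rw [hs.card_bag, hs.card_label c hc] at this
      omega
  choose f hf using H
  simpa using Fintype.card_le_of_injective f fun a b hab =>
    hT.isTop_unique (hab ▸ hf b) (hf a)

theorem IsSuitable.three_le (hs : T.IsSuitable) : 3 ≤ n := by
  have := Finset.card_le_univ (T.bag T.root)
  rwa [hs.card_bag, Fintype.card_fin] at this

end RootedBagTree

/-! ## Identifiers of pairs of vertices with a common bag -/

namespace InputListing

open RootedBagTree

variable {n r m : ℕ} {G : SimpleGraph (Fin n)} {T : RootedBagTree n r} (I : InputListing G T m)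

/-- The position in bag `c` of the vertex other than `u` and `v`. -/
def third (u v : Fin n) (c : Fin r) : Fin 3 :=
  if I.vert 0 c ≠ u ∧ I.vert 0 c ≠ v then 0 else if I.vert 1 c ≠ u ∧ I.vert 1 c ≠ v then 1 else 2

/-- The identifier of the pair `u`, `v`, computed from a bag `c` that contains it. -/
def idx (u v : Fin n) (c : Fin r) : ℕ :=
  3 * (T.rep u v c : ℕ) + I.third u v (T.rep u v c)

theorem third_comm (u v : Fin n) (c : Fin r) : I.third u v c = I.third v u c := by
  simp only [third, and_comm]

theorem idx_comm (u v : Fin n) (c : Fin r) : I.idx u v c = I.idx v u c := by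
  simp only [idx, I.third_comm u v, rep_comm u v]

theorem mem_bag_iff (v : Fin n) (c : Fin r) :
    v ∈ T.bag c ↔ v = I.vert 0 c ∨ v = I.vert 1 c ∨ v = I.vert 2 c := by
  simp [I.bag_eq]

theorem vert_mem (k : Fin 3) (c : Fin r) : I.vert k c ∈ T.bag c := by
  rw [I.mem_bag_iff]; fin_cases k <;> simp

theorem exists_vert {v : Fin n} {c : Fin r} (h : v ∈ T.bag c) : ∃ k, v = I.vert k c := by
  rw [I.mem_bag_iff] at h
  rcases h with h | h | h
  exacts [⟨0, h⟩, ⟨1, h⟩, ⟨2, h⟩]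

theorem vert_injective (hs : T.IsSuitable) (c : Fin r) :
    Function.Injective fun k => I.vert k c := by
  have h : (Finset.univ.image fun k => I.vert k c).card = (Finset.univ : Finset (Fin 3)).card := by
    refine Eq.trans ?_ (hs.card_bag c)
    rw [I.bag_eq c]
    congr 1
    ext x
    simp [Fin.exists_fin_succ, eq_comm]
  exact fun a b hab => Finset.injOn_of_card_image_eq h (by simp) (by simp) hab

theorem vert_inj (hs : T.IsSuitable) {c : Fin r} {j k : Fin 3} :
    I.vert j c = I.vert k c ↔ j = k :=
  (I.vert_injective hs c).eq_iff

theorem bag_eq_third (hs : T.IsSuitable) {u v : Fin n} (huv : u ≠ v) {c : Fin r}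
    (hu : u ∈ T.bag c) (hv : v ∈ T.bag c) :
    T.bag c = {u, v, I.vert (I.third u v c) c} ∧ I.vert (I.third u v c) c ≠ u ∧
      I.vert (I.third u v c) c ≠ v := by
  obtain ⟨i, rfl⟩ := I.exists_vert hu
  obtain ⟨j, rfl⟩ := I.exists_vert hv
  rw [I.bag_eq]
  simp only [third, ne_eq, I.vert_inj hs] at huv ⊢
  revert huv
  fin_cases i <;> fin_cases j <;>
    simp [I.vert_inj hs, Finset.ext_iff] <;> tauto

theorem idx_congr (hT : T.IsTreeDecomposition G) (hs : T.IsSuitable) {u v : Fin n} (huv : u ≠ v)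
    {b c : Fin r} (hub : u ∈ T.bag b) (hvb : v ∈ T.bag b) (huc : u ∈ T.bag c)
    (hvc : v ∈ T.bag c) : I.idx u v b = I.idx u v c := by
  rw [idx, idx, rep_congr hT hs huv hub hvb huc hvc]

theorem rep_eq_of_idx_eq {u v u' v' : Fin n} {b c : Fin r} (h : I.idx u v b = I.idx u' v' c) :
    T.rep u v b = T.rep u' v' c := by
  have h1 := (I.third u v (T.rep u v b)).is_lt
  have h2 := (I.third u' v' (T.rep u' v' c)).is_lt
  unfold idx at h
  exact Fin.ext (by omega)

/-- The identifier determines the topmost bag (quotient by 3) and the position of the third vertex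
(remainder); the pair is what remains of that bag. -/
theorem idx_inj (hs : T.IsSuitable) {u v u' v' : Fin n} (huv : u ≠ v) (huv' : u' ≠ v')
    {b c : Fin r} (hub : u ∈ T.bag b) (hvb : v ∈ T.bag b) (huc : u' ∈ T.bag c)
    (hvc : v' ∈ T.bag c) (h : I.idx u v b = I.idx u' v' c) : s(u, v) = s(u', v') := by
  have hr := I.rep_eq_of_idx_eq h
  have hk : I.third u v (T.rep u v b) = I.third u' v' (T.rep u' v' c) := by
    unfold idx at h
    exact Fin.ext (by rw [hr] at h ⊢; omega)
  obtain ⟨h1, h2, h3⟩ := I.bag_eq_third hs huv (left_mem_rep (v := v) hub) (right_mem_rep hvb)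
  obtain ⟨h1', h2', h3'⟩ := I.bag_eq_third hs huv' (left_mem_rep (v := v') huc)
    (right_mem_rep hvc)
  rw [hk, hr] at h1 h2 h3
  rw [h1'] at h1
  set z := I.vert (I.third u' v' (T.rep u' v' c)) (T.rep u' v' c)
  have hu : u ∈ ({u', v', z} : Finset (Fin n)) := by rw [h1]; simp
  have hv : v ∈ ({u', v', z} : Finset (Fin n)) := by rw [h1]; simp
  simp only [Finset.mem_insert, Finset.mem_singleton] at hu hv
  rw [Sym2.eq_iff]
  rcases hu with rfl | rfl | rfl <;> rcases hv with rfl | rfl | rfl <;> simp_all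

theorem idx_lt (u v : Fin n) (c : Fin r) : I.idx u v c < 3 * r := by
  have h1 := (I.third u v (T.rep u v c)).is_lt
  have h2 := (T.rep u v c).is_lt
  unfold idx
  omega

theorem adj_of_edge (i : Fin m) : G.Adj (I.src i) (I.tgt i) := by
  have : s(I.src i, I.tgt i) ∈ G.edgeSet := I.edge_range ▸ ⟨i, rfl⟩
  exact this

/-- Distinct edges have distinct identifiers, all below `3 * r`. -/
theorem card_edges_le (I : InputListing G T m) (hT : T.IsTreeDecomposition G) (hs : T.IsSuitable) : m ≤ 3 * r := by
  choose b hb using fun i => hT.edge _ _ (I.adj_of_edge i)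
  have := Fintype.card_le_of_injective
    (fun i : Fin m => (⟨I.idx (I.src i) (I.tgt i) (b i), I.idx_lt _ _ _⟩ : Fin (3 * r)))
    fun i j hij => I.edge_injective (I.idx_inj hs (I.adj_of_edge i).ne (I.adj_of_edge j).ne
      (hb i).1 (hb i).2 (hb j).1 (hb j).2 (Fin.ext_iff.1 hij))
  simpa using this

/-- The identifier of the pair opposite to the `k`-th vertex of bag `c`. -/
def side (c : Fin r) (k : Fin 3) : ℕ :=
  I.idx (I.vert (k + 1) c) (I.vert (k + 2) c) c

/-- The topmost bag containing the pair opposite to the `k`-th vertex of bag `c`. -/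
def sideRep (c : Fin r) (k : Fin 3) : Fin r :=
  T.rep (I.vert (k + 1) c) (I.vert (k + 2) c) c

theorem idx_vert (c : Fin r) {i j k : Fin 3} (hij : i ≠ j) (hik : i ≠ k) (hjk : j ≠ k) :
    I.idx (I.vert i c) (I.vert j c) c = I.side c k := by
  revert hij hik hjk
  fin_cases i <;> fin_cases j <;> fin_cases k <;> simp [side] <;> first
    | rfl
    | exact I.idx_comm _ _ _

theorem sideRep_eq_or (c : Fin r) (k : Fin 3) :
    I.sideRep c k = c ∨ I.sideRep c k = T.father c :=
  rep_eq_or _ _ _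

theorem sideRep_eq_of_side_eq {b c : Fin r} {j k : Fin 3} (h : I.side b j = I.side c k) :
    I.sideRep b j = I.sideRep c k :=
  I.rep_eq_of_idx_eq h

theorem side_injective (hs : T.IsSuitable) (c : Fin r) : Function.Injective (I.side c) := by
  have key : ∀ k : Fin 3, k + 1 ≠ k + 2 := by decide
  have key' : ∀ j k : Fin 3,
      j + 1 = k + 1 ∧ j + 2 = k + 2 ∨ j + 1 = k + 2 ∧ j + 2 = k + 1 → j = k := by decide
  intro j k h
  have hne : ∀ k : Fin 3, I.vert (k + 1) c ≠ I.vert (k + 2) c := fun k h =>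
    key k (I.vert_injective hs c h)
  have := I.idx_inj hs (hne j) (hne k) (I.vert_mem _ _) (I.vert_mem _ _) (I.vert_mem _ _)
    (I.vert_mem _ _) h
  rw [Sym2.eq_iff, I.vert_inj hs, I.vert_inj hs, I.vert_inj hs, I.vert_inj hs] at this
  exact key' j k this

/-- At most one side of a bag lies in its father: two sides together cover all three vertices, but
only two vertices are shared with the father. -/
theorem sideRep_eq (hs : T.IsSuitable) {c : Fin r} {j k : Fin 3} (hjk : k ≠ j)
    (h : I.sideRep c j ≠ c) : I.sideRep c k = c := by
  by_contra h'
  have H : ∀ k, I.sideRep c k ≠ c → I.vert (k + 1) c ∈ T.bag (T.father c) ∧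
      I.vert (k + 2) c ∈ T.bag (T.father c) := fun k hk => by
    by_contra hn
    exact hk (if_neg hn)
  have hr : c ≠ T.root := by
    rintro rfl
    rcases I.sideRep_eq_or T.root j with h1 | h1
    · exact h h1
    · exact h (h1.trans T.father_root)
  have h1 := H j h
  have h2 := H k h'
  have hsub : T.bag c ⊆ T.label c := by
    intro v hv
    rw [label, Finset.mem_inter]
    refine ⟨?_, hv⟩
    obtain ⟨i, rfl⟩ := I.exists_vert hv
    have : i = j + 1 ∨ i = j + 2 ∨ i = k + 1 ∨ i = k + 2 := by
      revert hjk; clear * -; revert i j k; decide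
    rcases this with rfl | rfl | rfl | rfl
    exacts [h1.1, h1.2, h2.1, h2.2]
  have := Finset.card_le_card hsub
  rw [hs.card_bag, hs.card_label c hr] at this
  omega

end InputListing

/-! ## Relaxation of triangles -/

/-- A table of tentative distances of pairs, with the bag that caused the last change (`0` stands
for none, `x + 1` for bag `x`). -/
structure DistTable (K : Type*) where
  dist : ℕ → K
  wit : ℕ → ℕ

namespace DistTable

variable {K : Type*} [AddCommGroup K] [LinearOrder K]

/-- Try to improve entry `a` by going through entries `b` and `e` of bag `x`. -/
def relaxSide (x a b e : ℕ) (t : DistTable K) : DistTable K :=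
  if t.dist b + t.dist e < t.dist a then
    ⟨Function.update t.dist a (t.dist b + t.dist e), Function.update t.wit a (x + 1)⟩
  else t

theorem relaxSide_dist (x a b e : ℕ) (t : DistTable K) : (t.relaxSide x a b e).dist =
    Function.update t.dist a (min (t.dist a) (t.dist b + t.dist e)) := by
  unfold relaxSide
  split_ifs with h
  · rw [min_eq_right h.le]
  · rw [min_eq_left (not_lt.1 h), Function.update_eq_self]

end DistTable

namespace InputListing

variable {n r m : ℕ} {G : SimpleGraph (Fin n)} {T : RootedBagTree n r} (I : InputListing G T m)
variable {K : Type*} [AddCommGroup K] [LinearOrder K]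

/-- Improve the `k`-th side of bag `c` using the two other sides. -/
def relaxSide (c : Fin r) (k : Fin 3) (t : DistTable K) : DistTable K :=
  t.relaxSide c (I.side c k) (I.side c (k + 1)) (I.side c (k + 2))

/-- Improve the three sides of a bag, one after the other. -/
def relaxBag (c : Fin r) (t : DistTable K) : DistTable K :=
  I.relaxSide c 2 (I.relaxSide c 1 (I.relaxSide c 0 t))

/-- The `k`-th side of bag `c` satisfies the triangle inequality. -/
def SideOK (d : ℕ → K) (c : Fin r) (k : Fin 3) : Prop :=
  d (I.side c k) ≤ d (I.side c (k + 1)) + d (I.side c (k + 2))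

/-- The entries are lengths in `P`, at most the initial ones, and explained by their witnesses. -/
structure Consistent (P : K → Prop) (d₀ : ℕ → K) (t : DistTable K) : Prop where
  isLen : ∀ c k, P (t.dist (I.side c k))
  le : ∀ i, t.dist i ≤ d₀ i
  wit : ∀ i, (t.wit i = 0 ∧ t.dist i = d₀ i) ∨ ∃ c k, I.side c k = i ∧ t.wit i = (c : ℕ) + 1 ∧
    t.dist (I.side c (k + 1)) + t.dist (I.side c (k + 2)) ≤ t.dist i

variable {I} [IsOrderedAddMonoid K] {P : K → Prop} {d₀ : ℕ → K} {t : DistTable K}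

/-- Entries only decrease, so an old witness inequality (two other sides sum to at most this one)
survives later changes of those two sides. An equality would not survive. -/
theorem Consistent.relaxSide (hs : T.IsSuitable) (hadd : ∀ x y, P x → P y → P (x + y))
    (h : I.Consistent P d₀ t) (c : Fin r) (k : Fin 3) :
    I.Consistent P d₀ (I.relaxSide c k t) := by
  unfold InputListing.relaxSide DistTable.relaxSide
  split_ifs with hlt
  swap
  · exact h
  have hle : ∀ i, Function.update t.dist (I.side c k)
      (t.dist (I.side c (k + 1)) + t.dist (I.side c (k + 2))) i ≤ t.dist i := fun i => by
    by_cases hi : i = I.side c k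
    · subst hi; simpa using hlt.le
    · simp [hi]
  refine ⟨fun c' k' => ?_, fun i => (hle i).trans (h.le i), fun i => ?_⟩
  · by_cases hi : I.side c' k' = I.side c k
    · simp only [hi, Function.update_self]
      exact hadd _ _ (h.isLen _ _) (h.isLen _ _)
    · simpa [hi] using h.isLen c' k'
  · by_cases hi : i = I.side c k
    · subst hi
      refine Or.inr ⟨c, k, rfl, by simp, ?_⟩
      -- The two summands are entries other than the updated one, so the new entry equals their
      -- current sum.
      have h1 : I.side c (k + 1) ≠ I.side c k := fun h => by simpa using I.side_injective hs c h
      have h2 : I.side c (k + 2) ≠ I.side c k := fun h => by simpa using I.side_injective hs c h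
      simp [h1, h2]
    · simp only [Function.update_of_ne hi]
      refine (h.wit i).imp_right ?_
      rintro ⟨c', k', h1, h2, h3⟩
      exact ⟨c', k', h1, h2, (add_le_add (hle _) (hle _)).trans h3⟩

theorem Consistent.relaxBag (hs : T.IsSuitable) (hadd : ∀ x y, P x → P y → P (x + y))
    (h : I.Consistent P d₀ t) (c : Fin r) : I.Consistent P d₀ (I.relaxBag c t) :=
  ((h.relaxSide hs hadd c 0).relaxSide hs hadd c 1).relaxSide hs hadd c 2

/-! ### How relaxing one bag affects the others -/

variable (I) in
/-- The effect on distances of relaxing bag `c`. -/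
structure Relaxed (c : Fin r) (d d' : ℕ → K) : Prop where
  le : ∀ i, d' i ≤ d i
  other : ∀ i, (∀ k, i ≠ I.side c k) → d' i = d i
  ok : ∀ k, I.SideOK d' c k
  stable : ∀ k, I.SideOK d c k → d' (I.side c k) = d (I.side c k)

theorem forall_fin_three {p : Fin 3 → Prop} : (∀ k, p k) ↔ p 0 ∧ p 1 ∧ p 2 := by
  rw [Fin.forall_fin_succ, Fin.forall_fin_succ, Fin.forall_fin_succ]
  simp

/-- The three sides are distinct entries, so this concerns three positive elements. A side lowered
to the sum of the other two cannot break their inequalities: if `b = e + a`, then `a ≤ b + e` since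
`e` is positive. For the same reason, lowering other sides never makes an already valid side
improvable. -/
theorem relaxed_relaxBag (hs : T.IsSuitable) (hP : ∀ x, P x → 0 < x) (h : I.Consistent P d₀ t)
    (c : Fin r) : I.Relaxed c t.dist (I.relaxBag c t).dist := by
  have hinj := I.side_injective hs c
  have h01 : I.side c 0 ≠ I.side c 1 := hinj.ne (by decide)
  have h02 : I.side c 0 ≠ I.side c 2 := hinj.ne (by decide)
  have h12 : I.side c 1 ≠ I.side c 2 := hinj.ne (by decide)
  have p0 := hP _ (h.isLen c 0)
  have p1 := hP _ (h.isLen c 1)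
  have p2 := hP _ (h.isLen c 2)
  have e : (I.relaxBag c t).dist = fun i =>
      let a := min (t.dist (I.side c 0)) (t.dist (I.side c 1) + t.dist (I.side c 2))
      let b := min (t.dist (I.side c 1)) (t.dist (I.side c 2) + a)
      let e := min (t.dist (I.side c 2)) (a + b)
      if i = I.side c 0 then a else if i = I.side c 1 then b else if i = I.side c 2 then e
      else t.dist i := by
    funext i
    simp only [relaxBag, InputListing.relaxSide, DistTable.relaxSide_dist, Fin.isValue,
      show (0 : Fin 3) + 1 = 1 from rfl, show (0 : Fin 3) + 2 = 2 from rfl,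
      show (1 : Fin 3) + 1 = 2 from rfl, show (1 : Fin 3) + 2 = 0 from rfl,
      show (2 : Fin 3) + 1 = 0 from rfl, show (2 : Fin 3) + 2 = 1 from rfl]
    simp only [Function.update_apply, h01, h01.symm, h02.symm, h12.symm, if_false, if_true]
    split_ifs <;> simp_all
  generalize hx : t.dist (I.side c 0) = x at *
  generalize hy : t.dist (I.side c 1) = y at *
  generalize hz : t.dist (I.side c 2) = z at *
  refine ⟨fun i => ?_, fun i hi => ?_, ?_, ?_⟩
  · rw [e]
    dsimp only
    split_ifs with h h h
    · rw [h, hx]; exact min_le_left _ _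
    · rw [h, hy]; exact min_le_left _ _
    · rw [h, hz]; exact min_le_left _ _
    · exact le_rfl
  · rw [e]; simp [hi]
  · rw [forall_fin_three]
    simp only [SideOK, e, Fin.isValue,
      show (0 : Fin 3) + 1 = 1 from rfl, show (0 : Fin 3) + 2 = 2 from rfl,
      show (1 : Fin 3) + 1 = 2 from rfl, show (1 : Fin 3) + 2 = 0 from rfl,
      show (2 : Fin 3) + 1 = 0 from rfl, show (2 : Fin 3) + 2 = 1 from rfl,
      h01, h02, h12, h01.symm, h02.symm, h12.symm, if_false, if_true]
    clear * - p0 p1 p2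
    grind
  · rw [forall_fin_three]
    simp only [SideOK, e, Fin.isValue,
      show (0 : Fin 3) + 1 = 1 from rfl, show (0 : Fin 3) + 2 = 2 from rfl,
      show (1 : Fin 3) + 1 = 2 from rfl, show (1 : Fin 3) + 2 = 0 from rfl,
      show (2 : Fin 3) + 1 = 0 from rfl, show (2 : Fin 3) + 2 = 1 from rfl,
      h01, h02, h12, h01.symm, h02.symm, h12.symm, if_false, if_true, hx, hy, hz]
    clear * - p0 p1 p2
    grind

variable (I) in
/-- Every side of bag `c` that also lies in the father satisfies the triangle inequality. -/
def UpOK (d : ℕ → K) (c : Fin r) : Prop :=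
  ∀ k, I.sideRep c k ≠ c → I.SideOK d c k

variable {c c' : Fin r} {d d' : ℕ → K}

omit [IsOrderedAddMonoid K] in
-- If this side is also a side of `c`, its topmost bag is `c` or the father of `c`. The first is
-- excluded by `h1`; in the second case the side already satisfies its inequality in `c` and is
-- stable.
theorem Relaxed.eq_of_sideRep (h : I.Relaxed c d d') {k : Fin 3} (h1 : I.sideRep c' k ≠ c)
    (h2 : I.sideRep c' k = T.father c → I.UpOK d c) :
    d' (I.side c' k) = d (I.side c' k) := by
  by_cases hi : ∃ j, I.side c' k = I.side c j
  · obtain ⟨j, hj⟩ := hi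
    have hrep := I.sideRep_eq_of_side_eq hj
    rw [hj]
    rw [hrep] at h1 h2
    exact h.stable j (h2 ((I.sideRep_eq_or c j).resolve_left h1) j h1)
  · exact h.other _ (not_exists.1 hi)

omit [IsOrderedAddMonoid K] in
-- If side `k` of `c'` lies in the father, the other two sides have topmost bag `c'` and do not
-- change. Side `k` itself can only decrease.
theorem Relaxed.upOK_of_eq (hs : T.IsSuitable) (h : I.Relaxed c d d')
    (hne : c' ≠ c) (h2 : c' = T.father c → I.UpOK d c) (hu : I.UpOK d c') : I.UpOK d' c' := by
  intro k hk
  have h3 : ∀ j : Fin 3, j ≠ k → d' (I.side c' j) = d (I.side c' j) := fun j hj => by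
    have hr := I.sideRep_eq hs hj hk
    exact h.eq_of_sideRep (by rwa [hr]) (by rwa [hr])
  unfold SideOK
  rw [h3 (k + 1) (by simp), h3 (k + 2) (by simp)]
  exact (h.le _).trans (hu k hk)

omit [IsOrderedAddMonoid K] in
-- All sides of `c'` have topmost bag `c'` or its father, neither of which is `c`, so none of them
-- changes.
theorem Relaxed.sideOK_of_father_ne (h : I.Relaxed c d d') (hne : c' ≠ c)
    (hf : T.father c' ≠ c) (hu : I.UpOK d c) (hc : ∀ k, I.SideOK d c' k) (k : Fin 3) :
    I.SideOK d' c' k := by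
  have h3 : ∀ j : Fin 3, d' (I.side c' j) = d (I.side c' j) := fun j =>
    h.eq_of_sideRep (by rcases I.sideRep_eq_or c' j with h | h <;> rwa [h]) fun _ => hu
  unfold SideOK
  rw [h3, h3, h3]
  exact hc k

end InputListing

/-! ## Lengths of walks in a graph with closed triangles -/

namespace RootedBagTree

variable {n r : ℕ} {T : RootedBagTree n r} {G : SimpleGraph (Fin n)}

variable (T) in
/-- The two vertices lie in a common bag. -/
def Near (u v : Fin n) : Prop := ∃ c, u ∈ T.bag c ∧ v ∈ T.bag c

variable {K : Type*} [AddCommGroup K] [LinearOrder K] [IsOrderedAddMonoid K]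

/-- The length of a sequence of vertices. -/
def listLength (d : Fin n → Fin n → K) : List (Fin n) → K
  | [] => 0
  | [_] => 0
  | u :: v :: l => d u v + listLength d (v :: l)

omit [LinearOrder K] [IsOrderedAddMonoid K] in
theorem listLength_append (d : Fin n → Fin n → K) (l l' : List (Fin n)) (x : Fin n) :
    listLength d (l ++ x :: l') = listLength d (l ++ [x]) + listLength d (x :: l') := by
  induction l with
  | nil => simp [listLength]
  | cons a l ih =>
    cases l with
    | nil => simp [listLength]
    | cons b l => simpa [listLength, add_assoc] using ih

/-- Triangle inequalities inside bags bound the entry of a pair by the length of any walk. -/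
theorem le_listLength (hT : T.IsTreeDecomposition G) {d : Fin n → Fin n → K}
    (hd : ∀ c, ∀ x ∈ T.bag c, ∀ y ∈ T.bag c, ∀ z ∈ T.bag c, d x z ≤ d x y + d y z)
    (u v : Fin n) (l : List (Fin n)) (hl : (u :: (l ++ [v])).IsChain T.Near)
    (huv : T.Near u v) : d u v ≤ listLength d (u :: (l ++ [v])) := by
  induction hk : l.length using Nat.strong_induction_on generalizing u v l with
  | _ k ih =>
    -- If `x` has the deepest top, any two vertices near `x` lie with it in its top bag, where all
    -- triangle inequalities are available.
    have near_of_top : ∀ {x y z : Fin n}, T.Near x y → T.Near x z →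
        T.depth (hT.top y) ≤ T.depth (hT.top x) → T.depth (hT.top z) ≤ T.depth (hT.top x) →
        d y z ≤ d y x + d x z ∧ T.Near y z ∧ d x z ≤ d x y + d y z ∧ d z x ≤ d z y + d y x := by
      rintro x y z ⟨c, hc⟩ ⟨c', hc'⟩ h1 h2
      have hx := (hT.isTop_top x).1
      have hy := hT.mem_bag_top hc.1 hc.2 h1
      have hz := hT.mem_bag_top hc'.1 hc'.2 h2
      exact ⟨hd _ _ hy _ hx _ hz, ⟨_, hy, hz⟩, hd _ _ hx _ hy _ hz, hd _ _ hz _ hy _ hx⟩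
    have symm : ∀ {x y}, T.Near x y → T.Near y x := fun ⟨c, h⟩ => ⟨c, h.2, h.1⟩
    obtain ⟨x, hx, hmax⟩ := (u :: (l ++ [v])).toFinset.exists_max_image
      (fun x => T.depth (hT.top x)) ⟨u, by simp⟩
    simp only [List.mem_toFinset] at hx hmax
    -- If the deepest vertex is the end point `u`, it is split off together with its first step; the
    -- induction treats the rest of the sequence. The end point `v` is symmetric.
    rcases List.mem_cons.1 hx with rfl | hx
    · cases l with
      | nil => simp [listLength]
      | cons y l =>
        simp only [List.cons_append, List.isChain_cons_cons] at hl
        obtain ⟨-, h2, h3, -⟩ := near_of_top hl.1 huv (hmax _ (by simp)) (hmax _ (by simp))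
        have := ih l.length (by simp at hk; omega) y v l (by simpa using hl.2) h2 rfl
        simp only [List.cons_append, listLength]
        exact h3.trans (by gcongr)
    rcases List.mem_append.1 hx with hx | hx
    -- An interior deepest vertex `x` is deleted: its neighbours `p` and `q` are near each other and
    -- `d p q ≤ d p x + d x q`.
    · obtain ⟨l₁, l₂, rfl⟩ := List.append_of_mem hx
      obtain ⟨l₁', p, hp⟩ : ∃ l₁' p, u :: l₁ = l₁' ++ [p] := by
        rcases List.eq_nil_or_concat (u :: l₁) with h | ⟨l', p, h⟩
        · simp at h
        · exact ⟨l', p, by simpa using h⟩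
      obtain ⟨q, l₂', hq⟩ : ∃ q l₂', l₂ ++ [v] = q :: l₂' := by
        cases l₂ with
        | nil => exact ⟨_, _, rfl⟩
        | cons a l => exact ⟨_, _, rfl⟩
      have e1 : u :: (l₁ ++ x :: l₂ ++ [v]) = l₁' ++ p :: x :: q :: l₂' := by
        have : u :: (l₁ ++ x :: l₂ ++ [v]) = (u :: l₁) ++ x :: (l₂ ++ [v]) := by simp
        rw [this, hp, hq]; simp
      have e2 : u :: (l₁ ++ l₂ ++ [v]) = l₁' ++ p :: q :: l₂' := by
        have : u :: (l₁ ++ l₂ ++ [v]) = (u :: l₁) ++ (l₂ ++ [v]) := by simp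
        rw [this, hp, hq]; simp
      rw [e1] at hl hmax ⊢
      rw [List.isChain_append_cons_cons, List.isChain_cons_cons] at hl
      obtain ⟨h1, h2, -, -⟩ := near_of_top (symm hl.2.1) hl.2.2.1 (hmax _ (by simp))
        (hmax _ (by simp))
      have := ih (l₁ ++ l₂).length (by simp at hk ⊢; omega) u v (l₁ ++ l₂)
        (by
          rw [e2, List.isChain_append_cons_cons]
          exact ⟨hl.1, h2, hl.2.2.2⟩) huv rfl
      refine this.trans ?_
      rw [e2, listLength_append, listLength_append d l₁' (x :: q :: l₂')]
      simp only [listLength]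
      rw [← add_assoc (d p x)]
      gcongr
    · rw [List.mem_singleton] at hx
      subst hx
      rcases List.eq_nil_or_concat l with rfl | ⟨l', p, rfl⟩
      · simp [listLength]
      · have e1 : u :: (l'.concat p ++ [x]) = (u :: l') ++ p :: x :: [] := by simp
        rw [e1] at hl hmax ⊢
        rw [List.isChain_append_cons_cons] at hl
        obtain ⟨-, h2, -, h4⟩ := near_of_top (symm hl.2.1) (symm huv) (hmax _ (by simp))
          (hmax _ (by simp))
        have := ih l'.length (by simp at hk; omega) u p l' (by simpa using hl.1) (symm h2) rfl
        rw [listLength_append]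
        simp only [listLength, add_zero]
        exact h4.trans (by simpa using this)

end RootedBagTree

/-! ## Shortest paths from closed tables -/

namespace InputListing

variable {n r m : ℕ} {G : SimpleGraph (Fin n)} {T : RootedBagTree n r} (I : InputListing G T m)
  (w : Sym2 (Fin n) → ℝ)

/-- Pairs of a weight and a positive number of edges. They are compared lexicographically. -/
def IsLen (x : ℝ ×ₗ ℝ) : Prop := 0 ≤ (ofLex x).1 ∧ ∃ k : ℕ, 1 ≤ k ∧ (ofLex x).2 = k

theorem IsLen.add {x y : ℝ ×ₗ ℝ} (hx : IsLen x) (hy : IsLen y) : IsLen (x + y) := by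
  obtain ⟨hx, k, hk, hk'⟩ := hx
  obtain ⟨hy, l, hl, hl'⟩ := hy
  refine ⟨?_, k + l, by omega, ?_⟩
  · simpa using add_nonneg hx hy
  · simp [hk', hl']

theorem IsLen.pos {x : ℝ ×ₗ ℝ} (hx : IsLen x) : 0 < x := by
  obtain ⟨hx, k, hk, hk'⟩ := hx
  rw [Prod.Lex.lt_iff]
  rcases hx.lt_or_eq with h | h
  · exact Or.inl h
  · refine Or.inr ⟨h, ?_⟩
    rw [hk']
    exact Nat.cast_pos.2 hk

/-- The weight given to pairs that are not edges. -/
noncomputable def bigWeight : ℝ := 1 + ∑ i, w s(I.src i, I.tgt i)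

open Classical in
/-- The length of a pair before all improvements. -/
noncomputable def pairLen (u v : Fin n) : ℝ ×ₗ ℝ :=
  toLex (if G.Adj u v then w s(u, v) else I.bigWeight w, 1)

/-- The weight and the number of edges of a walk. -/
noncomputable def walkLen {u v : Fin n} (P : G.Walk u v) : ℝ ×ₗ ℝ :=
  toLex (P.weight w, (P.length : ℝ))

/-- A table in which all improvements have been made. -/
structure Solved (t : DistTable (ℝ ×ₗ ℝ)) : Prop where
  exists_init : ∃ d₀, I.Consistent IsLen d₀ t ∧
    ∀ u v c, u ≠ v → u ∈ T.bag c → v ∈ T.bag c → d₀ (I.idx u v c) = I.pairLen w u v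
  ok : ∀ c k, I.SideOK t.dist c k

variable {I w} {t : DistTable (ℝ ×ₗ ℝ)}

theorem walkLen_cons {u v x : Fin n} (h : G.Adj u v) (P : G.Walk v x) :
    walkLen w (P.cons h) = toLex (w s(u, v), 1) + walkLen w P := by
  simp only [walkLen, SimpleGraph.Walk.weight, ← toLex_add, SimpleGraph.Walk.edges_cons,
    List.map_cons, List.sum_cons, SimpleGraph.Walk.length_cons, Nat.cast_add, Nat.cast_one,
    Prod.mk_add_mk, add_comm (P.length : ℝ)]

theorem walkLen_append {u v x : Fin n} (P : G.Walk u v) (Q : G.Walk v x) :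
    walkLen w (P.append Q) = walkLen w P + walkLen w Q := by
  simp [walkLen, SimpleGraph.Walk.weight, ← toLex_add]

theorem exists_side {u v : Fin n} {c : Fin r} (huv : u ≠ v) (hu : u ∈ T.bag c)
    (hv : v ∈ T.bag c) : ∃ k, I.idx u v c = I.side c k := by
  obtain ⟨i, rfl⟩ := I.exists_vert hu
  obtain ⟨j, rfl⟩ := I.exists_vert hv
  have hij : i ≠ j := fun h => huv (h ▸ rfl)
  obtain ⟨k, hk⟩ : ∃ k, i ≠ k ∧ j ≠ k := by clear * -; revert i j; decide
  exact ⟨k, I.idx_vert c hij hk.1 hk.2⟩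

theorem Solved.triangle (ht : I.Solved w t) {x y z : Fin n} {c : Fin r} (hx : x ∈ T.bag c)
    (hy : y ∈ T.bag c) (hz : z ∈ T.bag c) (hxy : x ≠ y) (hxz : x ≠ z) (hyz : y ≠ z) :
    t.dist (I.idx x z c) ≤ t.dist (I.idx x y c) + t.dist (I.idx y z c) := by
  obtain ⟨i, rfl⟩ := I.exists_vert hx
  obtain ⟨j, rfl⟩ := I.exists_vert hy
  obtain ⟨k, rfl⟩ := I.exists_vert hz
  have hij : i ≠ j := fun h => hxy (h ▸ rfl)
  have hik : i ≠ k := fun h => hxz (h ▸ rfl)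
  have hjk : j ≠ k := fun h => hyz (h ▸ rfl)
  rw [I.idx_vert c hik hij hjk.symm, I.idx_vert c hij hik hjk, I.idx_vert c hjk hij.symm hik.symm]
  have h := ht.ok c j
  have : (i = j + 1 ∧ k = j + 2) ∨ (k = j + 1 ∧ i = j + 2) := by
    clear * - hij hik hjk; revert i j k; decide
  rcases this with ⟨rfl, rfl⟩ | ⟨rfl, rfl⟩
  · rw [add_comm]; exact h
  · exact h

theorem Solved.isLen (ht : I.Solved w t) {u v : Fin n} {c : Fin r} (huv : u ≠ v)
    (hu : u ∈ T.bag c) (hv : v ∈ T.bag c) : IsLen (t.dist (I.idx u v c)) := by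
  obtain ⟨k, hk⟩ := exists_side (I := I) huv hu hv
  obtain ⟨d₀, h, -⟩ := ht.exists_init
  exact hk ▸ h.isLen c k

variable (I) in
open Classical in
/-- The entry of a pair of vertices with a common bag. -/
noncomputable def pairDist (t : DistTable (ℝ ×ₗ ℝ)) (u v : Fin n) : ℝ ×ₗ ℝ :=
  if u = v then 0 else if h : T.Near u v then t.dist (I.idx u v h.choose) else 0

theorem pairDist_eq (hT : T.IsTreeDecomposition G) (hs : T.IsSuitable) {u v : Fin n} {c : Fin r}
    (huv : u ≠ v) (hu : u ∈ T.bag c) (hv : v ∈ T.bag c) :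
    I.pairDist t u v = t.dist (I.idx u v c) := by
  have h : T.Near u v := ⟨c, hu, hv⟩
  rw [pairDist, if_neg huv, dif_pos h, I.idx_congr hT hs huv h.choose_spec.1 h.choose_spec.2 hu hv]

theorem Solved.pairDist_triangle (hT : T.IsTreeDecomposition G) (hs : T.IsSuitable)
    (ht : I.Solved w t) (c : Fin r) (x : Fin n) (hx : x ∈ T.bag c) (y : Fin n) (hy : y ∈ T.bag c)
    (z : Fin n) (hz : z ∈ T.bag c) :
    I.pairDist t x z ≤ I.pairDist t x y + I.pairDist t y z := by
  have h0 : ∀ x, I.pairDist t x x = 0 := fun x => if_pos rfl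
  have hpos : ∀ {x y}, x ∈ T.bag c → y ∈ T.bag c → 0 ≤ I.pairDist t x y := by
    intro x y hx hy
    by_cases hxy : x = y
    · rw [hxy, h0]
    · rw [pairDist_eq hT hs hxy hx hy]
      exact (ht.isLen hxy hx hy).pos.le
  by_cases hxy : x = y
  · subst hxy; rw [h0, zero_add]
  by_cases hyz : y = z
  · subst hyz; rw [h0, add_zero]
  by_cases hxz : x = z
  · subst hxz; rw [h0]; exact add_nonneg (hpos hx hy) (hpos hy hx)
  rw [pairDist_eq hT hs hxz hx hz, pairDist_eq hT hs hxy hx hy, pairDist_eq hT hs hyz hy hz]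
  exact ht.triangle hx hy hz hxy hxz hyz

theorem Solved.pairDist_le_of_adj (hT : T.IsTreeDecomposition G) (hs : T.IsSuitable)
    (ht : I.Solved w t) {u v : Fin n} (h : G.Adj u v) :
    I.pairDist t u v ≤ toLex (w s(u, v), 1) := by
  obtain ⟨c, hu, hv⟩ := hT.edge u v h
  obtain ⟨d₀, hc, hd⟩ := ht.exists_init
  rw [pairDist_eq hT hs h.ne hu hv]
  refine (hc.le _).trans ?_
  rw [hd u v c h.ne hu hv, pairLen, if_pos h]

theorem Solved.listLength_le (hT : T.IsTreeDecomposition G) (hs : T.IsSuitable)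
    (ht : I.Solved w t) {u v : Fin n} (P : G.Walk u v) :
    P.support.IsChain T.Near ∧
      RootedBagTree.listLength (I.pairDist t) P.support ≤ walkLen w P := by
  induction P with
  | nil => exact ⟨by simp, by simp [RootedBagTree.listLength, walkLen, SimpleGraph.Walk.weight]; rfl⟩
  | @cons a b c h P ih =>
    obtain ⟨l, hl⟩ : ∃ l, P.support = b :: l := ⟨_, P.cons_tail_support.symm⟩
    rw [SimpleGraph.Walk.support_cons]
    rw [hl] at ih ⊢
    refine ⟨List.isChain_cons_cons.2 ⟨hT.edge _ _ h, ih.1⟩, ?_⟩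
    rw [walkLen_cons, RootedBagTree.listLength]
    exact add_le_add (ht.pairDist_le_of_adj hT hs h) ih.2

/-- The entries of a solved table are lower bounds for the lengths of walks. -/
theorem Solved.dist_le (hT : T.IsTreeDecomposition G) (hs : T.IsSuitable)
    (ht : I.Solved w t) {u v : Fin n} {c : Fin r} (huv : u ≠ v) (hu : u ∈ T.bag c)
    (hv : v ∈ T.bag c) (P : G.Walk u v) : t.dist (I.idx u v c) ≤ walkLen w P := by
  obtain ⟨h1, h2⟩ := ht.listLength_le hT hs P
  rw [← pairDist_eq hT hs huv hu hv]
  refine le_trans ?_ h2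
  -- Since `u ≠ v`, the walk has at least one edge, so first and last occurrence in the support are
  -- separate.
  obtain ⟨l, hl⟩ : ∃ l, P.support = u :: (l ++ [v]) := by
    have h : P.support ≠ [] := by simp
    have e1 := P.cons_tail_support.symm
    have hne : P.support.tail ≠ [] := by
      intro h0
      have : P.support.length = 1 := by rw [e1, h0]; rfl
      rw [SimpleGraph.Walk.length_support] at this
      exact huv (SimpleGraph.Walk.eq_of_length_eq_zero (p := P) (by omega))
    refine ⟨P.support.tail.dropLast, ?_⟩
    have e2 : P.support.tail.getLast hne = v := by
      rw [List.getLast_tail]; simp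
    have e3 := List.dropLast_append_getLast hne
    rw [e2] at e3
    rw [e3]
    exact e1
  rw [hl] at h1 ⊢
  exact RootedBagTree.le_listLength hT (ht.pairDist_triangle hT hs) u v l h1 ⟨c, hu, hv⟩

/-- A path uses each edge at most once, so its weight is at most the total weight of `G`, one less
than `bigWeight`. -/
theorem weight_lt_bigWeight (hw : ∀ e ∈ G.edgeSet, 0 ≤ w e) {u v : Fin n} {P : G.Walk u v}
    (hP : P.IsPath) : P.weight w < I.bigWeight w := by
  have h1 : P.weight w = ∑ e ∈ P.edges.toFinset, w e :=
    (List.sum_toFinset w hP.isTrail.edges_nodup).symm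
  have h2 : ∑ i, w s(I.src i, I.tgt i) =
      ∑ e ∈ Finset.univ.image (fun i => s(I.src i, I.tgt i)), w e :=
    (Finset.sum_image fun i _ j _ h => I.edge_injective h).symm
  have h3 : ∑ e ∈ P.edges.toFinset, w e ≤
      ∑ e ∈ Finset.univ.image (fun i => s(I.src i, I.tgt i)), w e := by
    refine Finset.sum_le_sum_of_subset_of_nonneg (fun e he => ?_) fun e he _ => ?_
    · have : e ∈ G.edgeSet := P.edges_subset_edgeSet (List.mem_toFinset.1 he)
      rw [← I.edge_range] at this
      simpa using this
    · refine hw e ?_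
      rw [← I.edge_range]
      simpa using he
  rw [h1, bigWeight, h2]
  linarith

/-- By connectedness no entry of a solved table keeps the placeholder weight, so an entry without a
witness belongs to an edge. -/
theorem Solved.dist_fst_lt (hT : T.IsTreeDecomposition G) (hs : T.IsSuitable)
    (hG : G.Connected) (hw : ∀ e ∈ G.edgeSet, 0 ≤ w e)
    (ht : I.Solved w t) {u v : Fin n} {c : Fin r} (huv : u ≠ v) (hu : u ∈ T.bag c)
    (hv : v ∈ T.bag c) : (ofLex (t.dist (I.idx u v c))).1 < I.bigWeight w := by
  obtain ⟨P, hP⟩ := hG.exists_isPath u v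
  have h := ht.dist_le hT hs huv hu hv P
  rw [Prod.Lex.le_iff] at h
  have h2 := weight_lt_bigWeight (I := I) hw hP
  have h3 : (ofLex (walkLen w P)).1 = P.weight w := rfl
  rcases h with h | h
  · exact (h3 ▸ h).trans h2
  · exact (h.1.trans h3).trans_lt h2

/-! ### Unfolding witnesses into shortest paths -/

variable (I) in
/-- The walk is obtained from its end points by repeatedly inserting witnesses. -/
inductive Expansion (wit : ℕ → ℕ) : ∀ {u v : Fin n}, Fin r → G.Walk u v → Prop
  | edge {u v : Fin n} {x : Fin r} (h : G.Adj u v) (hu : u ∈ T.bag x) (hv : v ∈ T.bag x)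
      (hw : wit (I.idx u v x) = 0) : Expansion wit x (.cons h .nil)
  | split {u v z : Fin n} {x c : Fin r} (huv : u ≠ v) (hu : u ∈ T.bag x) (hv : v ∈ T.bag x)
      (hw : wit (I.idx u v x) = (c : ℕ) + 1) (hc : T.bag c = {u, v, z}) (hzu : z ≠ u)
      (hzv : z ≠ v) (P : G.Walk u z) (Q : G.Walk z v) (hP : Expansion wit c P)
      (hQ : Expansion wit c Q) : Expansion wit x (P.append Q)

/-- `Consistent` gives one inequality between the entry and the sum over its witness bag, and
closure of the table gives the other. Only now do witnesses describe exact decompositions. -/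
theorem Solved.witness (hT : T.IsTreeDecomposition G) (hs : T.IsSuitable)
    (hG : G.Connected) (hw : ∀ e ∈ G.edgeSet, 0 ≤ w e)
    (ht : I.Solved w t) {u v : Fin n} {x : Fin r} (huv : u ≠ v) (hu : u ∈ T.bag x)
    (hv : v ∈ T.bag x) :
    (t.wit (I.idx u v x) = 0 ∧ G.Adj u v ∧ t.dist (I.idx u v x) = toLex (w s(u, v), 1)) ∨
      ∃ (c : Fin r) (z : Fin n), t.wit (I.idx u v x) = (c : ℕ) + 1 ∧ T.bag c = {u, v, z} ∧ z ≠ u ∧ z ≠ v ∧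
        t.dist (I.idx u v x) = t.dist (I.idx u z c) + t.dist (I.idx z v c) := by
  obtain ⟨d₀, hc, hd⟩ := ht.exists_init
  rcases hc.wit (I.idx u v x) with ⟨h0, h1⟩ | ⟨c, k, hk, hwit, hle⟩
  · left
    rw [hd u v x huv hu hv, pairLen] at h1
    have hlt := ht.dist_fst_lt hT hs hG hw huv hu hv
    have hadj : G.Adj u v := by
      by_contra hn
      rw [h1, if_neg hn] at hlt
      exact lt_irrefl _ hlt
    rw [if_pos hadj] at h1
    exact ⟨h0, hadj, h1⟩
  · right
    have hinj := I.vert_injective hs c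
    have hne1 : k + 1 ≠ k + 2 := by clear * -; revert k; decide
    have hne2 : k + 1 ≠ k := by simp
    have hne3 : k + 2 ≠ k := by simp
    have hs' := I.idx_inj hs (hinj.ne hne1) huv (I.vert_mem _ _) (I.vert_mem _ _) hu hv hk
    have hbag : T.bag c = {I.vert (k + 1) c, I.vert (k + 2) c, I.vert k c} := by
      ext y
      constructor
      · intro hy
        obtain ⟨i, rfl⟩ := I.exists_vert hy
        have : i = k + 1 ∨ i = k + 2 ∨ i = k := by clear * -; revert i k; decide
        rcases this with rfl | rfl | rfl <;> simp
      · intro hy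
        simp only [Finset.mem_insert, Finset.mem_singleton] at hy
        rcases hy with rfl | rfl | rfl <;> exact I.vert_mem _ _
    have e1 : I.idx (I.vert (k + 1) c) (I.vert k c) c = I.side c (k + 2) :=
      I.idx_vert c hne2 hne1 hne3.symm
    have e2 : I.idx (I.vert k c) (I.vert (k + 2) c) c = I.side c (k + 1) :=
      I.idx_vert c hne3.symm hne2.symm hne1.symm
    have heq : t.dist (I.idx u v x) = t.dist (I.side c (k + 1)) + t.dist (I.side c (k + 2)) :=
      le_antisymm (hk ▸ ht.ok c k) hle
    rw [Sym2.eq_iff] at hs'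
    refine ⟨c, I.vert k c, hwit, ?_⟩
    rcases hs' with ⟨rfl, rfl⟩ | ⟨rfl, rfl⟩
    · exact ⟨hbag, hinj.ne hne2.symm, hinj.ne hne3.symm, by rw [heq, e1, e2, add_comm]⟩
    · refine ⟨by rw [hbag, Finset.insert_comm], hinj.ne hne3.symm, hinj.ne hne2.symm, ?_⟩
      rw [heq, I.idx_comm _ (I.vert k c), e2, I.idx_comm (I.vert k c), e1]

/-- Induction on the edge count of the entry: both parts of a split have positive counts adding up
to it, so each is smaller. -/
theorem Solved.exists_expansion (hT : T.IsTreeDecomposition G) (hs : T.IsSuitable)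
    (hG : G.Connected) (hw : ∀ e ∈ G.edgeSet, 0 ≤ w e)
    (ht : I.Solved w t) {u v : Fin n} {x : Fin r} (huv : u ≠ v) (hu : u ∈ T.bag x)
    (hv : v ∈ T.bag x) : ∃ P : G.Walk u v, I.Expansion t.wit x P ∧
      walkLen w P = t.dist (I.idx u v x) := by
  obtain ⟨-, k, -, hk⟩ := ht.isLen huv hu hv
  induction k using Nat.strong_induction_on generalizing u v x with
  | _ k ih =>
    rcases ht.witness hT hs hG hw huv hu hv with ⟨h0, hadj, hd⟩ | ⟨c, z, hc, hb, hzu, hzv, hd⟩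
    · refine ⟨_, .edge hadj hu hv h0, ?_⟩
      rw [hd, walkLen_cons]
      simp [walkLen, SimpleGraph.Walk.weight]
    · have huc : u ∈ T.bag c := by simp [hb]
      have hvc : v ∈ T.bag c := by simp [hb]
      have hzc : z ∈ T.bag c := by simp [hb]
      obtain ⟨-, k₁, hk1, hk₁⟩ := ht.isLen hzu.symm huc hzc
      obtain ⟨-, k₂, hk2, hk₂⟩ := ht.isLen hzv hzc hvc
      have hsum : k = k₁ + k₂ := by
        rw [hd] at hk
        have : (k : ℝ) = k₁ + k₂ := by rw [← hk, ← hk₁, ← hk₂]; rfl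
        exact_mod_cast this
      obtain ⟨P, hP, hP'⟩ := ih k₁ (by omega) hzu.symm huc hzc hk₁
      obtain ⟨Q, hQ, hQ'⟩ := ih k₂ (by omega) hzv hzc hvc hk₂
      exact ⟨_, .split huv hu hv hc hb hzu hzv P Q hP hQ, by rw [walkLen_append, hP', hQ', hd]⟩

/-- Removing cycles does not increase the weight, so by lexicographic minimality it cannot reduce
the number of edges either. Hence `P` equals its bypass. -/
theorem isShortestPath_of_walkLen_le (hw : ∀ e ∈ G.edgeSet, 0 ≤ w e) {u v : Fin n}
    {P : G.Walk u v} (hP : ∀ Q : G.Walk u v, walkLen w P ≤ walkLen w Q) :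
    P.IsShortestPath w := by
  have hle : ∀ Q : G.Walk u v, P.weight w ≤ Q.weight w := fun Q => by
    rcases (Prod.Lex.le_iff.1 (hP Q)) with h | h
    · exact h.le
    · exact h.1.le
  refine ⟨?_, fun Q _ => hle Q⟩
  have h1 : P.bypass.weight w ≤ P.weight w := by
    obtain ⟨l, hl, hl'⟩ := P.bypass_isPath.isTrail.edges_nodup.subperm P.edges_bypass_subset_edges
    refine ((hl.map w).sum_eq).symm.trans_le ?_
    refine (hl'.map w).sum_le_sum fun x hx => ?_
    obtain ⟨e, he, rfl⟩ := List.mem_map.1 hx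
    exact hw e (P.edges_subset_edgeSet he)
  have h2 : P.length ≤ P.bypass.length := by
    rcases (Prod.Lex.le_iff.1 (hP P.bypass)) with h | h
    · exact absurd h (not_lt.2 h1)
    · have h2 : (P.length : ℝ) ≤ P.bypass.length := h.2
      exact_mod_cast h2
  rw [← P.bypass_eq_self_of_length_le_length_bypass h2]
  exact P.bypass_isPath

/-- The entry of a pair is the weight of a shortest path, which the witnesses describe. -/
theorem Solved.exists_shortest (hT : T.IsTreeDecomposition G) (hs : T.IsSuitable)
    (hG : G.Connected) (hw : ∀ e ∈ G.edgeSet, 0 ≤ w e)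
    (ht : I.Solved w t) {u v : Fin n} {x : Fin r} (huv : u ≠ v) (hu : u ∈ T.bag x)
    (hv : v ∈ T.bag x) : ∃ P : G.Walk u v, P.IsShortestPath w ∧ I.Expansion t.wit x P ∧
      walkLen w P = t.dist (I.idx u v x) := by
  obtain ⟨P, hP, hP'⟩ := ht.exists_expansion hT hs hG hw huv hu hv
  exact ⟨P, isShortestPath_of_walkLen_le hw fun Q => hP' ▸ ht.dist_le hT hs huv hu hv Q, hP, hP'⟩

/-- If no shortest path consists of a single edge, the witness lies on a shortest path. -/
theorem Solved.exists_intermediate (hT : T.IsTreeDecomposition G) (hs : T.IsSuitable)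
    (hG : G.Connected) (hw : ∀ e ∈ G.edgeSet, 0 ≤ w e)
    (ht : I.Solved w t) {u v : Fin n} {x : Fin r} (huv : u ≠ v) (hu : u ∈ T.bag x)
    (hv : v ∈ T.bag x) (h2 : ∀ P : G.Walk u v, P.IsShortestPath w → 2 ≤ P.length) :
    ∃ (c : Fin r) (z : Fin n), t.wit (I.idx u v x) = (c : ℕ) + 1 ∧ T.bag c = {u, v, z} ∧ z ≠ u ∧ z ≠ v ∧
      ∃ P : G.Walk u v, P.IsShortestPath w ∧ z ∈ P.support := by
  rcases ht.witness hT hs hG hw huv hu hv with ⟨-, hadj, hd⟩ | ⟨c, z, hc, hb, hzu, hzv, hd⟩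
  -- Without a witness the single edge would be a shortest path, contradicting `h2`.
  · have : (SimpleGraph.Walk.cons hadj .nil).IsShortestPath w := by
      refine isShortestPath_of_walkLen_le hw fun Q => ?_
      refine le_trans (le_of_eq ?_) (ht.dist_le hT hs huv hu hv Q)
      rw [hd, walkLen_cons]
      simp [walkLen, SimpleGraph.Walk.weight]
    simpa using h2 _ this
  · have huc : u ∈ T.bag c := by simp [hb]
    have hvc : v ∈ T.bag c := by simp [hb]
    have hzc : z ∈ T.bag c := by simp [hb]
    obtain ⟨P, -, hP⟩ := ht.exists_expansion hT hs hG hw hzu.symm huc hzc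
    obtain ⟨Q, -, hQ⟩ := ht.exists_expansion hT hs hG hw hzv hzc hvc
    refine ⟨c, z, hc, hb, hzu, hzv, P.append Q,
      isShortestPath_of_walkLen_le hw fun R => ?_, by simp⟩
    rw [walkLen_append, hP, hQ, ← hd]
    exact ht.dist_le hT hs huv hu hv R

end InputListing

/-! ## Programs -/

namespace RealRAM

/-- Test whether vertex `a` lies in bag `x`. -/
def inBag (a x : NExp) : Test :=
  .or (.eq (.get 2 x) a) (.or (.eq (.get 3 x) a) (.eq (.get 4 x) a))

/-- Test whether `a` differs from the vertices in variables `u` and `v`. -/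
def neither (u v : ℕ) (a : NExp) : Test :=
  .and (.not (.eq a (.var u))) (.not (.eq a (.var v)))

/-- Store in variable `out` the identifier of the pair of vertices in variables `u` and `v`,
both contained in the bag in variable `x`. -/
def lookup (u v x out : ℕ) : Cmd :=
  .ite (.and (inBag (.var u) (.get 5 (.var x))) (inBag (.var v) (.get 5 (.var x))))
    (.setN 9 (.get 5 (.var x))) (.setN 9 (.var x)) ;;
  .ite (neither u v (.get 2 (.var 9)))
    (.setN out (.add (.var 9) (.add (.var 9) (.var 9))))
    (.ite (neither u v (.get 3 (.var 9)))
      (.setN out (.add (.add (.var 9) (.add (.var 9) (.var 9))) (.lit 1)))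
      (.setN out (.add (.add (.var 9) (.add (.var 9) (.var 9))) (.lit 2))))

/-- Lexicographic comparison: going through entries `b` and `e` improves entry `a`. -/
def improves (a b e : ℕ) : Test :=
  .or (.rlt (.add (.get 1 (.var b)) (.get 1 (.var e))) (.get 1 (.var a)))
    (.and (.not (.rlt (.get 1 (.var a)) (.add (.get 1 (.var b)) (.get 1 (.var e)))))
      (.rlt (.add (.get 2 (.var b)) (.get 2 (.var e))) (.get 2 (.var a))))

/-- Improve the entry with identifier in variable `a`. -/
def relaxOne (a b e : ℕ) : Cmd :=
  .ite (improves a b e)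
    (.storeR 1 (.var a) (.add (.get 1 (.var b)) (.get 1 (.var e))) ;;
      .storeR 2 (.var a) (.add (.get 2 (.var b)) (.get 2 (.var e))) ;;
      .storeN 10 (.var a) (.add (.var 14) (.lit 1)))
    .skip

/-- Improve the three sides of the bag in variable `14`. -/
def relax : Cmd :=
  .setN 15 (.get 2 (.var 14)) ;; .setN 16 (.get 3 (.var 14)) ;; .setN 17 (.get 4 (.var 14)) ;;
  lookup 16 17 14 18 ;; lookup 17 15 14 19 ;; lookup 15 16 14 20 ;;
  relaxOne 18 19 20 ;; relaxOne 19 20 18 ;; relaxOne 20 18 19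

/-- Repeat `body` for the values `0, 1, …` of variable `11` less than variable `N`. -/
def forLoop (N : ℕ) (body : Cmd) : Cmd :=
  .setN 11 (.lit 0) ;;
  .loop (.lt (.var 11) (.var N)) (body ;; .setN 11 (.add (.var 11) (.lit 1)))

/-- `J k` holds before the round with counter `k`. The body must leave the counter alone and
establish the next invariant for the state after the increment. Test and increment cost 8 per round;
the remaining 2 cover the initial assignment. -/
theorem Runs.forLoop {B N b : ℕ} {body : Cmd} {s : State} (J : ℕ → State → Prop)
    (hN : ∀ k s, J k s → s.nvar N = b) (hB : b + 1 ≤ B)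
    (hbody : ∀ k s, k < b → J k s → s.nvar 11 = k →
      body.wp B (fun s' => J (k + 1) (s'.setN 11 (k + 1)) ∧ s'.nvar 11 = k) s)
    (h0 : J 0 (s.setN 11 0)) :
    Runs B (forLoop N body) s ((b + 1) * (body.time + 10)) (J b) := by
  have h := Runs.seq (Cmd.wp_sound (B := B) (.setN 11 (.lit 0))
      (fun s => J (s.nvar 11) s ∧ s.nvar 11 = 0) s
      ⟨Nat.zero_le _, by simpa [NExp.eval] using h0⟩) fun s' hs' =>
    (Runs.loop (B := B) (p := .lt (.var 11) (.var N))
      (c := body ;; .setN 11 (.add (.var 11) (.lit 1)))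
      (fun s => J (s.nvar 11) s ∧ s.nvar 11 ≤ b) (fun s => b - s.nvar 11)
      (fun s hs => by
        have := hN _ _ hs.1
        have := hs.2
        simp only [Test.Fits, NExp.Fits]
        omega)
      (fun s hs hp => by
        have h1 := hN _ _ hs.1
        simp only [Test.Holds, NExp.eval, h1] at hp
        rw [Cmd.wp]
        refine Cmd.wp_mono _ (hbody _ s hp hs.1 rfl) fun s' hs' => ?_
        simp only [Cmd.wp, NExp.Fits, NExp.eval, State.setN_nvar, if_true, hs'.2]
        exact ⟨by omega, ⟨hs'.1, by omega⟩, by omega⟩)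
      (s := s') ⟨hs'.1, by omega⟩).mono (T' := (b + 1) * (body.time + 8)) (by
        refine Nat.mul_le_mul (by omega) ?_
        simp only [Test.cost, Cmd.time, NExp.cost]
        omega) (Q' := J b) fun s hs => by
          have h1 := hN _ _ hs.1.1
          have h2 := hs.2
          simp only [Test.Holds, NExp.eval, h1] at h2
          have : s.nvar 11 = b := by omega
          exact this ▸ hs.1.1
  refine h.mono ?_ fun _ h => h
  simp only [Cmd.time, NExp.cost]
  have : (b + 1) * (body.time + 10) = (b + 1) * (body.time + 8) + (b + 1) * 2 := by ring
  omega

/-- The table of distances and witnesses kept in memory. -/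
noncomputable def State.table (s : State) : DistTable (ℝ ×ₗ ℝ) :=
  ⟨fun i => toLex (s.rarr 1 i, s.rarr 2 i), s.narr 10⟩

end RealRAM

@[simp] theorem arrayOf_val {k l : ℕ} (f : Fin k → Fin l) (i : Fin k) :
    arrayOf f i = (f i : ℕ) := by
  simp [arrayOf]

/-! ### Correctness of lookup and relaxation on the machine -/

namespace InputListing

open RealRAM RootedBagTree

variable {n r m : ℕ} {G : SimpleGraph (Fin n)} {T : RootedBagTree n r} (I : InputListing G T m)
  (w : Sym2 (Fin n) → ℝ)

/-- The input is still available in memory. -/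
structure HasInput (s : State) : Prop where
  nvar : ∀ x, 1 ≤ x → x < 4 → s.nvar x = (I.initialState w).nvar x
  narr : ∀ A, A < 6 → s.narr A = (I.initialState w).narr A
  rarr : s.rarr 0 = (I.initialState w).rarr 0

variable {I w} {s s₀ : State} {B : ℕ}

theorem HasInput.frame {ns as xs rs : List ℕ} (h : I.HasInput w s₀)
    (hf : Frame ns as xs rs s₀ s) (h1 : ∀ x ∈ ns, 4 ≤ x) (h2 : ∀ A ∈ as, 6 ≤ A)
    (h3 : 0 ∉ rs) : I.HasInput w s :=
  ⟨fun x hx hx' => (hf.nvar x fun hm => by have := h1 x hm; omega).trans (h.nvar x hx hx'),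
    fun A hA => (hf.narr A fun hm => by have := h2 A hm; omega).trans (h.narr A hA),
    (hf.rarr 0 h3).trans h.rarr⟩

namespace HasInput

variable (h : I.HasInput w s)
include h

theorem nvar_one : s.nvar 1 = m := h.nvar 1 le_rfl (by norm_num)
theorem nvar_two : s.nvar 2 = r := h.nvar 2 (by norm_num) (by norm_num)
theorem nvar_three : s.nvar 3 = T.root := h.nvar 3 (by norm_num) (by norm_num)
theorem narr_zero : s.narr 0 = arrayOf I.src := h.narr 0 (by norm_num)
theorem narr_one : s.narr 1 = arrayOf I.tgt := h.narr 1 (by norm_num)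
theorem narr_two : s.narr 2 = arrayOf (I.vert 0) := h.narr 2 (by norm_num)
theorem narr_three : s.narr 3 = arrayOf (I.vert 1) := h.narr 3 (by norm_num)
theorem narr_four : s.narr 4 = arrayOf (I.vert 2) := h.narr 4 (by norm_num)
theorem narr_five : s.narr 5 = arrayOf T.father := h.narr 5 (by norm_num)
theorem rarr_zero (i : Fin m) : s.rarr 0 i = w s(I.src i, I.tgt i) := by
  rw [h.rarr]; simp [initialState]

end HasInput

/-- The sizes of the input and the word bound are as in the theorem. -/
structure Sizes (n r m B : ℕ) : Prop where
  three_le : 3 ≤ n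
  bags : r ≤ n
  edges : m ≤ 3 * r
  -- Identifiers stay below `3 * r`, the edge counter reaches `m ≤ 3 * r`, and `Runs.forLoop` needs
  -- one more.
  bound : 3 * n + 1 ≤ B

theorem Sizes.vertex_le (hz : Sizes n r m B) (v : Fin n) : (v : ℕ) ≤ B := by
  have := v.is_lt; have := hz.bound; omega

theorem Sizes.bag_lt (hz : Sizes n r m B) (c : Fin r) : 3 * (c : ℕ) + 2 < B := by
  have := c.is_lt; have := hz.bound; have := hz.bags; omega

theorem Sizes.bag_le (hz : Sizes n r m B) (c : Fin r) : (c : ℕ) ≤ B := by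
  have := hz.bag_lt c; omega

theorem holds_inBag (h : I.HasInput w s) {a x : NExp} {v : Fin n} {c : Fin r}
    (ha : a.eval s = v) (hx : x.eval s = c) : (inBag a x).Holds s ↔ v ∈ T.bag c := by
  simp only [inBag, Test.holds_or, Test.Holds, NExp.eval, ha, hx, h.narr_two, h.narr_three,
    h.narr_four, arrayOf_val, I.mem_bag_iff, Fin.val_inj, eq_comm]

theorem fits_inBag (h : I.HasInput w s) (hz : Sizes n r m B) {a x : NExp} {c : Fin r}
    (ha : a.Fits B s) (hx : x.Fits B s) (hc : x.eval s = c) : (inBag a x).Fits B s := by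
  simp only [inBag, Test.fits_or, Test.Fits, NExp.Fits, hc, h.narr_two, h.narr_three,
    h.narr_four, arrayOf_val, hz.vertex_le, ha, hx, and_self]

theorem wp_lookup (h : I.HasInput w s) (hz : Sizes n r m B) {u v x out : ℕ} {a b : Fin n}
    {c : Fin r} (hu : s.nvar u = a) (hv : s.nvar v = b) (hx : s.nvar x = c) (hu9 : u ≠ 9)
    (hv9 : v ≠ 9) {Q : State → Prop}
    (hQ : Q ((s.setN 9 (T.rep a b c)).setN out (I.idx a b c))) :
    (lookup u v x out).wp B Q s := by
  have hfa : (NExp.get 5 (.var x)).eval s = T.father c := by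
    simp [NExp.eval, hx, h.narr_five]
  have hfx : (NExp.get 5 (.var x)).Fits B s := by
    simp [NExp.Fits, NExp.eval, hx, h.narr_five, hz.bag_le]
  have hua : (NExp.var u).Fits B s := by simp [NExp.Fits, hu, hz.vertex_le]
  have hva : (NExp.var v).Fits B s := by simp [NExp.Fits, hv, hz.vertex_le]
  -- Both branches of the first test leave the topmost bag in variable `9`; the rest of the program
  -- is treated once for both.
  have key : ∀ f : Fin r, f = T.rep a b c →
      Cmd.wp B (.ite (neither u v (.get 2 (.var 9)))
        (.setN out (.add (.var 9) (.add (.var 9) (.var 9))))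
        (.ite (neither u v (.get 3 (.var 9)))
          (.setN out (.add (.add (.var 9) (.add (.var 9) (.var 9))) (.lit 1)))
          (.setN out (.add (.add (.var 9) (.add (.var 9) (.var 9))) (.lit 2)))))
        Q (s.setN 9 f) := by
    rintro f rfl
    have hlt := hz.bag_lt (T.rep a b c)
    simp only [Cmd.wp, neither, Test.Fits, Test.Holds, NExp.Fits, NExp.eval, State.setN_nvar,
      State.setN_narr, hu9, hv9, if_true, if_false, h.narr_two, h.narr_three, arrayOf_val, hu, hv,
      hz.vertex_le, and_true, Fin.val_inj]
    refine ⟨by omega, fun h1 => ?_, fun h1 => ⟨by omega, fun h2 => ?_, fun h2 => ?_⟩⟩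
    · have : I.idx a b c = T.rep a b c + (T.rep a b c + T.rep a b c) := by
        rw [idx, third, if_pos h1]; simp only [Fin.val_zero]; omega
      rw [← this]
      exact ⟨by omega, hQ⟩
    · have : I.idx a b c = T.rep a b c + (T.rep a b c + T.rep a b c) + 1 := by
        rw [idx, third, if_neg h1, if_pos h2]; simp only [Fin.val_one]; omega
      rw [← this]
      exact ⟨by omega, hQ⟩
    · have : I.idx a b c = T.rep a b c + (T.rep a b c + T.rep a b c) + 2 := by
        rw [idx, third, if_neg h1, if_neg h2]; simp only [Fin.val_two]; omega
      rw [← this]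
      exact ⟨by omega, hQ⟩
  refine ⟨⟨fits_inBag h hz hua hfx hfa, fits_inBag h hz hva hfx hfa⟩, fun hp => ?_, fun hp => ?_⟩
  all_goals
    simp only [Test.Holds, holds_inBag h (show (NExp.var u).eval s = a from hu) hfa,
      holds_inBag h (show (NExp.var v).eval s = b from hv) hfa] at hp
  · exact ⟨hfx, hfa.symm ▸ key _ (by rw [rep, if_pos hp])⟩
  · refine ⟨by simp [NExp.Fits, hx, hz.bag_le], ?_⟩
    have := key c (by rw [rep, if_neg hp])
    rw [← hx] at this
    exact this

theorem Sizes.side_le (hz : Sizes n r m B) (c : Fin r) (k : Fin 3) : I.side c k ≤ B := by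
  have := I.idx_lt (I.vert (k + 1) c) (I.vert (k + 2) c) c
  have := hz.bound; have := hz.bags
  unfold side; omega

theorem wp_relaxOne (hs : T.IsSuitable) (hz : Sizes n r m B) {a b e : ℕ} {c : Fin r}
    {k : Fin 3} (ha : s.nvar a = I.side c k) (hb : s.nvar b = I.side c (k + 1))
    (he : s.nvar e = I.side c (k + 2)) (hc : s.nvar 14 = c) :
    (relaxOne a b e).wp B (fun s' => Frame [] [10] [] [1, 2] s s' ∧
      s'.table = I.relaxSide c k s.table) s := by
  have h1 : I.side c (k + 1) ≠ I.side c k := fun h => by simpa using I.side_injective hs c h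
  have h2 : I.side c (k + 2) ≠ I.side c k := fun h => by simpa using I.side_injective hs c h
  have hlt := hz.bag_lt c
  have hiff : (improves a b e).Holds s ↔
      s.table.dist (I.side c (k + 1)) + s.table.dist (I.side c (k + 2)) <
        s.table.dist (I.side c k) := by
    simp only [improves, Test.holds_or, Test.Holds, RExp.eval, NExp.eval, ha, hb, he, State.table,
      ← toLex_add, Prod.mk_add_mk, Prod.Lex.toLex_lt_toLex]
    constructor
    · rintro (h | ⟨h, h'⟩)
      · exact Or.inl h
      · rcases (not_lt.1 h).lt_or_eq with h | h
        · exact Or.inl h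
        · exact Or.inr ⟨h, h'⟩
    · rintro (h | ⟨h, h'⟩)
      · exact Or.inl h
      · exact Or.inr ⟨by rw [h]; exact lt_irrefl _, h'⟩
  refine ⟨?_, fun hp => ?_, fun hp => ?_⟩
  · simp [improves, Test.Fits, RExp.Fits, NExp.Fits, ha, hb, he, hz.side_le]
  · rw [hiff] at hp
    simp only [Cmd.wp, RExp.Fits, NExp.Fits, RExp.eval, NExp.eval, State.storeR_nvar, ha, hb, he,
      hz.side_le, hc, State.storeR_rarr, and_self, true_and]
    refine ⟨by omega, ((Frame.refl s).storeR (by simp) _ _).storeR (by simp) _ _ |>.storeN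
      (by simp) _ _, ?_⟩
    rw [relaxSide, DistTable.relaxSide, if_pos hp]
    simp only [State.table, DistTable.mk.injEq]
    constructor
    · funext i
      by_cases hi : i = I.side c k
      · subst hi
        simp only [State.storeN_rarr, State.storeR_rarr]
        simp [← toLex_add]
      · simp [hi]
    · simp
  · rw [hiff] at hp
    refine ⟨Frame.refl s, ?_⟩
    rw [relaxSide, DistTable.relaxSide, if_neg hp]

theorem wp_relax (h : I.HasInput w s) (hs : T.IsSuitable) (hz : Sizes n r m B) {c : Fin r}
    (hc : s.nvar 14 = c) :
    relax.wp B (fun s' => Frame [9, 15, 16, 17, 18, 19, 20] [10] [] [1, 2] s s' ∧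
      s'.table = I.relaxBag c s.table) s := by
  have hlt := hz.bag_lt c
  have hf : ∀ {s'}, Frame [9, 15, 16, 17, 18, 19, 20] [10] [] [1, 2] s s' → I.HasInput w s' :=
    fun hf => h.frame hf (by simp) (by simp) (by simp)
  simp only [relax, Cmd.wp, NExp.Fits, NExp.eval, State.setN_nvar, State.setN_narr, hc,
    h.narr_two, h.narr_three, h.narr_four, arrayOf_val, hz.vertex_le, hz.bag_le, true_and,
    and_true, reduceIte, Nat.reduceEqDiff]
  have f1 : Frame [9, 15, 16, 17, 18, 19, 20] [10] [] [1, 2] s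
      (((s.setN 15 (I.vert 0 c)).setN 16 (I.vert 1 c)).setN 17 (I.vert 2 c)) :=
    (((Frame.refl s).setN (by simp) _).setN (by simp) _).setN (by simp) _
  refine wp_lookup (hf f1) hz (a := I.vert 1 c) (b := I.vert 2 c) (c := c) (by simp) (by simp)
    (by simpa using hc) (by simp) (by simp) ?_
  have f2 := (f1.setN (x := 9) (by simp) (T.rep (I.vert 1 c) (I.vert 2 c) c)).setN (x := 18)
    (by simp) (I.idx (I.vert 1 c) (I.vert 2 c) c)
  refine wp_lookup (hf f2) hz (a := I.vert 2 c) (b := I.vert 0 c) (c := c) (by simp) (by simp)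
    (by simpa using hc) (by simp) (by simp) ?_
  have f3 := (f2.setN (x := 9) (by simp) (T.rep (I.vert 2 c) (I.vert 0 c) c)).setN (x := 19)
    (by simp) (I.idx (I.vert 2 c) (I.vert 0 c) c)
  refine wp_lookup (hf f3) hz (a := I.vert 0 c) (b := I.vert 1 c) (c := c) (by simp) (by simp)
    (by simpa using hc) (by simp) (by simp) ?_
  have f4 := (f3.setN (x := 9) (by simp) (T.rep (I.vert 0 c) (I.vert 1 c) c)).setN (x := 20)
    (by simp) (I.idx (I.vert 0 c) (I.vert 1 c) c)
  generalize hs4 : State.setN _ 20 _ = s4 at f4 ⊢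
  -- The lookups run through the pairs cyclically, matching `side` because indices in `Fin 3` wrap
  -- around.
  have e18 : s4.nvar 18 = I.side c 0 := by rw [← hs4]; simp; rfl
  have e19 : s4.nvar 19 = I.side c 1 := by rw [← hs4]; simp; rfl
  have e20 : s4.nvar 20 = I.side c 2 := by rw [← hs4]; simp; rfl
  have e14 : s4.nvar 14 = c := by rw [← hs4]; simpa using hc
  have et : s4.table = s.table := by rw [← hs4]; rfl
  have hw : ∀ {s s' : State}, Frame [] [10] [] [1, 2] s s' →
      Frame [9, 15, 16, 17, 18, 19, 20] [10] [] [1, 2] s s' := fun h =>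
    h.weaken (by simp) (by simp) (by simp) (by simp)
  refine Cmd.wp_mono _ (wp_relaxOne hs hz (c := c) (k := 0) e18 e19 e20 e14) ?_
  rintro s5 ⟨f5, t5⟩
  refine Cmd.wp_mono _ (wp_relaxOne hs hz (c := c) (k := 1) ((f5.nvar 19 (by simp)).trans e19)
    ((f5.nvar 20 (by simp)).trans e20) ((f5.nvar 18 (by simp)).trans e18)
    ((f5.nvar 14 (by simp)).trans e14)) ?_
  rintro s6 ⟨f6, t6⟩
  have f6' := f5.trans f6
  refine Cmd.wp_mono _ (wp_relaxOne hs hz (c := c) (k := 2) ((f6'.nvar 20 (by simp)).trans e20)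
    ((f6'.nvar 18 (by simp)).trans e18) ((f6'.nvar 19 (by simp)).trans e19)
    ((f6'.nvar 14 (by simp)).trans e14)) ?_
  rintro s7 ⟨f7, t7⟩
  refine ⟨f4.trans (hw (f6'.trans f7)), ?_⟩
  rw [t7, t6, t5, et, relaxBag]

end InputListing

/-! ## Preprocessing -/

namespace RealRAM

/-- Compute the weight of pairs that are not edges in real variable `1`. -/
def sumWeights : Cmd :=
  .setR 1 (.lit 1) ;; forLoop 1 (.setR 1 (.add (.var 1) (.get 0 (.var 11))))

/-- Count the children of all bags in array `8`. -/
def countChildren : Cmd :=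
  forLoop 2 (.storeN 8 (.get 5 (.var 11)) (.add (.get 8 (.get 5 (.var 11))) (.lit 1)))

/-- If the vertex `get A i`, where `i` is the bag in variable `11` with father in variable `9`, does
not lie in the father, store `i` as its topmost bag. -/
def storeTop (A : ℕ) : Cmd :=
  .ite (.or (.eq (.var 11) (.var 3)) (.not (inBag (.get A (.var 11)) (.var 9))))
    (.storeN 7 (.get A (.var 11)) (.var 11)) .skip

/-- Compute the topmost bags of all vertices in array `7`. -/
def computeTops : Cmd :=
  forLoop 2 (.setN 9 (.get 5 (.var 11)) ;; storeTop 2 ;; storeTop 3 ;; storeTop 4)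

/-- Initialize the table as if there were no edges. -/
def initTable : Cmd :=
  forLoop 2 (.setN 9 (.add (.var 11) (.add (.var 11) (.var 11))) ;;
    .storeR 1 (.var 9) (.var 1) ;; .storeR 1 (.add (.var 9) (.lit 1)) (.var 1) ;;
    .storeR 1 (.add (.var 9) (.lit 2)) (.var 1) ;;
    .storeR 2 (.var 9) (.lit 1) ;; .storeR 2 (.add (.var 9) (.lit 1)) (.lit 1) ;;
    .storeR 2 (.add (.var 9) (.lit 2)) (.lit 1))

/-- Enter the edges into the table. -/
def enterEdges : Cmd :=
  forLoop 1 (.setN 14 (.get 0 (.var 11)) ;; .setN 15 (.get 1 (.var 11)) ;;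
    .setN 16 (.get 7 (.var 14)) ;;
    .ite (inBag (.var 15) (.var 16)) .skip (.setN 16 (.get 7 (.var 15))) ;;
    lookup 14 15 16 17 ;; .storeR 1 (.var 17) (.get 0 (.var 11)))

end RealRAM

/-! ### Correctness of the initialization -/

namespace InputListing

open RealRAM RootedBagTree

variable {n r m : ℕ} {G : SimpleGraph (Fin n)} {T : RootedBagTree n r} {I : InputListing G T m}
  {w : Sym2 (Fin n) → ℝ} {s : State} {B : ℕ}

theorem runs_sumWeights (h : I.HasInput w s) (hz : Sizes n r m B) :
    Runs B sumWeights s (1000 * n) fun s' => Frame [11] [] [1] [] s s' ∧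
      s'.rvar 1 = I.bigWeight w := by
  have hm := hz.edges
  have hr := hz.bags
  have hb := hz.bound
  have h3 := hz.three_le
  refine (Runs.seq (Cmd.wp_sound (B := B) (.setR 1 (.lit 1))
    (fun s' => Frame [11] [] [1] [] s s' ∧ s'.rvar 1 = 1) s ⟨trivial,
      (Frame.refl s).setR (by simp) _, by simp [RExp.eval]⟩) fun s₁ h₁ =>
    Runs.forLoop (b := m) (fun k s' => Frame [11] [] [1] [] s s' ∧
      s'.rvar 1 = 1 + ∑ i ∈ Finset.range k, s.rarr 0 i) ?_ (by omega) ?_ ?_).mono ?_ ?_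
  · rintro k s' ⟨hf, -⟩
    rw [hf.nvar 1 (by simp), h.nvar_one]
  · rintro k s' hk ⟨hf, hs⟩ h11
    refine ⟨⟨trivial, by simp only [NExp.Fits, RExp.Fits]; omega⟩,
      ⟨(hf.setR (by simp) _).setN (by simp) _, ?_⟩, h11⟩
    simp [RExp.eval, NExp.eval, h11, hs, Finset.sum_range_succ, hf.rarr 0, add_assoc]
  · exact ⟨h₁.1.setN (by simp) _, by simpa using h₁.2⟩
  · simp only [Cmd.time, RExp.cost, NExp.cost]
    omega
  · rintro s' ⟨hf, hs⟩
    refine ⟨hf, ?_⟩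
    rw [hs, bigWeight, Finset.sum_range]
    simp only [h.rarr_zero]

/-- The root, being its own father, is counted among its own children. This keeps its counter
positive during pruning. -/
theorem runs_countChildren (h : I.HasInput w s) (hz : Sizes n r m B) (h8 : s.narr 8 = fun _ => 0) :
    Runs B countChildren s (1000 * n) fun s' => Frame [11] [8] [] [] s s' ∧
      ∀ c : Fin r, s'.narr 8 c = (Finset.univ.filter fun i => T.father i = c).card := by
  have hm := hz.edges
  have hr := hz.bags
  have hb := hz.bound
  have h3 := hz.three_le
  refine (Runs.forLoop (b := r) (fun k s' => Frame [11] [8] [] [] s s' ∧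
      ∀ c : Fin r, s'.narr 8 c =
        (Finset.univ.filter fun i : Fin r => (i : ℕ) < k ∧ T.father i = c).card)
      ?_ (by omega) ?_ ?_).mono ?_ ?_
  · rintro k s' ⟨hf, -⟩
    rw [hf.nvar 2 (by simp), h.nvar_two]
  · rintro k s' hk ⟨hf, hs⟩ h11
    obtain ⟨c, rfl⟩ : ∃ c : Fin r, k = c := ⟨⟨k, hk⟩, rfl⟩
    have h5 : s'.narr 5 = arrayOf T.father := (hf.narr 5 (by simp)).trans h.narr_five
    have hle : s'.narr 8 (T.father c) ≤ r := by
      rw [hs]; exact (Finset.card_le_univ _).trans (by simp)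
    have hcB := hz.bag_le c
    have hfB := hz.bag_le (T.father c)
    simp only [Cmd.wp, NExp.Fits, NExp.eval, h11, h5, arrayOf_val]
    refine ⟨⟨hcB, hfB⟩, ⟨⟨⟨hcB, hfB⟩, by omega⟩, by omega, by omega⟩,
      ⟨(hf.storeN (by simp) _ _).setN (by simp) _, fun d => ?_⟩, h11⟩
    have hset : (Finset.univ.filter fun i : Fin r => (i : ℕ) < c + 1 ∧ T.father i = d) =
        if T.father c = d then
          insert c (Finset.univ.filter fun i : Fin r => (i : ℕ) < c ∧ T.father i = d)
        else Finset.univ.filter fun i : Fin r => (i : ℕ) < c ∧ T.father i = d := by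
      split_ifs with hd
      · ext i
        simp only [Finset.mem_filter, Finset.mem_univ, true_and, Finset.mem_insert]
        constructor
        · rintro ⟨h1, h2⟩
          rcases Nat.lt_succ_iff_lt_or_eq.1 h1 with h | h
          · exact Or.inr ⟨h, h2⟩
          · exact Or.inl (Fin.ext h)
        · rintro (rfl | h)
          · exact ⟨by omega, hd⟩
          · exact ⟨by omega, h.2⟩
      · ext i
        simp only [Finset.mem_filter, Finset.mem_univ, true_and]
        constructor
        · rintro ⟨h1, h2⟩
          rcases Nat.lt_succ_iff_lt_or_eq.1 h1 with h | h
          · exact ⟨h, h2⟩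
          · exact absurd (Fin.ext h ▸ h2) hd
        · exact fun h => ⟨by omega, h.2⟩
    rw [hset]
    simp only [State.setN_narr, State.storeN_narr, if_true, Function.update_apply, Fin.val_inj]
    split_ifs with h1 h2 h2
    · rw [Finset.card_insert_of_notMem (by simp), hs, h2]
    · exact absurd h1.symm h2
    · exact absurd h2.symm h1
    · exact hs d
  · exact ⟨(Frame.refl s).setN (by simp) _, by simp [h8]⟩
  · simp only [Cmd.time, NExp.cost]
    omega
  · rintro s' ⟨hf, hs⟩
    exact ⟨hf, by simpa using hs⟩

/-- Correct entries are not spoiled: a write happens only for a top, and tops are unique. -/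
theorem wp_storeTop (hT : T.IsTreeDecomposition G) (h : I.HasInput w s) (hz : Sizes n r m B)
    {A : ℕ} {j : Fin 3} {c : Fin r}
    (hA : s.narr A = arrayOf (I.vert j)) (h11 : s.nvar 11 = c) (h9 : s.nvar 9 = T.father c) :
    (storeTop A).wp B (fun s' => Frame [] [7] [] [] s s' ∧
      (∀ v c', T.IsTop v c' → s.narr 7 v = c' → s'.narr 7 v = c') ∧
      (T.IsTop (I.vert j c) c → s'.narr 7 (I.vert j c) = c)) s := by
  have hf : (NExp.get A (.var 11)).Fits B s := by
    simp [NExp.Fits, NExp.eval, h11, hA, hz.bag_le, hz.vertex_le]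
  have he : (NExp.get A (.var 11)).eval s = I.vert j c := by simp [NExp.eval, h11, hA]
  have hf9 : (NExp.var 9).Fits B s := by simp [NExp.Fits, h9, hz.bag_le]
  have he9 : (NExp.var 9).eval s = T.father c := h9
  have hiff : (Test.or (.eq (.var 11) (.var 3))
      (.not (inBag (.get A (.var 11)) (.var 9)))).Holds s ↔ T.IsTop (I.vert j c) c := by
    simp only [Test.holds_or, Test.Holds, holds_inBag h he he9, NExp.eval, h11, h.nvar_three,
      Fin.val_inj, RootedBagTree.IsTop, I.vert_mem, true_and]
  refine ⟨?_, fun hp => ?_, fun hp => ?_⟩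
  · simp only [Test.fits_or, Test.Fits, fits_inBag h hz hf hf9 he9]
    simp [NExp.Fits, h11, h.nvar_three, hz.bag_le]
  · rw [hiff] at hp
    refine ⟨hf, by simp [NExp.Fits, h11, hz.bag_le], (Frame.refl s).storeN (by simp) _ _, ?_, ?_⟩
    · intro v c' hv hc
      rw [he]
      simp only [State.storeN_narr, if_true, Function.update_apply, Fin.val_inj, NExp.eval, h11]
      split_ifs with hvc
      · subst hvc
        rw [hT.isTop_unique hv hp]
      · exact hc
    · intro _
      rw [he]
      simp [NExp.eval, h11]
  · rw [hiff] at hp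
    exact ⟨Frame.refl s, fun _ _ _ h => h, fun h => absurd h hp⟩

theorem runs_computeTops (hT : T.IsTreeDecomposition G) (h : I.HasInput w s)
    (hz : Sizes n r m B) :
    Runs B computeTops s (1000 * n) fun s' => Frame [9, 11] [7] [] [] s s' ∧
      ∀ v : Fin n, s'.narr 7 v = hT.top v := by
  have hr := hz.bags
  have hb := hz.bound
  have h3 := hz.three_le
  refine (Runs.forLoop (b := r) (fun k s' => Frame [9, 11] [7] [] [] s s' ∧
      ∀ (v : Fin n) (c : Fin r), T.IsTop v c → (c : ℕ) < k → s'.narr 7 v = c) ?_ (by omega) ?_ ?_).mono ?_ ?_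
  · rintro k s' ⟨hf, -⟩
    rw [hf.nvar 2 (by simp), h.nvar_two]
  · rintro k s₀ hk ⟨hf, hs⟩ h11
    obtain ⟨c, rfl⟩ : ∃ c : Fin r, k = c := ⟨⟨k, hk⟩, rfl⟩
    have hin : ∀ {s'}, Frame [9, 11] [7] [] [] s s' → I.HasInput w s' := fun hf =>
      h.frame hf (by simp) (by simp) (by simp)
    have hw : ∀ {s s' : State}, Frame [] [7] [] [] s s' → Frame [9, 11] [7] [] [] s s' := fun h =>
      h.weaken (by simp) (by simp) (by simp) (by simp)
    have h5 := (hin hf).narr_five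
    simp only [Cmd.wp]
    refine ⟨by simp [NExp.Fits, NExp.eval, h11, h5, hz.bag_le], ?_⟩
    have f0 := hf.setN (x := 9) (by simp) (T.father c)
    have e0 : (NExp.get 5 (.var 11)).eval s₀ = T.father c := by simp [NExp.eval, h11, h5]
    rw [e0]
    refine Cmd.wp_mono _ (wp_storeTop hT (j := 0) (c := c) (hin f0) hz (hin f0).narr_two
      (by simpa using h11) (by simp)) ?_
    rintro s₁ ⟨f1, hs1, hc1⟩
    have f1' := f0.trans (hw f1)
    refine Cmd.wp_mono _ (wp_storeTop hT (j := 1) (c := c) (hin f1') hz (hin f1').narr_three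
      ((f1.nvar 11 (by simp)).trans (by simpa using h11))
      ((f1.nvar 9 (by simp)).trans (by simp))) ?_
    rintro s₂ ⟨f2, hs2, hc2⟩
    have f2' := f1'.trans (hw f2)
    refine Cmd.wp_mono _ (wp_storeTop hT (j := 2) (c := c) (hin f2') hz (hin f2').narr_four
      (((f1.trans f2).nvar 11 (by simp)).trans (by simpa using h11))
      (((f1.trans f2).nvar 9 (by simp)).trans (by simp))) ?_
    rintro s₃ ⟨f3, hs3, hc3⟩
    refine ⟨⟨(f2'.trans (hw f3)).setN (by simp) _, fun v c' hv hc' => ?_⟩,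
      (((f1.trans f2).trans f3).nvar 11 (by simp)).trans (by simpa using h11)⟩
    rw [State.setN_narr]
    rcases Nat.lt_succ_iff_lt_or_eq.1 hc' with hlt | heq
    · exact hs3 _ _ hv (hs2 _ _ hv (hs1 _ _ hv (hs _ _ hv hlt)))
    · obtain rfl : c' = c := Fin.ext heq
      obtain ⟨j, rfl⟩ := I.exists_vert hv.1
      fin_cases j
      · exact hs3 _ _ hv (hs2 _ _ hv (hc1 hv))
      · exact hs3 _ _ hv (hc2 hv)
      · exact hc3 hv
  · exact ⟨(Frame.refl s).setN (by simp) _, by simp⟩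
  · have : (Cmd.setN 9 (.get 5 (.var 11)) ;; storeTop 2 ;; storeTop 3 ;; storeTop 4).time ≤ 200 := by
      decide
    nlinarith
  · rintro s' ⟨hf, hs⟩
    exact ⟨hf, fun v => hs v _ (hT.isTop_top v) (Fin.is_lt _)⟩

theorem runs_initTable (h : I.HasInput w s) (hz : Sizes n r m B) :
    Runs B initTable s (1000 * n) fun s' => Frame [9, 11] [] [] [1, 2] s s' ∧
      ∀ i, i < 3 * r → s'.rarr 1 i = s.rvar 1 ∧ s'.rarr 2 i = 1 := by
  have hr := hz.bags
  have hb := hz.bound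
  have h3 := hz.three_le
  refine (Runs.forLoop (b := r) (fun k s' => Frame [9, 11] [] [] [1, 2] s s' ∧
      ∀ i, i < 3 * k → s'.rarr 1 i = s.rvar 1 ∧ s'.rarr 2 i = 1) ?_ (by omega) ?_ ?_).mono ?_ ?_
  · rintro k s' ⟨hf, -⟩
    rw [hf.nvar 2 (by simp), h.nvar_two]
  · rintro k s₀ hk ⟨hf, hs⟩ h11
    have hv : s₀.rvar 1 = s.rvar 1 := hf.rvar 1 (by simp)
    simp only [Cmd.wp, NExp.Fits, NExp.eval, RExp.Fits, RExp.eval, h11, State.setN_nvar,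
      State.storeR_nvar, if_true, true_and, State.setN_rvar, State.storeR_rvar, hv]
    refine ⟨by omega, by omega, by omega, by omega, by omega, by omega, by omega,
      ⟨((((((((hf.setN (by simp) _).storeR (by simp) _ _).storeR (by simp) _ _).storeR (by simp)
        _ _).storeR (by simp) _ _).storeR (by simp) _ _).storeR (by simp) _ _).setN (by simp) _),
        fun i hi => ?_⟩, by simp⟩
    simp only [State.setN_rarr, State.storeR_rarr, if_true, Function.update_apply]
    by_cases h0 : i = k + (k + k)
    · simp [h0]
    by_cases h1 : i = k + (k + k) + 1
    · simp [h1]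
    by_cases h2 : i = k + (k + k) + 2
    · simp [h2]
    simpa [Function.update_apply, h0, h1, h2] using hs i (by omega)
  · exact ⟨(Frame.refl s).setN (by simp) _, by simp⟩
  · simp only [Cmd.time, NExp.cost, RExp.cost]
    omega
  · exact fun s' h => h

/-- The input does not name a bag for an edge. One is found in constant time, since by `mem_bag_top`
the top bag of one of its ends contains the other end. -/
theorem runs_enterEdges (hT : T.IsTreeDecomposition G) (hs : T.IsSuitable) (h : I.HasInput w s)
    (hz : Sizes n r m B) (h7 : ∀ v : Fin n, s.narr 7 v = hT.top v)
    (h1 : ∀ i, i < 3 * r → s.rarr 1 i = I.bigWeight w ∧ s.rarr 2 i = 1) :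
    Runs B enterEdges s (1000 * n) fun s' => Frame [9, 11, 14, 15, 16, 17] [] [] [1] s s' ∧
      ∀ u v c, u ≠ v → u ∈ T.bag c → v ∈ T.bag c →
        s'.table.dist (I.idx u v c) = I.pairLen w u v := by
  classical
  have hr := hz.bags
  have hb := hz.bound
  have h3 := hz.three_le
  have hm := hz.edges
  refine (Runs.forLoop (b := m) (fun k s' => Frame [9, 11, 14, 15, 16, 17] [] [] [1] s s' ∧
      ∀ u v c, u ≠ v → u ∈ T.bag c → v ∈ T.bag c → s'.rarr 1 (I.idx u v c) =
        if ∃ i : Fin m, (i : ℕ) < k ∧ s(I.src i, I.tgt i) = s(u, v) then w s(u, v)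
        else I.bigWeight w) ?_ (by omega) ?_ ?_).mono ?_ ?_
  · rintro k s' ⟨hf, -⟩
    rw [hf.nvar 1 (by simp), h.nvar_one]
  · rintro k s₀ hk ⟨hf, hs0⟩ h11
    obtain ⟨e, rfl⟩ : ∃ e : Fin m, k = e := ⟨⟨k, hk⟩, rfl⟩
    have hin : ∀ {s'}, Frame [9, 11, 14, 15, 16, 17] [] [] [1] s s' → I.HasInput w s' := fun hf =>
      h.frame hf (by simp) (by simp) (by simp)
    have h0 := (hin hf).narr_zero
    have h1 := (hin hf).narr_one
    have hr0 := (hin hf).rarr_zero e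
    have h7' : ∀ v : Fin n, s₀.narr 7 v = hT.top v := fun v => by
      rw [hf.narr 7 (by simp), h7]
    have hne := (I.adj_of_edge e).ne
    -- The part of the body after a bag `c` containing both ends has been found, common to both
    -- branches.
    have hrest : ∀ (s₂ : State) (c : Fin r), Frame [9, 11, 14, 15, 16, 17] [] [] [1] s s₂ →
        s₂.nvar 14 = I.src e → s₂.nvar 15 = I.tgt e → s₂.nvar 16 = c → s₂.nvar 11 = e →
        s₂.rarr = s₀.rarr → I.src e ∈ T.bag c → I.tgt e ∈ T.bag c →
        (lookup 14 15 16 17 ;; .storeR 1 (.var 17) (.get 0 (.var 11))).wp B (fun s' =>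
          (Frame [9, 11, 14, 15, 16, 17] [] [] [1] s (s'.setN 11 (e + 1)) ∧
          ∀ u v c, u ≠ v → u ∈ T.bag c → v ∈ T.bag c →
            (s'.setN 11 (e + 1)).rarr 1 (I.idx u v c) =
              if ∃ i : Fin m, (i : ℕ) < e + 1 ∧ s(I.src i, I.tgt i) = s(u, v) then w s(u, v)
              else I.bigWeight w) ∧ s'.nvar 11 = e) s₂ := by
      intro s₂ c hf₂ h14 h15 h16 h11 hrarr hsrc htgt
      refine wp_lookup (hin hf₂) hz h14 h15 h16 (by simp) (by simp) ?_
      have hidx := I.idx_lt (I.src e) (I.tgt e) c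
      simp only [Cmd.wp, NExp.Fits, RExp.Fits, NExp.eval, RExp.eval, State.setN_nvar,
        State.setN_rarr, State.storeR_nvar, h11, hrarr, hr0, reduceIte, Nat.reduceEqDiff]
      refine ⟨by omega, by omega, ⟨(((hf₂.setN (by simp) _).setN (by simp) _).storeR (by simp)
        _ _).setN (by simp) _, fun u v c' huv hu hv => ?_⟩, trivial⟩
      simp only [State.storeR_rarr, State.setN_rarr, hrarr, if_true, Function.update_apply]
      have hlt : (∃ i : Fin m, (i : ℕ) < e + 1 ∧ s(I.src i, I.tgt i) = s(u, v)) ↔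
          s(I.src e, I.tgt e) = s(u, v) ∨
            ∃ i : Fin m, (i : ℕ) < e ∧ s(I.src i, I.tgt i) = s(u, v) := by
        constructor
        · rintro ⟨i, h1, h2⟩
          rcases Nat.lt_succ_iff_lt_or_eq.1 h1 with h | h
          · exact Or.inr ⟨i, h, h2⟩
          · exact Or.inl (Fin.ext h ▸ h2)
        · rintro (h | ⟨i, h1, h2⟩)
          · exact ⟨e, by omega, h⟩
          · exact ⟨i, by omega, h2⟩
      by_cases hi : I.idx u v c' = I.idx (I.src e) (I.tgt e) c
      · have heq := I.idx_inj hs huv hne hu hv hsrc htgt hi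
        rw [if_pos hi, if_pos (hlt.2 (Or.inl heq.symm)), heq]
      · have hne' : s(I.src e, I.tgt e) ≠ s(u, v) := by
          intro heq
          apply hi
          rw [Sym2.eq_iff] at heq
          rcases heq with ⟨rfl, rfl⟩ | ⟨rfl, rfl⟩
          · exact I.idx_congr hT hs huv hu hv hsrc htgt
          · rw [I.idx_comm]
            exact I.idx_congr hT hs huv.symm hv hu hsrc htgt
        rw [if_neg hi, hs0 u v c' huv hu hv]
        simp only [hlt, hne', false_or]
    have f1 := ((hf.setN (x := 14) (by simp) (I.src e)).setN (x := 15) (by simp) (I.tgt e)).setN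
      (x := 16) (by simp) (hT.top (I.src e))
    have e0 : (NExp.get 0 (.var 11)).eval s₀ = I.src e := by simp [NExp.eval, h11, h0]
    have e1 : (NExp.get 1 (.var 11)).eval (s₀.setN 14 (I.src e)) = I.tgt e := by
      simp [NExp.eval, h11, h1]
    have e2 : (NExp.get 7 (.var 14)).eval ((s₀.setN 14 (I.src e)).setN 15 (I.tgt e)) =
        hT.top (I.src e) := by simp [NExp.eval, h7']
    refine ⟨by simp [NExp.Fits, NExp.eval, h11, h0, hz.vertex_le]; omega, ?_⟩
    rw [e0]
    refine ⟨by simp [NExp.Fits, NExp.eval, h11, h1, hz.vertex_le]; omega, ?_⟩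
    rw [e1]
    refine ⟨by simp [NExp.Fits, NExp.eval, hz.vertex_le, h7', hz.bag_le], ?_⟩
    rw [e2]
    generalize hs₁ : State.setN _ 16 _ = s₁ at f1 ⊢
    have h14 : s₁.nvar 14 = I.src e := by simp [← hs₁]
    have h15 : s₁.nvar 15 = I.tgt e := by simp [← hs₁]
    have h16 : s₁.nvar 16 = hT.top (I.src e) := by simp [← hs₁]
    have h11' : s₁.nvar 11 = e := by simp [← hs₁, h11]
    have hra : s₁.rarr = s₀.rarr := by simp [← hs₁]
    have hholds := holds_inBag (hin f1) (a := .var 15) (x := .var 16) h15 h16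
    refine ⟨fits_inBag (hin f1) hz (by simp [NExp.Fits, h15, hz.vertex_le])
      (by simp [NExp.Fits, h16, hz.bag_le]) h16, fun hp => ?_, fun hp => ?_⟩
    · exact hrest s₁ _ f1 h14 h15 h16 h11' hra (hT.isTop_top _).1 (hholds.1 hp)
    · have hmem : I.src e ∈ T.bag (hT.top (I.tgt e)) := by
        obtain ⟨b, hb1, hb2⟩ := hT.edge _ _ (I.adj_of_edge e)
        refine hT.mem_bag_top hb2 hb1 (le_of_not_ge fun hle => hp (hholds.2 ?_))
        exact hT.mem_bag_top hb1 hb2 hle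
      have e3 : (NExp.get 7 (.var 15)).eval s₁ = hT.top (I.tgt e) := by
        simp [NExp.eval, h15, f1.narr 7, h7]
      refine ⟨by simp [NExp.Fits, NExp.eval, h15, f1.narr 7, h7, hz.vertex_le, hz.bag_le], ?_⟩
      rw [e3]
      exact hrest _ _ (f1.setN (by simp) _) (by simpa using h14) (by simpa using h15) (by simp)
        (by simpa using h11') hra hmem (hT.isTop_top _).1
  · refine ⟨(Frame.refl s).setN (by simp) _, fun u v c _ _ _ => ?_⟩
    simp [(h1 _ (I.idx_lt u v c)).1]
  · have : (Cmd.setN 14 (.get 0 (.var 11)) ;; .setN 15 (.get 1 (.var 11)) ;;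
      .setN 16 (.get 7 (.var 14)) ;;
      .ite (inBag (.var 15) (.var 16)) .skip (.setN 16 (.get 7 (.var 15))) ;;
      lookup 14 15 16 17 ;; .storeR 1 (.var 17) (.get 0 (.var 11))).time ≤ 200 := by
      decide
    nlinarith
  · rintro s' ⟨hf, hs'⟩
    refine ⟨hf, fun u v c huv hu hv => ?_⟩
    have e2 : s'.rarr 2 (I.idx u v c) = 1 := by
      rw [hf.rarr 2 (by simp)]; exact (h1 _ (I.idx_lt u v c)).2
    have hiff : (∃ i : Fin m, (i : ℕ) < m ∧ s(I.src i, I.tgt i) = s(u, v)) ↔ G.Adj u v := by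
      rw [← SimpleGraph.mem_edgeSet, ← I.edge_range]
      simp
    simp only [State.table, hs' u v c huv hu hv, e2, pairLen, hiff]

end InputListing

/-! ### Ordering the bags by pruning leaves, and the two relaxation passes -/

namespace RealRAM

/-- Append the integer `e` to the queue in array `9` with length in variable `13`. -/
def push (e : NExp) : Cmd :=
  .storeN 9 (.var 13) e ;; .setN 13 (.add (.var 13) (.lit 1))

/-- Put all bags without children into the queue. -/
def pushLeaves : Cmd :=
  .setN 13 (.lit 0) ;; forLoop 2 (.ite (.eq (.get 8 (.var 11)) (.lit 0)) (push (.var 11)) .skip)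

/-- Take a bag from the queue; if it is the last child of its father, put the father into the
queue. -/
def pruneLeaf : Cmd :=
  .setN 15 (.get 5 (.get 9 (.var 12))) ;;
  .storeN 8 (.var 15) (.sub (.get 8 (.var 15)) (.lit 1)) ;;
  .ite (.eq (.get 8 (.var 15)) (.lit 0)) (push (.var 15)) .skip ;;
  .setN 12 (.add (.var 12) (.lit 1))

/-- Compute in array `9` a list of all bags in which children precede their fathers. -/
def computeOrder : Cmd :=
  pushLeaves ;; .setN 12 (.lit 0) ;; .loop (.lt (.var 12) (.var 13)) pruneLeaf ;; push (.var 3)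

/-- Relax all bags in the order of array `9`. -/
def passUp : Cmd :=
  forLoop 2 (.setN 14 (.get 9 (.var 11)) ;; relax)

/-- Relax all bags in the reverse order of array `9`. -/
def passDown : Cmd :=
  forLoop 2 (.setN 14 (.get 9 (.sub (.sub (.var 2) (.lit 1)) (.var 11))) ;; relax)

/-- Build the data structure. -/
def preprocess : Cmd :=
  sumWeights ;; countChildren ;; computeTops ;; initTable ;; enterEdges ;; computeOrder ;;
  passUp ;; passDown

end RealRAM

namespace InputListing

open RealRAM RootedBagTree

variable {n r m : ℕ} {G : SimpleGraph (Fin n)} {T : RootedBagTree n r} {I : InputListing G T m}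
  {w : Sym2 (Fin n) → ℝ} {s : State} {B : ℕ}

/-- The array begins with the elements of the list. -/
def Listed (a : ℕ → ℕ) (L : List (Fin r)) : Prop :=
  ∀ i (h : i < L.length), a i = L[i]

theorem Listed.append {a : ℕ → ℕ} {L : List (Fin r)} (h : Listed a L) (c : Fin r) :
    Listed (Function.update a L.length c) (L ++ [c]) := by
  intro i hi
  rw [List.length_append, List.length_singleton] at hi
  by_cases hl : i = L.length
  · subst hl
    simp
  · have hlt : i < L.length := by omega
    rw [Function.update_of_ne hl, List.getElem_append_left hlt, h i hlt]

theorem length_le_of_nodup {L : List (Fin r)} (h : L.Nodup) : L.length ≤ r := by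
  simpa using h.length_le_card

variable (T) in
/-- The number of children not in `A`. -/
def restCount (A : List (Fin r)) (c : Fin r) : ℕ :=
  (Finset.univ.filter fun i => T.father i = c ∧ i ∉ A).card

/-- With `i` the root, this shows that the root never enters the queue; it is appended at the very
end. -/
theorem restCount_pos {A : List (Fin r)} {i : Fin r} (hi : i ∉ A) :
    restCount T A (T.father i) ≠ 0 :=
  (Finset.card_pos.2 ⟨i, by simp [hi]⟩).ne'

theorem restCount_append {A : List (Fin r)} {x : Fin r} (hx : x ∉ A) (c : Fin r) :
    restCount T (A ++ [x]) c =
      if c = T.father x then restCount T A (T.father x) - 1 else restCount T A c := by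
  unfold restCount
  split_ifs with h
  · subst h
    rw [← Finset.card_erase_of_mem (a := x) (by simp [hx])]
    congr 1
    ext i
    simp only [Finset.mem_filter, Finset.mem_univ, true_and, Finset.mem_erase, List.mem_append,
      List.mem_singleton]
    tauto
  · congr 1
    ext i
    simp only [Finset.mem_filter, Finset.mem_univ, true_and, List.mem_append,
      List.mem_singleton]
    constructor
    · tauto
    · rintro ⟨rfl, h2⟩
      refine ⟨rfl, ?_⟩
      rintro (h3 | rfl)
      · exact h2 h3
      · exact h rfl

variable (T) in
/-- The state of pruning: the bags in `A` have been pruned, those in `Q` are waiting. -/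
structure Pruning (cnt : Fin r → ℕ) (A Q : List (Fin r)) : Prop where
  nodup : (A ++ Q).Nodup
  root_notMem : T.root ∉ A ++ Q
  order : (A ++ Q).Pairwise fun a b => T.father b ≠ a
  count : ∀ c, cnt c = restCount T A c
  mem_iff : ∀ c, c ∈ A ++ Q ↔ cnt c = 0

/-- Before this step the father still counts the unpruned `x`, so it is not yet listed. Appending it
respects the order: a listed grandfather would have count zero although it has the unpruned child
`T.father x`. -/
theorem Pruning.step {cnt cnt' : Fin r → ℕ} {A Q : List (Fin r)} {x : Fin r}
    (h : Pruning T cnt A (x :: Q))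
    (h' : ∀ c, cnt' c = if c = T.father x then cnt (T.father x) - 1 else cnt c) :
    Pruning T cnt' (A ++ [x]) (if cnt' (T.father x) = 0 then Q ++ [T.father x] else Q) := by
  have hx : x ∉ A := by
    have := h.nodup
    rw [List.nodup_append] at this
    exact fun hx => this.2.2 x hx x (by simp) rfl
  have hcnt : ∀ c, cnt' c = restCount T (A ++ [x]) c := fun c => by
    rw [h', restCount_append hx, h.count, h.count]
  have hf : T.father x ∉ A ++ x :: Q := by
    rw [h.mem_iff, h.count]
    exact restCount_pos hx
  have happ : ∀ L, A ++ [x] ++ L = A ++ x :: L := by simp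
  split_ifs with h0
  · have e : A ++ [x] ++ (Q ++ [T.father x]) = (A ++ x :: Q) ++ [T.father x] := by simp
    refine ⟨?_, ?_, ?_, hcnt, fun c => ?_⟩
    · rw [e, List.nodup_append]
      refine ⟨h.nodup, by simp, fun a ha b hb => ?_⟩
      rw [List.mem_singleton] at hb
      rintro rfl
      exact hf (hb ▸ ha)
    · rw [e, List.mem_append, List.mem_singleton]
      rintro (h1 | h1)
      · exact h.root_notMem h1
      · rw [hcnt, ← h1] at h0
        have h2 : T.root ∉ A ++ [x] := fun h3 => h.root_notMem (by
          rw [← happ]; exact List.mem_append_left _ h3)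
        exact restCount_pos h2 (T.father_root.symm ▸ h0)
    · rw [e, List.pairwise_append]
      refine ⟨h.order, by simp, fun a ha b hb => ?_⟩
      rw [List.mem_singleton] at hb
      subst hb
      rintro rfl
      rw [h.mem_iff, h.count] at ha
      exact restCount_pos (fun h1 => hf (List.mem_append_left _ h1)) ha
    · rw [e, List.mem_append, List.mem_singleton, h.mem_iff]
      by_cases hc : c = T.father x
      · subst hc; simp [h0]
      · simp [h' c, hc]
  · rw [← happ] at hf
    refine ⟨by rw [happ]; exact h.nodup, by rw [happ]; exact h.root_notMem,
      by rw [happ]; exact h.order, hcnt, fun c => ?_⟩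
    by_cases hc : c = T.father x
    · subst hc; simp only [hf, h0]
    · rw [happ, h.mem_iff, h' c, if_neg hc]

/-- A deepest unpruned bag other than the root has a nonzero count, since the queue is empty. So it
has an unpruned child, which is deeper. -/
theorem Pruning.complete {cnt : Fin r → ℕ} {A : List (Fin r)} (h : Pruning T cnt A []) (c : Fin r)
    (hc : c ≠ T.root) : c ∈ A := by
  by_contra hA
  obtain ⟨d, hd, hmax⟩ := (Finset.univ.filter fun c => c ≠ T.root ∧ c ∉ A).exists_max_image
    T.depth ⟨c, by simp [hc, hA]⟩
  simp only [Finset.mem_filter, Finset.mem_univ, true_and] at hd hmax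
  have h1 : cnt d ≠ 0 := fun h0 => hd.2 (by simpa using (h.mem_iff d).2 h0)
  rw [h.count] at h1
  obtain ⟨i, hi⟩ := Finset.card_pos.1 (Nat.pos_of_ne_zero h1)
  simp only [Finset.mem_filter, Finset.mem_univ, true_and] at hi
  have hir : i ≠ T.root := by
    rintro rfl
    exact hd.1 (hi.1.symm.trans T.father_root)
  have h2 := hmax i ⟨hir, hi.2⟩
  have h3 := T.depth_father_lt hir
  rw [hi.1] at h3
  omega

variable (T) in
/-- All bags, children before fathers. -/
structure IsOrder (L : List (Fin r)) : Prop where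
  length : L.length = r
  nodup : L.Nodup
  mem : ∀ c, c ∈ L
  order : L.Pairwise fun a b => T.father b ≠ a

theorem Pruning.isOrder {cnt : Fin r → ℕ} {A : List (Fin r)} (h : Pruning T cnt A []) :
    IsOrder T (A ++ [T.root]) := by
  have hA : T.root ∉ A := by simpa using h.root_notMem
  have hnd : (A ++ [T.root]).Nodup := by
    rw [List.nodup_append]
    refine ⟨by simpa using h.nodup, by simp, fun a ha b hb => ?_⟩
    rw [List.mem_singleton] at hb
    rintro rfl
    exact hA (hb ▸ ha)
  have hmem : ∀ c, c ∈ A ++ [T.root] := fun c => by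
    by_cases hc : c = T.root
    · simp [hc]
    · exact List.mem_append_left _ (h.complete c hc)
  refine ⟨?_, hnd, hmem, ?_⟩
  · rw [← List.toFinset_card_of_nodup hnd,
      Finset.eq_univ_of_forall fun c => List.mem_toFinset.2 (hmem c)]
    simp
  · rw [List.pairwise_append]
    refine ⟨by simpa using h.order, by simp, fun a ha b hb => ?_⟩
    rw [List.mem_singleton] at hb
    subst hb
    rw [T.father_root]
    rintro rfl
    exact hA ha

theorem runs_pushLeaves (h : I.HasInput w s) (hz : Sizes n r m B)
    (h8 : ∀ c : Fin r, s.narr 8 c = (Finset.univ.filter fun i => T.father i = c).card) :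
    Runs B pushLeaves s (1000 * n) fun s' => Frame [11, 13] [9] [] [] s s' ∧
      ∃ Q : List (Fin r), Listed (s'.narr 9) Q ∧ s'.nvar 13 = Q.length ∧
        Pruning T (fun c => s.narr 8 c) [] Q := by
  have hr := hz.bags
  have hb := hz.bound
  have h3 := hz.three_le
  refine (Runs.seq (Cmd.wp_sound (B := B) (.setN 13 (.lit 0))
    (fun s' => Frame [11, 13] [9] [] [] s s' ∧ s'.nvar 13 = 0) s ⟨Nat.zero_le _,
      (Frame.refl s).setN (by simp) _, by simp [NExp.eval]⟩) fun s₁ h₁ =>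
    Runs.forLoop (b := r) (fun k s' => Frame [11, 13] [9] [] [] s s' ∧
      ∃ Q : List (Fin r), Listed (s'.narr 9) Q ∧ s'.nvar 13 = Q.length ∧ Q.Nodup ∧
        ∀ c, c ∈ Q ↔ (c : ℕ) < k ∧ s.narr 8 c = 0) ?_ (by omega) ?_ ?_).mono ?_ ?_
  · rintro k s' ⟨hf, -⟩
    rw [hf.nvar 2 (by simp), h.nvar_two]
  · rintro k s' hk ⟨hf, Q, hQ, h13, hnd, hmem⟩ h11
    obtain ⟨c, rfl⟩ : ∃ c : Fin r, k = c := ⟨⟨k, hk⟩, rfl⟩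
    have hcB := hz.bag_le c
    have hlen := length_le_of_nodup hnd
    have e8 : s'.narr 8 = s.narr 8 := hf.narr 8 (by simp)
    have hle : s.narr 8 c ≤ r := by
      rw [h8]; exact (Finset.card_le_univ _).trans (by simp)
    have hlt : ∀ d : Fin r, (d : ℕ) < c + 1 ↔ (d : ℕ) < c ∨ d = c := fun d => by
      rw [Nat.lt_succ_iff_lt_or_eq, Fin.val_inj]
    refine ⟨by simp [NExp.Fits, Test.Fits, NExp.eval, h11, e8]; omega, fun hp => ?_, fun hp => ?_⟩
    · simp only [Test.Holds, NExp.eval, h11, e8] at hp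
      simp only [push, Cmd.wp, NExp.Fits, NExp.eval, State.storeN_nvar, h11, h13]
      refine ⟨by omega, hcB, by omega, ⟨((hf.storeN (by simp) _ _).setN (by simp) _).setN
        (by simp) _, Q ++ [c], ?_, ?_, ?_, fun d => ?_⟩, ?_⟩
      · simpa using hQ.append c
      · simp
      · rw [List.nodup_append]
        refine ⟨hnd, by simp, fun a ha b hb => ?_⟩
        rw [List.mem_singleton] at hb
        rintro rfl
        rw [hb, hmem] at ha
        omega
      · rw [List.mem_append, hmem, List.mem_singleton, hlt]
        constructor
        · rintro (h1 | rfl)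
          · exact ⟨Or.inl h1.1, h1.2⟩
          · exact ⟨Or.inr rfl, hp⟩
        · tauto
      · simp [h11]
    · simp only [Test.Holds, NExp.eval, h11, e8] at hp
      refine ⟨⟨hf.setN (by simp) _, Q, hQ, by simpa using h13, hnd, fun d => ?_⟩, h11⟩
      rw [hmem, hlt]
      constructor
      · tauto
      · rintro ⟨h1 | rfl, h2⟩
        · exact ⟨h1, h2⟩
        · exact absurd h2 hp
  · exact ⟨h₁.1.setN (by simp) _, [], fun i hi => by simp at hi, by simpa using h₁.2, by simp,
      by simp⟩
  · have h1 : (Cmd.setN 13 (.lit 0)).time ≤ 10 := by decide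
    have h2 : (Cmd.ite (.eq (.get 8 (.var 11)) (.lit 0)) (push (.var 11)) .skip).time ≤ 100 := by
      decide
    nlinarith
  · rintro s' ⟨hf, Q, hQ, h13, hnd, hmem⟩
    have hcnt : ∀ c : Fin r, s.narr 8 c = restCount T [] c := fun c => by
      rw [h8, restCount]; simp
    have hmem' : ∀ c, c ∈ Q ↔ s.narr 8 c = 0 := fun c => by simpa using hmem c
    refine ⟨hf, Q, hQ, h13, by simpa using hnd, ?_, ?_, hcnt, by simpa using hmem'⟩
    · rw [List.nil_append, hmem', hcnt]
      have := restCount_pos (T := T) (A := []) (i := T.root) (by simp)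
      rwa [T.father_root] at this
    · refine List.pairwise_of_forall_mem_list fun a ha b _ => ?_
      rintro rfl
      rw [List.nil_append, hmem', hcnt] at ha
      exact restCount_pos (by simp) ha

/-- Variables `12` and `13` are head and tail of the queue. Nothing is erased from array `9`, so the
pruned prefix `A` is itself the order being built. -/
theorem wp_pruneLeaf (h : I.HasInput w s) (hz : Sizes n r m B) {A Q : List (Fin r)} {x : Fin r}
    (hL : Listed (s.narr 9) (A ++ x :: Q)) (h12 : s.nvar 12 = A.length)
    (h13 : s.nvar 13 = (A ++ x :: Q).length) (hP : Pruning T (fun c => s.narr 8 c) A (x :: Q)) :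
    pruneLeaf.wp B (fun s' => Frame [11, 12, 13, 15] [8, 9] [] [] s s' ∧
      s'.nvar 12 = A.length + 1 ∧ ∃ Q', Listed (s'.narr 9) (A ++ [x] ++ Q') ∧
        s'.nvar 13 = (A ++ [x] ++ Q').length ∧ Pruning T (fun c => s'.narr 8 c) (A ++ [x]) Q') s := by
  have hr := hz.bags
  have hb := hz.bound
  have h3 := hz.three_le
  have hlen := length_le_of_nodup hP.nodup
  have hlen' := hlen
  rw [List.length_append, List.length_cons] at hlen'
  have hA : s.narr 9 A.length = x := by
    rw [hL _ (by simp)]; simp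
  have hxB := hz.bag_le x
  have hfB := hz.bag_le (T.father x)
  have hcnt : s.narr 8 (T.father x) ≤ r := by
    have := hP.count (T.father x)
    rw [this]; exact (Finset.card_le_univ _).trans (by simp)
  simp only [pruneLeaf, push, Cmd.wp, NExp.Fits, NExp.eval, h12, hA, h.narr_five, arrayOf_val,
    State.setN_nvar, State.setN_narr, State.storeN_nvar, State.storeN_narr, Test.Fits, Test.Holds,
    h13, reduceIte, Nat.reduceEqDiff, Function.update_self]
  have hstep := hP.step (cnt' := fun c : Fin r => Function.update (s.narr 8) (T.father x)
    (s.narr 8 (T.father x) - 1) c) fun c => by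
      simp [Function.update_apply, Fin.val_inj]
  simp only [Function.update_self] at hstep
  refine ⟨by omega, by omega, by omega, by omega, fun h0 => ?_, fun h0 => ?_⟩
  · rw [if_pos h0] at hstep
    refine ⟨by omega, by omega, by omega, by omega, ((((((Frame.refl s).setN (by simp) _).storeN
      (by simp) _ _).storeN (by simp) _ _).setN (by simp) _).setN (by simp) _), trivial,
      Q ++ [T.father x], ?_, ?_, ?_⟩
    · have := hL.append (T.father x)
      simpa using this
    · simp; omega
    · simpa [Function.update_apply] using hstep
  · rw [if_neg h0] at hstep
    refine ⟨by omega, ((((Frame.refl s).setN (by simp) _).storeN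
      (by simp) _ _).setN (by simp) _), trivial, Q, ?_, ?_, ?_⟩
    · simpa using hL
    · simp
    · simpa using hstep

theorem runs_computeOrder (h : I.HasInput w s) (hz : Sizes n r m B)
    (h8 : ∀ c : Fin r, s.narr 8 c = (Finset.univ.filter fun i => T.father i = c).card) :
    Runs B computeOrder s (2000 * n) fun s' => Frame [11, 12, 13, 15] [8, 9] [] [] s s' ∧
      ∃ L, IsOrder T L ∧ Listed (s'.narr 9) L := by
  have hr := hz.bags
  have hb := hz.bound
  have h3 := hz.three_le
  refine (Runs.seq (runs_pushLeaves h hz h8) fun s₁ hs₁ => Runs.seq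
    (Q := fun s' => Frame [11, 12, 13, 15] [8, 9] [] [] s s' ∧ ∃ A Q : List (Fin r),
      Listed (s'.narr 9) (A ++ Q) ∧ s'.nvar 12 = A.length ∧ s'.nvar 13 = (A ++ Q).length ∧
      Pruning T (fun c => s'.narr 8 c) A Q)
    (Cmd.wp_sound (B := B) (.setN 12 (.lit 0)) _ s₁ ?_) fun s₂ hs₂ => Runs.seq
    ((Runs.loop (fun s' => Frame [11, 12, 13, 15] [8, 9] [] [] s s' ∧ ∃ A Q : List (Fin r),
      Listed (s'.narr 9) (A ++ Q) ∧ s'.nvar 12 = A.length ∧ s'.nvar 13 = (A ++ Q).length ∧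
      Pruning T (fun c => s'.narr 8 c) A Q) (fun s' => r - s'.nvar 12) ?_ ?_ hs₂).mono
      (T' := (r + 1) * 50) ?_ (fun _ h => h))
    fun s₃ hs₃ => Cmd.wp_sound (push (.var 3)) _ s₃ ?_).mono ?_ fun _ h => h
  · obtain ⟨hf, Q, hQ, h13, hP⟩ := hs₁
    refine ⟨Nat.zero_le _, (hf.weaken (by simp) (by simp) (by simp) (by simp)).setN (by simp) _,
      [], Q, hQ, by simp [NExp.eval], by simpa using h13, ?_⟩
    simpa [hf.narr 8] using hP
  · rintro s' ⟨-, A, Q, -, h12, h13, hP⟩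
    have hlen := length_le_of_nodup hP.nodup
    have hlen' := hlen
    rw [List.length_append] at hlen'
    simp only [Test.Fits, NExp.Fits]
    omega
  · rintro s' ⟨hf, A, Q, hL, h12, h13, hP⟩ hp
    simp only [Test.Holds, NExp.eval, h12, h13, List.length_append] at hp
    obtain ⟨x, Q, rfl⟩ : ∃ x Q', Q = x :: Q' := by
      cases Q with
      | nil => simp at hp
      | cons x Q => exact ⟨x, Q, rfl⟩
    have hlen := length_le_of_nodup hP.nodup
    rw [List.length_append, List.length_cons] at hlen
    refine Cmd.wp_mono _ (wp_pruneLeaf (h.frame hf (by simp) (by simp) (by simp)) hz hL h12 h13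
      hP) ?_
    rintro s'' ⟨hf', h12', Q', h1, h2, h3⟩
    exact ⟨⟨hf.trans hf', A ++ [x], Q', h1, by simpa using h12', h2, h3⟩, by omega⟩
  · refine Nat.mul_le_mul (by omega) ?_
    decide
  · obtain ⟨⟨hf, A, Q, hL, h12, h13, hP⟩, hn⟩ := hs₃
    simp only [Test.Holds, NExp.eval, h12, h13, List.length_append] at hn
    obtain rfl : Q = [] := List.eq_nil_of_length_eq_zero (by omega)
    have hlen := length_le_of_nodup hP.nodup
    have h3' : s₃.nvar 3 = T.root := by rw [hf.nvar 3 (by simp), h.nvar_three]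
    have hroot := hz.bag_le T.root
    simp only [List.append_nil] at hlen h13
    refine ⟨by simp only [NExp.Fits]; omega, by simp only [NExp.Fits]; omega,
      by simp only [NExp.Fits, NExp.eval, State.storeN_nvar]; omega,
      (hf.storeN (by simp) _ _).setN (by simp) _, A ++ [T.root], hP.isOrder, ?_⟩
    have := hL.append T.root
    simpa [NExp.eval, h13, h3'] using this
  · simp only [push, Cmd.time, NExp.cost]
    omega

/-- A freshly relaxed bag satisfies all its inequalities. Later relaxations in this order never
concern its children, so `Relaxed.upOK_of_eq` preserves what is needed. -/
theorem runs_passUp (hs : T.IsSuitable) (h : I.HasInput w s)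
    (hz : Sizes n r m B) {d₀ : ℕ → ℝ ×ₗ ℝ} (ht : I.Consistent IsLen d₀ s.table)
    {L : List (Fin r)} (hL : IsOrder T L) (h9 : Listed (s.narr 9) L) :
    Runs B passUp s (4000 * n) fun s' =>
      Frame [9, 11, 14, 15, 16, 17, 18, 19, 20] [10] [] [1, 2] s s' ∧
      I.Consistent IsLen d₀ s'.table ∧ ∀ c, I.UpOK s'.table.dist c := by
  have hr := hz.bags
  have hb := hz.bound
  have h3 := hz.three_le
  have hl := hL.length
  refine (Runs.forLoop (b := r) (fun k s' =>
      Frame [9, 11, 14, 15, 16, 17, 18, 19, 20] [10] [] [1, 2] s s' ∧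
      I.Consistent IsLen d₀ s'.table ∧
      ∀ j (hj : j < L.length), j < k → I.UpOK s'.table.dist L[j]) ?_ (by omega) ?_ ?_).mono ?_ ?_
  · rintro k s' ⟨hf, -⟩
    rw [hf.nvar 2 (by simp), h.nvar_two]
  · rintro k s₁ hk ⟨hf, hc, hu⟩ h11
    have hkl : k < L.length := by omega
    have e : (NExp.get 9 (.var 11)).eval s₁ = L[k] := by
      simp [NExp.eval, h11, hf.narr 9, h9 k hkl]
    have hB := hz.bag_le L[k]
    refine ⟨⟨by simp only [NExp.Fits]; omega, by rw [show s₁.narr 9 _ = _ from e]; exact hB⟩, ?_⟩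
    rw [e]
    have f1 := hf.setN (x := 14) (by simp) (L[k] : ℕ)
    refine Cmd.wp_mono _ (wp_relax (c := L[k]) (h.frame f1 (by simp) (by simp) (by simp)) hs hz
      (by simp)) ?_
    rintro s₂ ⟨hf₂, ht₂⟩
    have hcons := hc.relaxBag hs (fun _ _ => IsLen.add) L[k]
    have hrel := relaxed_relaxBag hs (fun _ => IsLen.pos) hc L[k]
    have et : (s₂.setN 11 (k + 1)).table = I.relaxBag L[k] s₁.table := ht₂
    refine ⟨⟨(f1.trans (hf₂.weaken (by simp) (by simp) (by simp) (by simp))).setN (by simp) _,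
      ?_, fun j hj hjk => ?_⟩, (hf₂.nvar 11 (by simp)).trans (by simpa using h11)⟩
    · rw [et]; exact hcons
    · rw [et]
      rcases Nat.lt_succ_iff_lt_or_eq.1 hjk with hjk | rfl
      · have hne : L[j] ≠ L[k] := fun h => by
          have := (hL.nodup.getElem_inj_iff).1 h
          omega
        refine hrel.upOK_of_eq hs hne (fun h => ?_) (hu j hj hjk)
        -- The order excludes that an already treated bag is the father of the current one.
        exact absurd h.symm (List.pairwise_iff_getElem.1 hL.order j k hj hkl hjk)
      · exact fun i _ => hrel.ok i
  · exact ⟨(Frame.refl s).setN (by simp) _, ht, by simp⟩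
  · have : (Cmd.setN 14 (.get 9 (.var 11)) ;; relax).time ≤ 2000 := by decide
    nlinarith
  · rintro s' ⟨hf, hc, hu⟩
    refine ⟨hf, hc, fun c => ?_⟩
    obtain ⟨j, hj, rfl⟩ := List.mem_iff_getElem.1 (hL.mem c)
    exact hu j hj (by omega)

/-- After `k` rounds the treated bags are those at positions `j` with `r ≤ j + k`. None of them is a
child of the bag relaxed next, so `Relaxed.sideOK_of_father_ne` keeps them closed. -/
theorem runs_passDown (hs : T.IsSuitable) (h : I.HasInput w s)
    (hz : Sizes n r m B) {d₀ : ℕ → ℝ ×ₗ ℝ} (ht : I.Consistent IsLen d₀ s.table)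
    {L : List (Fin r)} (hL : IsOrder T L) (h9 : Listed (s.narr 9) L)
    (hu : ∀ c, I.UpOK s.table.dist c) :
    Runs B passDown s (4000 * n) fun s' =>
      Frame [9, 11, 14, 15, 16, 17, 18, 19, 20] [10] [] [1, 2] s s' ∧
      I.Consistent IsLen d₀ s'.table ∧ ∀ c k, I.SideOK s'.table.dist c k := by
  have hr := hz.bags
  have hb := hz.bound
  have h3 := hz.three_le
  have hl := hL.length
  refine (Runs.forLoop (b := r) (fun k s' =>
      Frame [9, 11, 14, 15, 16, 17, 18, 19, 20] [10] [] [1, 2] s s' ∧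
      I.Consistent IsLen d₀ s'.table ∧ (∀ c, I.UpOK s'.table.dist c) ∧
      ∀ j (hj : j < L.length), r ≤ j + k → ∀ i, I.SideOK s'.table.dist L[j] i)
      ?_ (by omega) ?_ ?_).mono ?_ ?_
  · rintro k s' ⟨hf, -⟩
    rw [hf.nvar 2 (by simp), h.nvar_two]
  · rintro k s₁ hk ⟨hf, hc, hu, ho⟩ h11
    have hkl : r - 1 - k < L.length := by omega
    have h2 : s₁.nvar 2 = r := by rw [hf.nvar 2 (by simp), h.nvar_two]
    have e : (NExp.get 9 (.sub (.sub (.var 2) (.lit 1)) (.var 11))).eval s₁ = L[r - 1 - k] := by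
      simp [NExp.eval, h11, h2, hf.narr 9, h9 _ hkl]
    have hB := hz.bag_le L[r - 1 - k]
    refine ⟨⟨by simp only [NExp.Fits]; omega, by rw [show s₁.narr 9 _ = _ from e]; exact hB⟩, ?_⟩
    rw [e]
    have f1 := hf.setN (x := 14) (by simp) (L[r - 1 - k] : ℕ)
    refine Cmd.wp_mono _ (wp_relax (c := L[r - 1 - k]) (h.frame f1 (by simp) (by simp) (by simp))
      hs hz (by simp)) ?_
    rintro s₂ ⟨hf₂, ht₂⟩
    have hcons := hc.relaxBag hs (fun _ _ => IsLen.add) L[r - 1 - k]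
    have hrel := relaxed_relaxBag hs (fun _ => IsLen.pos) hc L[r - 1 - k]
    have et : (s₂.setN 11 (k + 1)).table = I.relaxBag L[r - 1 - k] s₁.table := ht₂
    refine ⟨⟨(f1.trans (hf₂.weaken (by simp) (by simp) (by simp) (by simp))).setN (by simp) _,
      ?_, fun c => ?_, fun j hj hjk => ?_⟩, (hf₂.nvar 11 (by simp)).trans (by simpa using h11)⟩
    · rw [et]; exact hcons
    · rw [et]
      by_cases hcl : c = L[r - 1 - k]
      · subst hcl
        exact fun i _ => hrel.ok i
      · exact hrel.upOK_of_eq hs hcl (fun _ => hu _) (hu c)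
    · rw [et]
      by_cases hjk' : j = r - 1 - k
      · subst hjk'
        exact hrel.ok
      · have hlt : r - 1 - k < j := by omega
        have hne : L[j] ≠ L[r - 1 - k] := fun h => by
          have := (hL.nodup.getElem_inj_iff).1 h
          omega
        exact hrel.sideOK_of_father_ne hne
          (List.pairwise_iff_getElem.1 hL.order _ j hkl hj hlt) (hu _) (ho j hj (by omega))
  · exact ⟨(Frame.refl s).setN (by simp) _, ht, hu, fun j hj hjr => by omega⟩
  · have : (Cmd.setN 14 (.get 9 (.sub (.sub (.var 2) (.lit 1)) (.var 11))) ;; relax).time ≤ 2000 := by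
      decide
    nlinarith
  · rintro s' ⟨hf, hc, -, ho⟩
    refine ⟨hf, hc, fun c => ?_⟩
    obtain ⟨j, hj, rfl⟩ := List.mem_iff_getElem.1 (hL.mem c)
    exact ho j hj (by omega)

theorem isLen_pairLen (hw : ∀ e ∈ G.edgeSet, 0 ≤ w e) (u v : Fin n) : IsLen (I.pairLen w u v) := by
  refine ⟨?_, 1, le_rfl, by simp [pairLen]⟩
  simp only [pairLen, ofLex_toLex]
  split_ifs with h
  · exact hw _ h
  · have : 0 ≤ ∑ i, w s(I.src i, I.tgt i) :=
      Finset.sum_nonneg fun i _ => hw _ (I.adj_of_edge i)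
    unfold bigWeight
    linarith

theorem consistent_init (hs : T.IsSuitable) (hw : ∀ e ∈ G.edgeSet, 0 ≤ w e)
    {t : DistTable (ℝ ×ₗ ℝ)} (hwit : ∀ i, t.wit i = 0)
    (ht : ∀ u v c, u ≠ v → u ∈ T.bag c → v ∈ T.bag c → t.dist (I.idx u v c) = I.pairLen w u v) :
    I.Consistent IsLen t.dist t := by
  refine ⟨fun c k => ?_, fun _ => le_rfl, fun i => Or.inl ⟨hwit i, rfl⟩⟩
  have hne : k + 1 ≠ k + 2 := by revert k; decide
  rw [side, ht _ _ _ ((I.vert_injective hs c).ne hne) (I.vert_mem _ _) (I.vert_mem _ _)]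
  exact isLen_pairLen hw _ _

theorem runs_preprocess (hT : T.IsTreeDecomposition G) (hs : T.IsSuitable)
    (hw : ∀ e ∈ G.edgeSet, 0 ≤ w e) (hz : Sizes n r m B) :
    Runs B preprocess (I.initialState w) (16000 * n) fun s => I.HasInput w s ∧
      I.Solved w s.table := by
  have h0 : I.HasInput w (I.initialState w) := ⟨fun _ _ _ => rfl, fun _ _ => rfl, rfl⟩
  refine (Runs.seq (runs_sumWeights h0 hz) fun s₁ ⟨f₁, b₁⟩ => ?_).mono
    (T := 1000 * n + (1000 * n + (1000 * n + (1000 * n + (1000 * n + (2000 * n +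
      (4000 * n + 4000 * n))))))) (by omega) fun _ h => h
  have h₁ := h0.frame f₁ (by simp) (by simp) (by simp)
  refine Runs.seq (runs_countChildren h₁ hz (f₁.narr 8 (by simp))) fun s₂ ⟨f₂, b₂⟩ => ?_
  have h₂ := h₁.frame f₂ (by simp) (by simp) (by simp)
  refine Runs.seq (runs_computeTops hT h₂ hz) fun s₃ ⟨f₃, b₃⟩ => ?_
  have h₃ := h₂.frame f₃ (by simp) (by simp) (by simp)
  refine Runs.seq (runs_initTable h₃ hz) fun s₄ ⟨f₄, b₄⟩ => ?_
  have h₄ := h₃.frame f₄ (by simp) (by simp) (by simp)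
  have e₄ : s₃.rvar 1 = I.bigWeight w := by
    rw [f₃.rvar 1 (by simp), f₂.rvar 1 (by simp), b₁]
  rw [e₄] at b₄
  refine Runs.seq (runs_enterEdges hT hs h₄ hz (by rw [f₄.narr 7 (by simp)]; exact b₃) b₄)
    fun s₅ ⟨f₅, b₅⟩ => ?_
  have h₅ := h₄.frame f₅ (by simp) (by simp) (by simp)
  have e₅ : s₅.narr 8 = s₂.narr 8 := by
    rw [f₅.narr 8 (by simp), f₄.narr 8 (by simp), f₃.narr 8 (by simp)]
  refine Runs.seq (runs_computeOrder h₅ hz (by rw [e₅]; exact b₂)) fun s₆ ⟨f₆, L, hL, b₆⟩ => ?_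
  have h₆ := h₅.frame f₆ (by simp) (by simp) (by simp)
  have e₆ : s₆.table = s₅.table := by
    simp only [State.table, f₆.rarr 1 (by simp), f₆.rarr 2 (by simp), f₆.narr 10 (by simp)]
  have w₅ : ∀ i, s₅.table.wit i = 0 := fun i => by
    have : s₅.narr 10 = (I.initialState w).narr 10 := by
      rw [f₅.narr 10 (by simp), f₄.narr 10 (by simp), f₃.narr 10 (by simp), f₂.narr 10 (by simp),
        f₁.narr 10 (by simp)]
    rw [show s₅.table.wit i = s₅.narr 10 i from rfl, this]
    rfl
  have c₅ := consistent_init hs hw w₅ b₅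
  refine Runs.seq (runs_passUp hs h₆ hz (e₆ ▸ c₅) hL b₆) fun s₇ ⟨f₇, c₇, b₇⟩ => ?_
  have h₇ := h₆.frame f₇ (by simp) (by simp) (by simp)
  refine (runs_passDown hs h₇ hz c₇ hL (by rw [f₇.narr 9 (by simp)]; exact b₆) b₇).mono le_rfl ?_
  rintro s₈ ⟨f₈, c₈, b₈⟩
  -- The initial distances in `Solved` are those present after the edges were entered.
  exact ⟨h₇.frame f₈ (by simp) (by simp) (by simp), ⟨_, c₈, e₆ ▸ b₅⟩, b₈⟩

end InputListing

/-! ## Queries -/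

namespace RealRAM

/-- Distance query. -/
def distanceQuery : Cmd :=
  .ite (.eq (.var 4) (.var 5)) (.setR 0 (.lit 0)) (lookup 4 5 6 10 ;; .setR 0 (.get 1 (.var 10)))

/-- Store in variable `out` the vertex of the bag in variable `y` that differs from the vertices in
variables `u` and `v`. -/
def getThird (u v y out : ℕ) : Cmd :=
  .ite (neither u v (.get 2 (.var y))) (.setN out (.get 2 (.var y)))
    (.ite (neither u v (.get 3 (.var y))) (.setN out (.get 3 (.var y)))
      (.setN out (.get 4 (.var y))))

/-- Intermediate vertex query. -/
def intermediateQuery : Cmd :=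
  lookup 4 5 6 10 ;; .setN 8 (.sub (.get 10 (.var 10)) (.lit 1)) ;; getThird 4 5 8 7

/-- One step of the path extraction. The current vertex is in variable `14`; the stack with height
in variable `12` consists of the vertices in array `11` to be reached one after the other, each with
a bag in array `12` that also contains its predecessor. -/
def pathStep : Cmd :=
  .setN 12 (.sub (.var 12) (.lit 1)) ;; .setN 15 (.get 11 (.var 12)) ;;
  .setN 16 (.get 12 (.var 12)) ;; lookup 14 15 16 10 ;;
  .ite (.eq (.get 10 (.var 10)) (.lit 0))
    (.setN 14 (.var 15) ;; .setN 7 (.add (.var 7) (.lit 1)) ;; .storeN 6 (.var 7) (.var 14))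
    (.setN 8 (.sub (.get 10 (.var 10)) (.lit 1)) ;; getThird 14 15 8 17 ;;
      .storeN 12 (.var 12) (.var 8) ;; .setN 12 (.add (.var 12) (.lit 1)) ;;
      .storeN 11 (.var 12) (.var 17) ;; .storeN 12 (.var 12) (.var 8) ;;
      .setN 12 (.add (.var 12) (.lit 1)))

/-- Repeat path extraction steps until the stack is empty. -/
def pathLoop : Cmd :=
  .loop (.lt (.lit 0) (.var 12)) pathStep

/-- Initialize the path extraction. -/
def pathInit : Cmd :=
  .setN 7 (.lit 0) ;; .setN 14 (.var 4) ;; .storeN 6 (.lit 0) (.var 4) ;;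
  .ite (.eq (.var 4) (.var 5)) (.setN 12 (.lit 0))
    (.storeN 11 (.lit 0) (.var 5) ;; .storeN 12 (.lit 0) (.var 6) ;; .setN 12 (.lit 1))

/-- Shortest path extraction. -/
def pathQuery : Cmd :=
  pathInit ;; pathLoop

end RealRAM

/-! ### Correctness of the queries -/

namespace InputListing

open RealRAM RootedBagTree

variable {n r m : ℕ} {G : SimpleGraph (Fin n)} {T : RootedBagTree n r} {I : InputListing G T m}
  {w : Sym2 (Fin n) → ℝ} {s : State} {B : ℕ} {t : DistTable (ℝ ×ₗ ℝ)}

variable (I w) in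
/-- The data structure: the input and a table. -/
structure Intact (t : DistTable (ℝ ×ₗ ℝ)) (s : State) : Prop where
  input : I.HasInput w s
  table : s.table = t

theorem Intact.frame {ns as xs rs : List ℕ} {s₀ : State} (h : I.Intact w t s₀)
    (hf : Frame ns as xs rs s₀ s) (h1 : ∀ x ∈ ns, 4 ≤ x) (h2 : ∀ A ∈ as, 6 ≤ A)
    (h3 : 10 ∉ as) (h4 : rs = []) : I.Intact w t s := by
  subst h4
  refine ⟨h.input.frame hf h1 h2 (by simp), ?_⟩
  rw [← h.table]
  simp only [State.table, hf.narr 10 h3, hf.rarr 1 (by simp), hf.rarr 2 (by simp)]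

theorem frame_withQuery (s : State) (u v : Fin n) (x : Fin r) :
    Frame [4, 5, 6] [] [] [] s (s.withQuery u v x) :=
  (((Frame.refl s).setN (by simp) _).setN (by simp) _).setN (by simp) _

theorem Intact.withQuery (h : I.Intact w t s) (u v : Fin n) (x : Fin r) :
    I.Intact w t (s.withQuery u v x) :=
  h.frame (frame_withQuery s u v x) (by simp) (by simp) (by simp) rfl

theorem withQuery_four (u v : Fin n) (x : Fin r) : (s.withQuery u v x).nvar 4 = u := by
  simp [State.withQuery]

theorem withQuery_five (u v : Fin n) (x : Fin r) : (s.withQuery u v x).nvar 5 = v := by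
  simp [State.withQuery]

theorem withQuery_six (u v : Fin n) (x : Fin r) : (s.withQuery u v x).nvar 6 = x := by
  simp [State.withQuery]

theorem vert_third (hs : T.IsSuitable) {u v z : Fin n} {c : Fin r} (huv : u ≠ v)
    (hc : T.bag c = {u, v, z}) : I.vert (I.third u v c) c = z := by
  obtain ⟨-, h1, h2⟩ := I.bag_eq_third hs huv (c := c) (by simp [hc]) (by simp [hc])
  have h := I.vert_mem (I.third u v c) c
  rw [hc] at h
  simpa [h1, h2] using h

theorem wp_getThird (hs : T.IsSuitable) (h : I.HasInput w s) (hz : Sizes n r m B)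
    {u v y out : ℕ} {a b z : Fin n} {c : Fin r} (hu : s.nvar u = a) (hv : s.nvar v = b)
    (hy : s.nvar y = c) (hab : a ≠ b) (hc : T.bag c = {a, b, z}) {Q : State → Prop}
    (hQ : Q (s.setN out z)) : (getThird u v y out).wp B Q s := by
  have hz' := vert_third (I := I) hs hab hc
  simp only [getThird, neither, Cmd.wp, Test.Fits, Test.Holds, NExp.Fits, NExp.eval, hu, hv, hy,
    h.narr_two, h.narr_three, h.narr_four, arrayOf_val, hz.vertex_le, hz.bag_le, true_and,
    and_true, Fin.val_inj]
  unfold third at hz'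
  refine ⟨fun h1 => ?_, fun h1 => ⟨fun h2 => ?_, fun h2 => ?_⟩⟩
  · rw [if_pos h1] at hz'
    rwa [hz']
  · rw [if_neg h1, if_pos h2] at hz'
    rwa [hz']
  · rw [if_neg h1, if_neg h2] at hz'
    rwa [hz']

theorem isShortestPath_nil (u : Fin n) : (.nil : G.Walk u u).IsShortestPath w := by
  refine ⟨.nil, fun Q hQ => ?_⟩
  rw [(SimpleGraph.Walk.isPath_iff_nil.1 hQ).eq_nil]

theorem runs_distanceQuery (hT : T.IsTreeDecomposition G) (hs : T.IsSuitable) (hG : G.Connected)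
    (hw : ∀ e ∈ G.edgeSet, 0 ≤ w e) (hz : Sizes n r m B) (ht : I.Solved w t)
    (h : I.Intact w t s) {u v : Fin n} {x : Fin r} (hu : u ∈ T.bag x) (hv : v ∈ T.bag x) :
    Runs B distanceQuery (s.withQuery u v x) 1000 fun s' => I.Intact w t s' ∧
      ∃ P : G.Walk u v, P.IsShortestPath w ∧ s'.rvar 0 = P.weight w := by
  refine (Cmd.wp_sound _ _ _ ?_).mono (by decide) fun _ h => h
  have hi := h.withQuery u v x
  have hvu := hz.vertex_le u
  have hvv := hz.vertex_le v
  refine ⟨by simp only [Test.Fits, NExp.Fits, withQuery_four, withQuery_five]; exact ⟨hvu, hvv⟩,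
    fun hp => ?_, fun hp => ?_⟩
  all_goals simp only [Test.Holds, NExp.eval, withQuery_four, withQuery_five, Fin.val_inj] at hp
  · subst hp
    refine ⟨trivial, hi.frame ((Frame.refl (ns := []) (as := []) (xs := [0]) (rs := []) _).setR
      (by simp) _) (by simp) (by simp) (by simp) rfl, .nil, isShortestPath_nil u, ?_⟩
    simp [RExp.eval, SimpleGraph.Walk.weight]
  · obtain ⟨P, hP, -, hlen⟩ := ht.exists_shortest hT hs hG hw hp hu hv
    refine wp_lookup hi.input hz (withQuery_four u v x) (withQuery_five u v x)
      (withQuery_six u v x) (by simp) (by simp) ?_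
    have hidx := I.idx_lt u v x
    have h1 := hz.bags
    have h2 := hz.bound
    refine ⟨by simp only [RExp.Fits, NExp.Fits, State.setN_nvar, reduceIte]; omega, hi.frame
      ((((Frame.refl (ns := [9, 10]) (as := []) (xs := [0]) (rs := []) _).setN (by simp) _).setN
      (by simp) _).setR (by simp) _) (by simp) (by simp) (by simp) rfl, P, hP, ?_⟩
    have e : P.weight w = (ofLex (t.dist (I.idx u v x))).1 := by rw [← hlen]; rfl
    rw [e, ← hi.table]
    simp [RExp.eval, NExp.eval, State.table]

theorem runs_intermediateQuery (hT : T.IsTreeDecomposition G) (hs : T.IsSuitable)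
    (hG : G.Connected) (hw : ∀ e ∈ G.edgeSet, 0 ≤ w e) (hz : Sizes n r m B) (ht : I.Solved w t)
    (h : I.Intact w t s) {u v : Fin n} {x : Fin r} (hu : u ∈ T.bag x) (hv : v ∈ T.bag x)
    (h2 : ∀ P : G.Walk u v, P.IsShortestPath w → 2 ≤ P.length) :
    Runs B intermediateQuery (s.withQuery u v x) 1000 fun s' => I.Intact w t s' ∧
      ∃ (z : Fin n) (y : Fin r), s'.nvar 7 = z ∧ s'.nvar 8 = y ∧ z ≠ u ∧ z ≠ v ∧
        T.bag y = {u, v, z} ∧ ∃ P : G.Walk u v, P.IsShortestPath w ∧ z ∈ P.support := by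
  -- For `u = v` the empty path is shortest and has no edges, contradicting `h2`.
  have huv : u ≠ v := by
    rintro rfl
    have := h2 .nil (isShortestPath_nil u)
    simp at this
  obtain ⟨c, z, hc, hb, hzu, hzv, hP⟩ := ht.exists_intermediate hT hs hG hw huv hu hv h2
  refine (Cmd.wp_sound _ _ _ ?_).mono (by decide) fun _ h => h
  have hi := h.withQuery u v x
  refine wp_lookup hi.input hz (withQuery_four u v x) (withQuery_five u v x)
      (withQuery_six u v x) (by simp) (by simp) ?_
  have hidx := I.idx_lt u v x
  have h1 := hz.bags
  have h2 := hz.bound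
  have h3 := hz.bag_lt c
  generalize hs₁ : State.setN _ 10 _ = s₁
  have f₁ : Frame [7, 8, 9, 10] [] [] [] (s.withQuery u v x) s₁ :=
    hs₁ ▸ ((Frame.refl _).setN (by simp) _).setN (by simp) _
  have e10 : s₁.nvar 10 = I.idx u v x := by simp [← hs₁]
  have e : s₁.narr 10 (I.idx u v x) = c + 1 := by
    rw [← hc, ← hi.table, f₁.narr 10 (by simp)]; rfl
  have e8 : (NExp.sub (.get 10 (.var 10)) (.lit 1)).eval s₁ = c := by
    simp [NExp.eval, e10, e]
  refine ⟨by simp only [NExp.Fits, NExp.eval, e10, e]; omega, ?_⟩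
  rw [e8]
  have f₂ := f₁.setN (x := 8) (by simp) (c : ℕ)
  refine wp_getThird hs (hi.frame f₂ (by simp) (by simp) (by simp) rfl).input hz (a := u) (b := v)
    (z := z) (c := c) ((f₂.nvar 4 (by simp)).trans (withQuery_four u v x))
    ((f₂.nvar 5 (by simp)).trans (withQuery_five u v x)) (by simp) huv hb ?_
  exact ⟨hi.frame (f₂.setN (x := 7) (by simp) (z : ℕ)) (by simp) (by simp) (by simp) rfl, z, c,
    by simp, by simp, hzu, hzv, hb, hP⟩

/-- From `s` to `s'`, the vertices of `P` after the first one have been appended to the path, which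
consisted of `l` edges before, and the topmost of `p + 1` stack entries has been removed. -/
structure Emits {u v : Fin n} (P : G.Walk u v) (p l : ℕ) (s s' : State) : Prop where
  frame : Frame [7, 8, 9, 10, 12, 14, 15, 16, 17] [6, 11, 12] [] [] s s'
  current : s'.nvar 14 = v
  height : s'.nvar 12 = p
  length : s'.nvar 7 = l + P.length
  path : ∀ i ≤ P.length, s'.narr 6 (l + i) = P.getVert i
  old : ∀ i < l, s'.narr 6 i = s.narr 6 i
  vertices : ∀ i < p, s'.narr 11 i = s.narr 11 i
  bags : ∀ i < p, s'.narr 12 i = s.narr 12 i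

/-- The next vertex to be reached from `u` is `v`, both in bag `x`. -/
structure Awaits (u v : Fin n) (x : Fin r) (p l : ℕ) (s : State) : Prop where
  current : s.nvar 14 = u
  height : s.nvar 12 = p + 1
  length : s.nvar 7 = l
  path : s.narr 6 l = u
  vertex : s.narr 11 p = v
  bag : s.narr 12 p = x

/-- Pops the stack and looks up the pair, which is common to emitting an edge and splitting at a
witness. -/
theorem Awaits.step (hz : Sizes n r m B) (hi : I.Intact w t s) {u v : Fin n}
    {x : Fin r} {p l : ℕ} (h : Awaits u v x p l s) (hp : p + 1 ≤ n)
    {Q : State → Prop} (hQ : ∀ s', Frame [7, 8, 9, 10, 12, 14, 15, 16, 17] [6, 11, 12] [] [] s s' →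
      s'.narr = s.narr → s'.nvar 14 = u → s'.nvar 15 = v → s'.nvar 12 = p → s'.nvar 7 = l →
      s'.nvar 10 = I.idx u v x → s'.narr 10 = t.wit →
      (Cmd.ite (.eq (.get 10 (.var 10)) (.lit 0))
        (.setN 14 (.var 15) ;; .setN 7 (.add (.var 7) (.lit 1)) ;; .storeN 6 (.var 7) (.var 14))
        (.setN 8 (.sub (.get 10 (.var 10)) (.lit 1)) ;; getThird 14 15 8 17 ;;
          .storeN 12 (.var 12) (.var 8) ;; .setN 12 (.add (.var 12) (.lit 1)) ;;
          .storeN 11 (.var 12) (.var 17) ;; .storeN 12 (.var 12) (.var 8) ;;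
          .setN 12 (.add (.var 12) (.lit 1)))).wp B Q s') : pathStep.wp B Q s := by
  have h2 := hz.bound
  have h3 := hz.vertex_le v
  have h4 := hz.bag_le x
  have e12 : (NExp.sub (.var 12) (.lit 1)).eval s = p := by simp [NExp.eval, h.height]
  refine ⟨by simp only [NExp.Fits, h.height]; omega, ?_⟩
  rw [e12]
  have f₁ := (Frame.refl (ns := [7, 8, 9, 10, 12, 14, 15, 16, 17]) (as := [6, 11, 12]) (xs := [])
    (rs := []) s).setN (x := 12) (by simp) p
  refine ⟨by simp [NExp.Fits, NExp.eval, h.vertex]; omega, ?_⟩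
  have e15 : (NExp.get 11 (.var 12)).eval (s.setN 12 p) = v := by simp [NExp.eval, h.vertex]
  rw [e15]
  refine ⟨by simp [NExp.Fits, NExp.eval, h.bag]; omega, ?_⟩
  have e16 : (NExp.get 12 (.var 12)).eval ((s.setN 12 p).setN 15 v) = x := by
    simp [NExp.eval, h.bag]
  rw [e16]
  have f₂ := (f₁.setN (x := 15) (by simp) (v : ℕ)).setN (x := 16) (by simp) (x : ℕ)
  refine wp_lookup (hi.frame f₂ (by simp) (by simp) (by simp) rfl).input hz (a := u) (b := v)
    (c := x) (by simpa using h.current) (by simp) (by simp) (by simp) (by simp) ?_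
  refine hQ _ ((f₂.setN (by simp) _).setN (by simp) _) rfl (by simpa using h.current) (by simp)
    (by simp) (by simpa using h.length) (by simp) ?_
  rw [← hi.table]
  rfl

theorem Expansion.one_le_length {wit : ℕ → ℕ} {u v : Fin n} {x : Fin r} {P : G.Walk u v}
    (h : I.Expansion wit x P) : 1 ≤ P.length := by
  induction h with
  | edge => simp
  | split => rw [SimpleGraph.Walk.length_append]; omega

/-- The expansion of a walk with `k + 1` edges is a binary tree with `k` inner nodes, hence `2 * k +
1` rounds. The rest of the run is a continuation with time `D` and result `Q`, so that the two
halves of a split can be chained within one loop. -/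
theorem runs_pathLoop (hs : T.IsSuitable) (hz : Sizes n r m B) {u v : Fin n} {x : Fin r}
    {P : G.Walk u v} (hP : I.Expansion t.wit x P) {k : ℕ} (hk : P.length = k + 1)
    {p l : ℕ} (hp : p + P.length ≤ n) (hl : l + P.length ≤ n) {s : State}
    (hi : I.Intact w t s) (hA : Awaits u v x p l s) {D : ℕ} {Q : State → Prop}
    (hQ : ∀ s', Emits P p l s s' → Runs B pathLoop s' D Q) :
    Runs B pathLoop s ((2 * k + 1) * (pathStep.time + 4) + D) Q := by
  have hbd := hz.bound
  have h3 := hz.three_le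
  have hbags := hz.bags
  induction hP generalizing k p l s D Q with
  | @edge u v x hadj hu hv hw =>
    obtain rfl : k = 0 := by simpa using hk.symm
    simp only [SimpleGraph.Walk.length_cons, SimpleGraph.Walk.length_nil] at hp hl
    refine (Runs.loop_step (R := Emits (.cons hadj .nil) p l s) ?_ ?_ ?_ hQ).mono ?_ fun _ h => h
    · simp only [Test.Fits, NExp.Fits, hA.height]; omega
    · simp only [Test.Holds, NExp.eval, hA.height]; omega
    · refine hA.step hz hi hp fun s' hf hn h14 h15 h12 h7 h10 hwit => ?_
      have hvB := hz.vertex_le v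
      have hidx := I.idx_lt u v x
      refine ⟨by simp only [Test.Fits, NExp.Fits, NExp.eval, h10, hwit, hw]; omega, fun _ => ?_,
        fun hne => absurd (by simp [Test.Holds, NExp.eval, h10, hwit, hw]) hne⟩
      simp only [Cmd.wp, NExp.Fits, NExp.eval, State.setN_nvar, h15, h7, reduceIte,
        Nat.reduceEqDiff]
      refine ⟨hvB, by omega, by omega, hvB, ((hf.setN (by simp) _).setN (by simp) _).storeN
        (by simp) _ _, by simp, by simp [h12], by simp, ?_, ?_, ?_, ?_⟩
      · intro i hi
        simp only [SimpleGraph.Walk.length_cons, SimpleGraph.Walk.length_nil] at hi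
        have : i = 0 ∨ i = 1 := by omega
        rcases this with rfl | rfl
        · simp [hn, hA.path]
        · simp
      · intro i hi
        simp [hn, show i ≠ l + 1 by omega]
      · intro i hi
        simp [hn]
      · intro i hi
        simp [hn]
    · simp only [Test.cost, NExp.cost]; omega
  | @split u v z x c huv hu hv hw hc hzu hzv P₁ P₂ hP₁ hP₂ ih₁ ih₂ =>
    obtain ⟨a, ha⟩ : ∃ a, P₁.length = a + 1 := ⟨_, (Nat.sub_add_cancel hP₁.one_le_length).symm⟩
    obtain ⟨b, hb⟩ : ∃ b, P₂.length = b + 1 := ⟨_, (Nat.sub_add_cancel hP₂.one_le_length).symm⟩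
    rw [SimpleGraph.Walk.length_append] at hp hl hk
    have hstep : Runs B pathLoop s (Test.cost (.lt (.lit 0) (.var 12)) + 1 + pathStep.time +
        ((2 * a + 1) * (pathStep.time + 4) + ((2 * b + 1) * (pathStep.time + 4) + D))) Q := by
      refine Runs.loop_step (R := fun s' =>
        Frame [7, 8, 9, 10, 12, 14, 15, 16, 17] [6, 11, 12] [] [] s s' ∧
        Awaits u z c (p + 1) l s' ∧ s'.narr 11 p = v ∧ s'.narr 12 p = c ∧
        s'.narr 6 = s.narr 6 ∧ (∀ i < p, s'.narr 11 i = s.narr 11 i) ∧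
        (∀ i < p, s'.narr 12 i = s.narr 12 i)) ?_ ?_ ?_ ?_
      · simp only [Test.Fits, NExp.Fits, hA.height]; omega
      · simp only [Test.Holds, NExp.eval, hA.height]; omega
      · refine hA.step hz hi (by omega) fun s' hf hn h14 h15 h12 h7 h10 hwit => ?_
        have hzB := hz.vertex_le z
        have hcB := hz.bag_lt c
        have hidx := I.idx_lt u v x
        refine ⟨by simp only [Test.Fits, NExp.Fits, NExp.eval, h10, hwit, hw]; omega,
          fun h0 => absurd h0 (by simp [Test.Holds, NExp.eval, h10, hwit, hw]), fun _ => ?_⟩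
        have e8 : (NExp.sub (.get 10 (.var 10)) (.lit 1)).eval s' = c := by
          simp [NExp.eval, h10, hwit, hw]
        refine ⟨by simp only [NExp.Fits, NExp.eval, h10, hwit, hw]; omega, ?_⟩
        rw [e8]
        have f₂ := hf.setN (x := 8) (by simp) (c : ℕ)
        refine wp_getThird hs (hi.frame f₂ (by simp) (by simp) (by simp) rfl).input hz (a := u)
          (b := v) (z := z) (c := c) (by simpa using h14) (by simpa using h15) (by simp) huv hc ?_
        simp only [Cmd.wp, NExp.Fits, NExp.eval, State.setN_nvar, State.storeN_nvar, h12,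
          reduceIte, Nat.reduceEqDiff]
        refine ⟨by omega, by omega, by omega, by omega, by omega, by omega, by omega, by omega,
          ((((((f₂.setN (by simp) _).storeN (by simp) _ _).setN (by simp) _).storeN (by simp)
          _ _).storeN (by simp) _ _).setN (by simp) _), ⟨?_, ?_, ?_, ?_, ?_, ?_⟩, ?_, ?_, ?_, ?_, ?_⟩
        · simp [h14]
        · simp
        · simp [h7]
        · simp [hn, hA.path]
        · simp
        · simp
        · simp [hn, hA.vertex]
        · simp
        · simp [hn]
        · intro i hi
          simp [hn, show i ≠ p + 1 by omega]
        · intro i hi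
          simp [hn, show i ≠ p + 1 by omega, show i ≠ p by omega]
      · rintro s₁ ⟨f₁, hA₁, hv₁, hx₁, h6₁, h11₁, h12₁⟩
        -- The stack is one higher while `P₁` is emitted; the height bound still holds because `P₂`
        -- has at least one edge.
        refine ih₁ ha (by omega) (by omega) (hi.frame f₁ (by simp) (by simp) (by simp) rfl) hA₁
          fun s₂ hE₂ => ?_
        have hA₂ : Awaits z v c p (l + P₁.length) s₂ :=
          ⟨hE₂.current, hE₂.height, hE₂.length, by simpa using hE₂.path _ le_rfl,
            (hE₂.vertices p (by omega)).trans hv₁, (hE₂.bags p (by omega)).trans hx₁⟩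
        have f₂ := f₁.trans hE₂.frame
        refine ih₂ hb (by omega) (by omega) (hi.frame f₂ (by simp) (by simp) (by simp) rfl) hA₂
          fun s₃ hE₃ => hQ s₃ ⟨f₂.trans hE₃.frame, hE₃.current, hE₃.height, ?_, ?_, ?_, ?_, ?_⟩
        · rw [hE₃.length, SimpleGraph.Walk.length_append, Nat.add_assoc]
        · intro i hi
          rw [SimpleGraph.Walk.length_append] at hi
          rw [SimpleGraph.Walk.getVert_append]
          split_ifs with hlt
          · rw [hE₃.old _ (by omega), hE₂.path i hlt.le]
          · rw [← hE₃.path (i - P₁.length) (by omega)]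
            congr 1
            omega
        · intro i hi
          rw [hE₃.old _ (by omega), hE₂.old _ hi, h6₁]
        · intro i hi
          rw [hE₃.vertices _ hi, hE₂.vertices _ (by omega), h11₁ _ hi]
        · intro i hi
          rw [hE₃.bags _ hi, hE₂.bags _ (by omega), h12₁ _ hi]
    refine hstep.mono ?_ fun _ h => h
    -- One round for the split, `2 * a + 1` and `2 * b + 1` for the halves: together `2 * k + 1`.
    obtain rfl : k = a + b + 1 := by omega
    simp only [Test.cost, NExp.cost]
    apply le_of_eq
    ring

theorem runs_pathQuery (hT : T.IsTreeDecomposition G) (hs : T.IsSuitable)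
    (hG : G.Connected) (hw : ∀ e ∈ G.edgeSet, 0 ≤ w e) (hz : Sizes n r m B) (ht : I.Solved w t)
    (h : I.Intact w t s) {u v : Fin n} {x : Fin r} (hu : u ∈ T.bag x) (hv : v ∈ T.bag x) :
    ∃ P : G.Walk u v, P.IsShortestPath w ∧
      Runs B pathQuery (s.withQuery u v x) (2000 * (P.length + 1)) fun s' => I.Intact w t s' ∧
        s'.nvar 7 = P.length ∧ ∀ i ≤ P.length, s'.narr 6 i = P.getVert i := by
  have hi := h.withQuery u v x
  have hvu := hz.vertex_le u
  have hvv := hz.vertex_le v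
  have hxB := hz.bag_le x
  have hbd := hz.bound
  have h4 : (s.withQuery u v x).nvar 4 = u := withQuery_four u v x
  have h5 : (s.withQuery u v x).nvar 5 = v := withQuery_five u v x
  have h6 : (s.withQuery u v x).nvar 6 = x := withQuery_six u v x
  generalize s.withQuery u v x = s₀ at *
  have ftime : pathStep.time + 4 ≤ 500 := by decide
  have itime : pathInit.time ≤ 100 := by decide
  by_cases huv : u = v
  · subst huv
    refine ⟨.nil, (isShortestPath_nil u),
      (Runs.seq (Cmd.wp_sound (B := B) pathInit (fun s' =>
        Frame [7, 12, 14] [6] [] [] s₀ s' ∧ s'.nvar 12 = 0 ∧ s'.nvar 7 = 0 ∧ s'.narr 6 0 = u)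
        _ ?_) fun s₁ h₁ => Runs.loop_done ?_ ?_ ?_).mono ?_ fun _ h => h⟩
    · simp only [pathInit, Cmd.wp, NExp.Fits, NExp.eval, State.setN_nvar, State.storeN_nvar,
        Test.Fits, Test.Holds, h4, h5, reduceIte, Nat.reduceEqDiff, not_true_eq_false,
        false_imp_iff, true_imp_iff, and_true]
      exact ⟨Nat.zero_le _, hvu, Nat.zero_le _, hvu, ⟨hvu, hvu⟩, Nat.zero_le _,
        (((((Frame.refl s₀).setN (by simp) _).setN (by simp) _).storeN (by simp) _ _).setN
        (by simp) _), by simp⟩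
    · simp only [Test.Fits, NExp.Fits, h₁.2.1]; omega
    · simp only [Test.Holds, NExp.eval, h₁.2.1]; omega
    · refine ⟨hi.frame h₁.1 (by simp) (by simp) (by simp) rfl, h₁.2.2.1, fun i hi => ?_⟩
      obtain rfl : i = 0 := by simpa using hi
      simpa using h₁.2.2.2
    · simp only [Test.cost, NExp.cost, SimpleGraph.Walk.length_nil]; omega
  · obtain ⟨P, hP, hE, -⟩ := ht.exists_shortest hT hs hG hw huv hu hv
    obtain ⟨k, hk⟩ : ∃ k, P.length = k + 1 := ⟨_, (Nat.sub_add_cancel hE.one_le_length).symm⟩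
    -- A path has fewer than `n` edges, which bounds stack height and output addresses.
    have hlt : P.length < n := by simpa using hP.1.length_lt
    refine ⟨P, hP, (Runs.seq (Cmd.wp_sound (B := B) pathInit (fun s' =>
        Frame [7, 12, 14] [6, 11, 12] [] [] s₀ s' ∧ Awaits u v x 0 0 s') _ ?_) fun s₁ h₁ =>
      runs_pathLoop hs hz hE hk (by omega) (by omega)
        (hi.frame h₁.1 (by simp) (by simp) (by simp) rfl) h₁.2 (D := 10)
        fun s₂ h₂ => (Runs.loop_done ?_ ?_ ?_).mono ?_ fun _ h => h).mono ?_ fun _ h => h⟩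
    · have huv' : (u : ℕ) ≠ v := fun h => huv (Fin.ext h)
      simp only [pathInit, Cmd.wp, NExp.Fits, NExp.eval, State.setN_nvar, State.storeN_nvar,
        Test.Fits, Test.Holds, h4, h5, h6, reduceIte, Nat.reduceEqDiff, huv', not_false_eq_true,
        false_imp_iff, true_imp_iff, true_and]
      refine ⟨Nat.zero_le _, hvu, Nat.zero_le _, hvu, ⟨hvu, hvv⟩, Nat.zero_le _, hvv,
        Nat.zero_le _, hxB, by omega,
        ((((((Frame.refl s₀).setN (by simp) _).setN (by simp) _).storeN (by simp) _ _).storeN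
        (by simp) _ _).storeN (by simp) _ _).setN (by simp) _, ?_, ?_, ?_, ?_, ?_, ?_⟩ <;> simp
    · simp only [Test.Fits, NExp.Fits, h₂.height]; omega
    · simp only [Test.Holds, NExp.eval, h₂.height]; omega
    · refine ⟨(hi.frame h₁.1 (by simp) (by simp) (by simp) rfl).frame h₂.frame (by simp) (by simp)
        (by simp) rfl, by simpa using h₂.length, fun i hi => by simpa using h₂.path i hi⟩
    · simp only [Test.cost, NExp.cost]; omega
    · have : (2 * k + 1) * (pathStep.time + 4) ≤ (2 * k + 1) * 500 := Nat.mul_le_mul_left _ ftime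
      omega

end InputListing

/-- There are four fixed programs (preprocessing, distance query, intermediate vertex query, path
extraction) and a constant `C`. On every input, `Inv` describes the memory states in which the data
structure is intact: preprocessing leads to such a state, and every query can be asked in every such
state and leads to such a state again, so that any sequence of queries can be asked.
All runs satisfy the word and address bound `C * n`, whence linear space.
Results: the distance in real variable `0`; the intermediate vertex and the bag in integer variables
`7` and `8`; the extracted path as its length in integer variable `7` and its vertices, in order, in
integer array `6`. -/
theorem mainTheorem8 :
    ∃ (preprocess distanceQuery intermediateQuery pathQuery : RealRAM.Cmd) (C : ℕ),
      ∀ (n m r : ℕ) (G : SimpleGraph (Fin n)) (w : Sym2 (Fin n) → ℝ) (T : RootedBagTree n r)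
        (I : InputListing G T m),
        G.Connected → (∀ e ∈ G.edgeSet, 0 ≤ w e) → T.IsTreeDecomposition G → T.IsSuitable →
        ∃ Inv : RealRAM.State → Prop,
          (∃ (t : ℕ) (s : RealRAM.State), t ≤ C * n ∧
            RealRAM.Exec (C * n) preprocess (I.initialState w) t s ∧ Inv s) ∧
          ∀ s : RealRAM.State, Inv s →
            ∀ (X : Fin r) (u v : Fin n), u ∈ T.bag X → v ∈ T.bag X →
              (∃ (t : ℕ) (s' : RealRAM.State), t ≤ C ∧
                RealRAM.Exec (C * n) distanceQuery (s.withQuery u v X) t s' ∧ Inv s' ∧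
                ∃ P : G.Walk u v, P.IsShortestPath w ∧ s'.rvar 0 = P.weight w) ∧
              ((∀ P : G.Walk u v, P.IsShortestPath w → 2 ≤ P.length) →
                ∃ (t : ℕ) (s' : RealRAM.State) (z : Fin n) (Y : Fin r), t ≤ C ∧
                  RealRAM.Exec (C * n) intermediateQuery (s.withQuery u v X) t s' ∧ Inv s' ∧
                  s'.nvar 7 = z ∧ s'.nvar 8 = Y ∧
                  z ≠ u ∧ z ≠ v ∧ T.bag Y = {u, v, z} ∧
                  ∃ P : G.Walk u v, P.IsShortestPath w ∧ z ∈ P.support) ∧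
              (∃ P : G.Walk u v, P.IsShortestPath w ∧
                ∃ (t : ℕ) (s' : RealRAM.State), t ≤ C * (P.length + 1) ∧
                  RealRAM.Exec (C * n) pathQuery (s.withQuery u v X) t s' ∧ Inv s' ∧
                  s'.nvar 7 = P.length ∧
                  ∀ i : ℕ, i ≤ P.length → s'.narr 6 i = P.getVert i) := by
  open InputListing RealRAM in
  refine ⟨preprocess, distanceQuery, intermediateQuery, pathQuery, 16000,
    fun n m r G w T I hG hw hT hs => ?_⟩
  have hr := hs.card_nodes_le hT
  have h3 := hs.three_le
  have hz : Sizes n r m (16000 * n) := ⟨h3, hr, I.card_edges_le hT hs, by omega⟩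
  obtain ⟨t₀, s₀, ht₀, hrun, hin, hsol⟩ := runs_preprocess hT hs hw hz (I := I)
  -- The invariant fixes the solved table; queries write only to scratch and output memory, so it
  -- persists through any sequence of them.
  refine ⟨I.Intact w s₀.table, ⟨t₀, s₀, ht₀, hrun, hin, rfl⟩, fun s h x u v hu hv => ⟨?_, ?_, ?_⟩⟩
  · obtain ⟨t, s', ht, hrun, h', hP⟩ := runs_distanceQuery hT hs hG hw hz hsol h hu hv
    exact ⟨t, s', ht.trans (by norm_num), hrun, h', hP⟩
  · intro h2
    obtain ⟨t, s', ht, hrun, h', z, y, hzy⟩ :=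
      runs_intermediateQuery hT hs hG hw hz hsol h hu hv h2
    exact ⟨t, s', z, y, ht.trans (by norm_num), hrun, h', hzy⟩
  · obtain ⟨P, hP, t, s', ht, hrun, h', h7, h6⟩ := runs_pathQuery hT hs hG hw hz hsol h hu hv
    exact ⟨P, hP, t, s', ht.trans (by omega), hrun, h', h7, h6⟩
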